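/- Let $T>0$, let $r,\rho,\sigma\in L^\infty(0,T)$ be deterministic with $0<\sigma_*<\sigma(t)<\sigma^*<\infty$, let $\lambda\in(0,1)$, $v_0>0$, $I_0>0$, $\bar\sigma\in\mathbb R$ be constants, and let $W$ be a Brownian motion with respect to a filtration on a probability space. Let $S$ be an adapted continuous solution on $[0,T]$ of $$dS_t=\rho(t)S_t\,dt+\sigma(t)S_t\,dW_t,\qquad S_0>0\ \text{a.s.}$$ For $N\ge 1$ put $\Delta t=T/N$, $t_n=n\Delta t$, and define $$v^{(N)}_0=v_0,\quad v^{(N)}_n=\lambda v^{(N)}_{n-1}+\frac{1-\lambda}{\Delta t}\Big(\frac{S_{t_n}}{S_{t_{n-1}}}-1\Big)^2,\qquad w^{(N)}_n=\frac{\bar\sigma}{\sqrt{v^{(N)}_n}} .$$ The discrete-time volatility target index is defined by $\tilde I^{(N)}_0=I_0$ and $$\frac{\tilde I^{(N)}_{t_n}}{\tilde I^{(N)}_{t_{n-1}}}=1+(1-w^{(N)}_{n-1})\int_{t_{n-1}}^{t_n}r(t)\,dt+w^{(N)}_{n-1}\Big(\frac{S_{t_n}}{S_{t_{n-1}}}-1\Big),$$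 with $\tilde I^{(N)}_t=\tilde I^{(N)}_{t_n}$ for $t\in[t_n,t_{n+1})$. The continuous-time volatility target index is the adapted continuous solution $I^{(N)}$ of $$\frac{dI^{(N)}_t}{I^{(N)}_t}=(1-w^{(N)}_{n-1})\,r(t)\,dt+w^{(N)}_{n-1}\frac{dS_t}{S_t}\quad(t\in[t_{n-1},t_n)),\qquad I^{(N)}_0=I_0 .$$ Then $I^{(N)}_T>0$ almost surely for every $N\ge1$, $\mathbb P(\tilde I^{(N)}_T>0)\to1$ as $N\to\infty$, and, with the convention $\log x:=\log|x|$ for $x<0$ and $\log 0:=0$ (which matters only on the event $\{\tilde I^{(N)}_T\le 0\}$, whose probability tends to $0$, and on null sets), $$\log\tilde I^{(N)}_T-\log I^{(N)}_T\longrightarrow 0\quad\text{in distribution as }N\to\infty .$$ Moreover $\mathbb E[f(\log\tilde I^{(N)}_T)]-\mathbb E[f(\log I^{(N)}_T)]\to0$ for every bounded continuous $f:\mathbb R\to\mathbb R$, and the two indices have the same limiting distribution: for every probability measure $\nu$ on $\mathbb R$, $\tilde I^{(N)}_T\to\nu$ in distribution if and only if $I^{(N)}_T\to\nu$ in distribution.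 -/

import Mathlib

open MeasureTheory ProbabilityTheory Filter Topology
open scoped NNReal ENNReal BoundedContinuousFunction

noncomputable section

namespace VolTarget

variable {Ω : Type*} {mΩ : MeasurableSpace Ω}

/-- `W` is a standard one-dimensional Brownian motion relative to the filtration `𝓕`: it is a
Brownian motion, it is adapted, and its increments after time `s` are independent of `𝓕 s`. -/
structure IsFilteredBrownian (𝓕 : Filtration ℝ≥0 mΩ) (W : ℝ≥0 → Ω → ℝ) (P : Measure Ω) :
    Prop where
  isBrownian : IsBrownianReal W P
  adapted : ∀ t, Measurable[𝓕 t] (W t)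
  indep : ∀ s t, s ≤ t →
    Indep (MeasurableSpace.comap (fun ω => W t ω - W s ω) inferInstance) (𝓕 s) P

/-- A simple (elementary predictable) process
`∑_{i < len} ξ_i 1_{(τ_i, τ_{i+1}]}`, with deterministic times `τ_0 ≤ τ_1 ≤ ⋯` and bounded
`𝓕 τ_i`-measurable coefficients `ξ_i`. -/
structure SimpleProcess (𝓕 : Filtration ℝ≥0 mΩ) where
  len : ℕ
  time : ℕ → ℝ≥0
  coeff : ℕ → Ω → ℝ
  monotone_time : Monotone time
  measurable_coeff : ∀ i, Measurable[𝓕 (time i)] (coeff i)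
  bounded_coeff : ∃ C : ℝ, ∀ i ω, |coeff i ω| ≤ C

/-- The value of a simple process at time `s`. -/
def SimpleProcess.eval {𝓕 : Filtration ℝ≥0 mΩ} (V : SimpleProcess 𝓕) (s : ℝ≥0) (ω : Ω) : ℝ :=
  ∑ i ∈ Finset.range V.len,
    (Set.Ioc (V.time i) (V.time (i + 1))).indicator (fun _ => V.coeff i ω) s

/-- The stochastic integral `∫_0^t V dW` of a simple process. -/
def SimpleProcess.integral {𝓕 : Filtration ℝ≥0 mΩ} (V : SimpleProcess 𝓕) (W : ℝ≥0 → Ω → ℝ)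
    (t : ℝ≥0) (ω : Ω) : ℝ :=
  ∑ i ∈ Finset.range V.len,
    V.coeff i ω * (W (min (V.time (i + 1)) t) ω - W (min (V.time i) t) ω)

/-- `Y` is (a version of) the Itô integral process `Y_t = ∫_0^t H_s dW_s`, `0 ≤ t ≤ T`:
there are simple processes `V_n` such that `∫_0^T |V_n - H|² ds → 0` in probability and
`∫_0^t V_n dW → Y_t` in probability, uniformly in `t ∈ [0, T]`. -/
structure IsItoIntegral (𝓕 : Filtration ℝ≥0 mΩ) (W : ℝ≥0 → Ω → ℝ) (P : Measure Ω)
    (T : ℝ≥0) (H Y : ℝ≥0 → Ω → ℝ) : Prop where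
  aestronglyMeasurable :
    AEStronglyMeasurable (fun p : ℝ × Ω => H p.1.toNNReal p.2)
      ((volume.restrict (Set.Icc (0 : ℝ) T)).prod P)
  approx : ∃ V : ℕ → SimpleProcess 𝓕,
    (∀ ε : ℝ≥0∞, 0 < ε →
      Tendsto (fun n => P {ω | ε ≤ ∫⁻ s in Set.Icc (0 : ℝ) T,
        ‖(V n).eval s.toNNReal ω - H s.toNNReal ω‖ₑ ^ 2}) atTop (𝓝 0)) ∧
    (∀ ε : ℝ, 0 < ε →
      Tendsto (fun n => P {ω | ∃ t ≤ T, ε ≤ |(V n).integral W t ω - Y t ω|}) atTop (𝓝 0))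

/-- `X` is an Itô process on `[0, T]` with stochastic differential `dX_t = b_t dt + h_t dW_t`:
it is adapted with (almost surely) continuous paths and `X_t = X_0 + ∫_0^t b_s ds + ∫_0^t h_s dW_s`. -/
structure HasItoDifferential (𝓕 : Filtration ℝ≥0 mΩ) (W : ℝ≥0 → Ω → ℝ) (P : Measure Ω)
    (T : ℝ≥0) (b h X : ℝ≥0 → Ω → ℝ) : Prop where
  adapted : ∀ t ≤ T, Measurable[𝓕 t] (X t)
  continuousOn : ∀ᵐ ω ∂P, ContinuousOn (fun t => X t ω) (Set.Icc 0 T)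
  integrableOn : ∀ᵐ ω ∂P, IntegrableOn (fun s : ℝ => b s.toNNReal ω) (Set.Icc (0 : ℝ) T)
  isItoIntegral : IsItoIntegral 𝓕 W P T h
    (fun t ω => X t ω - X 0 ω - ∫ s in (0 : ℝ)..t, b s.toNNReal ω)

/-- The risky asset: a solution of `dS_t = ρ(t) S_t dt + σ(t) S_t dW_t` on `[0, T]` with
positive initial value. -/
structure IsStock (𝓕 : Filtration ℝ≥0 mΩ) (W : ℝ≥0 → Ω → ℝ) (P : Measure Ω) (T : ℝ≥0)
    (ρ σ : ℝ → ℝ) (S : ℝ≥0 → Ω → ℝ) : Prop where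
  pos_zero : ∀ᵐ ω ∂P, 0 < S 0 ω
  sde : HasItoDifferential 𝓕 W P T (fun t ω => ρ t * S t ω) (fun t ω => σ t * S t ω) S

/-- The observation window size `Δt = T / N`. -/
def window (T : ℝ≥0) (N : ℕ) : ℝ≥0 := T / N

/-- The observation times `t_n = n Δt`. -/
def obsTime (T : ℝ≥0) (N n : ℕ) : ℝ≥0 := n * window T N

/-- The simple return `S_{t_{n+1}} / S_{t_n} - 1` of the risky asset. -/
def simpleReturn (T : ℝ≥0) (S : ℝ≥0 → Ω → ℝ) (N n : ℕ) (ω : Ω) : ℝ :=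
  S (obsTime T N (n + 1)) ω / S (obsTime T N n) ω - 1

/-- The realised annual variance `v_n`:
`v_n = lam v_{n-1} + (1 - lam) / Δt * (S_{t_n} / S_{t_{n-1}} - 1)²`, started at `v₀`. -/
def realisedVariance (T : ℝ≥0) (lam v₀ : ℝ) (S : ℝ≥0 → Ω → ℝ) (N : ℕ) : ℕ → Ω → ℝ
  | 0, _ => v₀
  | n + 1, ω => lam * realisedVariance T lam v₀ S N n ω
      + (1 - lam) / (window T N : ℝ) * simpleReturn T S N n ω ^ 2

/-- The risky asset leverage `w_n = σbar / √v_n`. -/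
def leverage (T : ℝ≥0) (lam v₀ σbar : ℝ) (S : ℝ≥0 → Ω → ℝ) (N n : ℕ) (ω : Ω) : ℝ :=
  σbar / √(realisedVariance T lam v₀ S N n ω)

/-- The discrete time volatility target index at the observation times `t_n`:
`Ĩ_{t_n} / Ĩ_{t_{n-1}} = 1 + (1 - w_{n-1}) ∫_{t_{n-1}}^{t_n} r dt
  + w_{n-1} (S_{t_n} / S_{t_{n-1}} - 1)`. -/
def discreteIndexAt (T : ℝ≥0) (lam v₀ σbar I₀ : ℝ) (r : ℝ → ℝ) (S : ℝ≥0 → Ω → ℝ) (N : ℕ) :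
    ℕ → Ω → ℝ
  | 0, _ => I₀
  | n + 1, ω => discreteIndexAt T lam v₀ σbar I₀ r S N n ω *
      (1 + (1 - leverage T lam v₀ σbar S N n ω)
          * (∫ t in (obsTime T N n : ℝ)..(obsTime T N (n + 1)), r t)
        + leverage T lam v₀ σbar S N n ω * simpleReturn T S N n ω)

/-- The discrete time volatility target index `Ĩ_t`, constant on each `[t_n, t_{n+1})`. -/
def discreteIndex (T : ℝ≥0) (lam v₀ σbar I₀ : ℝ) (r : ℝ → ℝ) (S : ℝ≥0 → Ω → ℝ) (N : ℕ)
    (t : ℝ≥0) (ω : Ω) : ℝ :=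
  discreteIndexAt T lam v₀ σbar I₀ r S N ⌊t / window T N⌋₊ ω

/-- The leverage in force at time `t`, equal to `w_{n-1}` for `t ∈ [t_{n-1}, t_n)`. -/
def leverageAt (T : ℝ≥0) (lam v₀ σbar : ℝ) (S : ℝ≥0 → Ω → ℝ) (N : ℕ) (t : ℝ≥0) (ω : Ω) : ℝ :=
  leverage T lam v₀ σbar S N ⌊t / window T N⌋₊ ω

/-- `I` is the continuous time volatility target index: `I_0 = I₀` and
`dI_t / I_t = (1 - w_{n-1}) r(t) dt + w_{n-1} dS_t / S_t` for `t ∈ [t_{n-1}, t_n)`,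
where `dS_t = ρ(t) S_t dt + σ(t) S_t dW_t`. -/
structure IsContinuousIndex (𝓕 : Filtration ℝ≥0 mΩ) (W : ℝ≥0 → Ω → ℝ) (P : Measure Ω)
    (T : ℝ≥0) (lam v₀ σbar I₀ : ℝ) (r ρ σ : ℝ → ℝ) (S : ℝ≥0 → Ω → ℝ) (N : ℕ)
    (I : ℝ≥0 → Ω → ℝ) : Prop where
  initial : ∀ᵐ ω ∂P, I 0 ω = I₀
  sde : HasItoDifferential 𝓕 W P T
    (fun t ω => (1 - leverageAt T lam v₀ σbar S N t ω) * r t * I t ω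
      + leverageAt T lam v₀ σbar S N t ω * I t ω / S t ω * (ρ t * S t ω))
    (fun t ω => leverageAt T lam v₀ σbar S N t ω * I t ω / S t ω * (σ t * S t ω))
    I

end VolTarget

end

/-! Both logarithms are sums over the observation windows and are compared window by window. Let `w`
be the leverage at `t_k`, `g` the increment of `J = ∫ σ dW` over the window, and `R`, `D`, `s` the
integrals of `r`, `ρ`, `σ²`. The linear equations have explicit solutions: the simple return is `exp
(D + g - s/2) - 1` (`IsMarket.simpleReturn_eq`) and `log I` grows by `(1-w) R + w D + w g - w² s/2`
(`IsMarket.index_eq`). A Taylor expansion of the logarithm of the discrete growth factor gives the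
same growth plus `(w - w²)/2 * (g² - s)` plus a third order remainder (`log_growth_expansion`). As
`w` is known at `t_k` while `g` is Gaussian and independent of the past, the extra terms are
martingale differences with second moment of order `N⁻²`. Their sum is of order `N^(-1/2)` in `L²`,
and the remainders add up to order `N^(-1/2)` in mean.

This needs a bound on the fourth moment of `1 + |w|` that is uniform in `N` and `n`, that is, a
bound on the mean of `v⁻²` for the realised variance `v`. The variance `v` retains a fixed share of
each of the last five squared returns divided by `Δt`. If `v ≤ 4^(-j)`, all five returns are small;
given the past each is so with probability of order `2^(-j)`, because a Gaussian density is bounded.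
The resulting `32^(-j)` beats the weight `16^j` (`IsMarket.exists_lintegral_inv_sq_le`).

The explicit solution (`HasItoDifferential.ae_eq_mul_exp`) is obtained without Itô's formula, for
bounded measurable coefficients and Itô integrals known only as limits in probability of simple
integrals. Multiply the solution `X` by `E = exp (-logGrowth)` and telescope `E X` along dyadic
partitions. To second order there remain compensated squares of increments of `J`, the error of
freezing the drift, and the error of replacing the integrand of `X` by `w X σ` with `X` frozen at
the left end of each block. The first vanish by orthogonality, the second by continuity of `X`, the
third by a Lenglart inequality, which bounds a martingale transform in probability by its bracket
and passes from simple processes to the limit (`IsItoIntegral.lintegral_min_blockError_le`). Almost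
surely along a subsequence everything vanishes, so `E X` takes the same value at both ends.

Finally `log I_T` is bounded in `L¹`, hence tight. This turns closeness of the logarithms in
probability into closeness of the indices and of expectations of bounded continuous functions. -/

noncomputable section

namespace VolTarget

/-! ### Discrete martingale transforms: orthogonality, Lenglart and Kolmogorov inequalities. -/

section

variable {Ω : Type*} {mΩ : MeasurableSpace Ω}

/-- Centred square integrable innovations `ζ k` with variances `c k`, relative to a discrete
filtration. -/
structure IsNoise (𝒢 : Filtration ℕ mΩ) (P : Measure Ω) (ζ : ℕ → Ω → ℝ) (c : ℕ → ℝ) : Prop where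
  meas : ∀ k, Measurable[𝒢 (k + 1)] (ζ k)
  indep : ∀ k, Indep (MeasurableSpace.comap (ζ k) inferInstance) (𝒢 k) P
  memLp : ∀ k, MemLp (ζ k) 2 P
  mean : ∀ k, ∫ ω, ζ k ω ∂P = 0
  var : ∀ k, ∫ ω, ζ k ω ^ 2 ∂P = c k

variable {𝒢 : Filtration ℕ mΩ} {P : Measure Ω} {ζ ξ : ℕ → Ω → ℝ} {c : ℕ → ℝ}

lemma indepFun_of_indep_comap {m : MeasurableSpace Ω} {X Y : Ω → ℝ}
    (h : Indep (MeasurableSpace.comap Y inferInstance) m P) (hX : Measurable[m] X) :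
    IndepFun X Y P :=
  indep_of_indep_of_le_left h.symm hX.comap_le

lemma IsNoise.var_nonneg (h : IsNoise 𝒢 P ζ c) (k : ℕ) : 0 ≤ c k := by
  rw [← h.var k]; positivity

lemma IsNoise.measurable (h : IsNoise 𝒢 P ζ c) (k : ℕ) : Measurable (ζ k) :=
  (h.meas k).mono (𝒢.le _) le_rfl

lemma IsNoise.indepFun (h : IsNoise 𝒢 P ζ c) {k : ℕ} {X : Ω → ℝ} (hX : Measurable[𝒢 k] X) :
    IndepFun X (ζ k) P :=
  indepFun_of_indep_comap (h.indep k) hX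

/-- Independence takes the place of Hölder's inequality: `X²` and `ζ²` are independent and
integrable, so no fourth moments are required. -/
lemma IsNoise.memLp_mul (h : IsNoise 𝒢 P ζ c) {k : ℕ} {X : Ω → ℝ} (hX : Measurable[𝒢 k] X)
    (hX2 : MemLp X 2 P) : MemLp (fun ω => X ω * ζ k ω) 2 P := by
  have hXm : Measurable X := hX.mono (𝒢.le _) le_rfl
  refine (memLp_two_iff_integrable_sq (hXm.mul (h.measurable k)).aestronglyMeasurable).2 ?_
  have h1 : IndepFun (fun ω => X ω ^ 2) (fun ω => ζ k ω ^ 2) P :=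
    (h.indepFun hX).comp (measurable_id.pow_const 2) (measurable_id.pow_const 2)
  have := h1.integrable_mul hX2.integrable_sq (h.memLp k).integrable_sq
  refine this.congr (ae_of_all _ fun ω => ?_)
  simp [mul_pow]

lemma IsNoise.integral_mul_sq (h : IsNoise 𝒢 P ζ c) {k : ℕ} {X : Ω → ℝ}
    (hX : Measurable[𝒢 k] X) :
    ∫ ω, (X ω * ζ k ω) ^ 2 ∂P = c k * ∫ ω, X ω ^ 2 ∂P := by
  have hXm : Measurable X := hX.mono (𝒢.le _) le_rfl
  have h1 : IndepFun (fun ω => X ω ^ 2) (fun ω => ζ k ω ^ 2) P :=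
    (h.indepFun hX).comp (measurable_id.pow_const 2) (measurable_id.pow_const 2)
  have := h1.integral_fun_mul_eq_mul_integral (hXm.pow_const 2).aestronglyMeasurable
    ((h.measurable k).pow_const 2).aestronglyMeasurable
  simp only [mul_pow]
  rw [this, h.var k, mul_comm]

lemma IsNoise.integral_mul (h : IsNoise 𝒢 P ζ c) {k : ℕ} {X : Ω → ℝ}
    (hX : Measurable[𝒢 k] X) : ∫ ω, X ω * ζ k ω ∂P = 0 := by
  have hXm : Measurable X := hX.mono (𝒢.le _) le_rfl
  rw [(h.indepFun hX).integral_fun_mul_eq_mul_integral hXm.aestronglyMeasurable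
    (h.measurable k).aestronglyMeasurable, h.mean k, mul_zero]

lemma IsNoise.measurable_sum (h : IsNoise 𝒢 P ζ c) (hξ : ∀ k, Measurable[𝒢 k] (ξ k)) (m : ℕ) :
    Measurable[𝒢 m] (fun ω => ∑ k ∈ Finset.range m, ξ k ω * ζ k ω) := by
  refine Finset.measurable_fun_sum _ fun k hk => ?_
  have hk' : k + 1 ≤ m := Finset.mem_range.1 hk
  exact ((hξ k).mono (𝒢.mono (Nat.le_of_succ_le hk')) le_rfl).mul
    ((h.meas k).mono (𝒢.mono hk') le_rfl)

lemma IsNoise.memLp_sum (h : IsNoise 𝒢 P ζ c) (hξ : ∀ k, Measurable[𝒢 k] (ξ k))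
    (hξ2 : ∀ k, MemLp (ξ k) 2 P) (m : ℕ) :
    MemLp (fun ω => ∑ k ∈ Finset.range m, ξ k ω * ζ k ω) 2 P :=
  memLp_finsetSum _ fun k _ => h.memLp_mul (hξ k) (hξ2 k)

/-- Orthogonality of martingale differences. -/
lemma IsNoise.integral_sum_sq (h : IsNoise 𝒢 P ζ c) (hξ : ∀ k, Measurable[𝒢 k] (ξ k))
    (hξ2 : ∀ k, MemLp (ξ k) 2 P) (m : ℕ) :
    ∫ ω, (∑ k ∈ Finset.range m, ξ k ω * ζ k ω) ^ 2 ∂P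
      = ∑ k ∈ Finset.range m, c k * ∫ ω, ξ k ω ^ 2 ∂P := by
  induction m with
  | zero => simp
  | succ m ih =>
    have hS := h.memLp_sum hξ hξ2 m
    have hlast := h.memLp_mul (hξ m) (hξ2 m)
    have hcross : ∫ ω, 2 * ((∑ k ∈ Finset.range m, ξ k ω * ζ k ω) * (ξ m ω * ζ m ω)) ∂P = 0 := by
      rw [integral_const_mul]
      have := h.integral_mul (k := m) ((h.measurable_sum hξ m).mul (hξ m))
      simp only [Pi.mul_apply, mul_assoc] at this
      rw [this, mul_zero]
    have hi : Integrable (fun ω =>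
        2 * ((∑ k ∈ Finset.range m, ξ k ω * ζ k ω) * (ξ m ω * ζ m ω))) P :=
      (hS.integrable_mul hlast).const_mul 2
    have e : ∀ ω, (∑ k ∈ Finset.range (m + 1), ξ k ω * ζ k ω) ^ 2
        = (∑ k ∈ Finset.range m, ξ k ω * ζ k ω) ^ 2
          + 2 * ((∑ k ∈ Finset.range m, ξ k ω * ζ k ω) * (ξ m ω * ζ m ω))
          + (ξ m ω * ζ m ω) ^ 2 := fun ω => by rw [Finset.sum_range_succ]; ring
    simp_rw [e]
    have hi2 : Integrable (fun ω => (∑ k ∈ Finset.range m, ξ k ω * ζ k ω) ^ 2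
        + 2 * ((∑ k ∈ Finset.range m, ξ k ω * ζ k ω) * (ξ m ω * ζ m ω))) P :=
      hS.integrable_sq.add hi
    rw [integral_add hi2 hlast.integrable_sq, integral_add hS.integrable_sq hi, hcross, ih, h.integral_mul_sq (hξ m),
      Finset.sum_range_succ, add_zero]

/-- The integrand `ξ`, set to zero once the accumulated quadratic variation exceeds `δ`. -/
def stoppedCoeff (ξ : ℕ → Ω → ℝ) (c : ℕ → ℝ) (δ : ℝ) (k : ℕ) (ω : Ω) : ℝ :=
  if c k ≠ 0 ∧ ∑ i ∈ Finset.range (k + 1), c i * ξ i ω ^ 2 ≤ δ then ξ k ω else 0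

lemma measurable_stoppedCoeff (hξ : ∀ k, Measurable[𝒢 k] (ξ k)) (δ : ℝ) (k : ℕ) :
    Measurable[𝒢 k] (stoppedCoeff ξ c δ k) := by
  have hsum : Measurable[𝒢 k] (fun ω => ∑ i ∈ Finset.range (k + 1), c i * ξ i ω ^ 2) := by
    refine Finset.measurable_fun_sum _ fun i hi => ?_
    have hik : i ≤ k := Nat.lt_succ_iff.1 (Finset.mem_range.1 hi)
    exact (((hξ i).mono (𝒢.mono hik) le_rfl).pow_const 2).const_mul _
  by_cases hc : c k ≠ 0
  · have hS : MeasurableSet[𝒢 k] {ω | ∑ i ∈ Finset.range (k + 1), c i * ξ i ω ^ 2 ≤ δ} :=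
      hsum measurableSet_Iic
    have e : stoppedCoeff ξ c δ k
        = {ω | ∑ i ∈ Finset.range (k + 1), c i * ξ i ω ^ 2 ≤ δ}.indicator (ξ k) := by
      ext ω
      simp [stoppedCoeff, hc, Set.indicator_apply]
    rw [e]
    exact (hξ k).indicator hS
  · have e : stoppedCoeff ξ c δ k = fun _ => 0 := by
      ext ω
      simp [stoppedCoeff, hc]
    rw [e]
    exact measurable_const

/-- The test at index `k` already counts the `k`-th term of the bracket. Hence stopping takes effect
before `δ` is exceeded, and there is no overshoot to estimate. -/
lemma sum_stoppedCoeff_le (hc : ∀ k, 0 ≤ c k) {δ : ℝ} (hδ : 0 ≤ δ) (m : ℕ) (ω : Ω) :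
    ∑ k ∈ Finset.range m, c k * stoppedCoeff ξ c δ k ω ^ 2 ≤ δ := by
  induction m with
  | zero => simpa
  | succ m ih =>
    by_cases hm : c m ≠ 0 ∧ ∑ i ∈ Finset.range (m + 1), c i * ξ i ω ^ 2 ≤ δ
    · refine le_trans (Finset.sum_le_sum fun k _ => mul_le_mul_of_nonneg_left ?_ (hc k)) hm.2
      unfold stoppedCoeff
      split_ifs
      · exact le_rfl
      · simpa using sq_nonneg (ξ k ω)
    · rw [Finset.sum_range_succ]
      simp only [stoppedCoeff, if_neg hm]
      simpa [stoppedCoeff] using ih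

lemma stoppedCoeff_mul_eq (hc : ∀ k, 0 ≤ c k) {δ : ℝ} {m : ℕ}
    {ω : Ω} (hζ : ∀ k, c k = 0 → ζ k ω = 0) (hω : ∑ k ∈ Finset.range m, c k * ξ k ω ^ 2 ≤ δ) {k : ℕ} (hk : k < m) :
    stoppedCoeff ξ c δ k ω * ζ k ω = ξ k ω * ζ k ω := by
  by_cases h0 : c k = 0
  · simp [hζ k h0]
  · have h1 : ∑ i ∈ Finset.range (k + 1), c i * ξ i ω ^ 2
        ≤ ∑ i ∈ Finset.range m, c i * ξ i ω ^ 2 :=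
      Finset.sum_le_sum_of_subset_of_nonneg (Finset.range_mono hk)
        fun i _ _ => mul_nonneg (hc i) (sq_nonneg _)
    rw [stoppedCoeff, if_pos ⟨h0, h1.trans hω⟩]

/-- No integrability of `ξ` is assumed: the stopped coefficient is bounded by `√(δ / c k)`. At
degenerate indices `c k = 0` this bound would be lost, which is why `stoppedCoeff` is set to zero
there. -/
lemma memLp_stoppedCoeff [IsFiniteMeasure P] (hc : ∀ k, 0 ≤ c k)
    (hξ : ∀ k, Measurable[𝒢 k] (ξ k)) {δ : ℝ} (hδ : 0 ≤ δ) (k : ℕ) :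
    MemLp (stoppedCoeff ξ c δ k) 2 P := by
  have hm : Measurable (stoppedCoeff ξ c δ k) :=
    (measurable_stoppedCoeff hξ δ k).mono (𝒢.le _) le_rfl
  refine MemLp.of_bound hm.aestronglyMeasurable (√(δ / c k)) (ae_of_all _ fun ω => ?_)
  by_cases h0 : c k = 0
  · simp [stoppedCoeff, h0]
  have hpos : 0 < c k := lt_of_le_of_ne (hc k) (Ne.symm h0)
  have h1 := sum_stoppedCoeff_le (ξ := ξ) hc hδ (k + 1) ω
  have h2 : c k * stoppedCoeff ξ c δ k ω ^ 2 ≤ δ :=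
    le_trans (Finset.single_le_sum (f := fun k => c k * stoppedCoeff ξ c δ k ω ^ 2)
      (fun i _ => mul_nonneg (hc i) (sq_nonneg _)) (Finset.self_mem_range_succ k)) h1
  rw [Real.norm_eq_abs]
  refine Real.abs_le_sqrt ?_
  rw [le_div_iff₀ hpos]; linarith

/-- The orthogonality relation for a sum over a block of indices. -/
lemma IsNoise.integral_sum_Ico_sq (h : IsNoise 𝒢 P ζ c) (hξ : ∀ k, Measurable[𝒢 k] (ξ k))
    (hξ2 : ∀ k, MemLp (ξ k) 2 P) (a b : ℕ) :
    MemLp (fun ω => ∑ k ∈ Finset.Ico a b, ξ k ω * ζ k ω) 2 P ∧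
    ∫ ω, (∑ k ∈ Finset.Ico a b, ξ k ω * ζ k ω) ^ 2 ∂P
      = ∑ k ∈ Finset.Ico a b, c k * ∫ ω, ξ k ω ^ 2 ∂P := by
  refine ⟨memLp_finsetSum _ fun k _ => h.memLp_mul (hξ k) (hξ2 k), ?_⟩
  let ξ' : ℕ → Ω → ℝ := fun k ω => if a ≤ k then ξ k ω else 0
  have hξ' : ∀ k, Measurable[𝒢 k] (ξ' k) := fun k => by
    by_cases hk : a ≤ k
    · simpa [ξ', hk] using hξ k
    · simp [ξ', hk]
  have hξ2' : ∀ k, MemLp (ξ' k) 2 P := fun k => by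
    by_cases hk : a ≤ k
    · simpa [ξ', hk] using hξ2 k
    · simp [ξ', hk]
  have e : ∀ f : ℕ → ℝ, ∑ k ∈ Finset.Ico a b, f k
      = ∑ k ∈ Finset.range b, if a ≤ k then f k else 0 := fun f => by
    rw [← Finset.sum_filter]
    congr 1
    ext k
    simp [and_comm]
  have := h.integral_sum_sq hξ' hξ2' b
  simp_rw [e]
  convert this using 5 with ω k hk k hk
  · simp [ξ']
  · split_ifs with hk
    · simp [ξ', hk]
    · simp [ξ', hk]

lemma IsNoise.ae_eq_zero (h : IsNoise 𝒢 P ζ c) : ∀ᵐ ω ∂P, ∀ k, c k = 0 → ζ k ω = 0 := by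
  rw [ae_all_iff]
  intro k
  by_cases h0 : c k = 0
  · have h1 := (integral_eq_zero_iff_of_nonneg (fun ω => sq_nonneg (ζ k ω))
      (h.memLp k).integrable_sq).1 ((h.var k).trans h0)
    filter_upwards [h1] with ω hω _
    simpa using hω
  · exact ae_of_all _ fun ω h => absurd h h0

/-- A Lenglart type inequality: a martingale transform is small as soon as its bracket is small.
The two parts treat the sum itself and the sum of the squares over blocks. -/
lemma IsNoise.lintegral_min_blocks_le [IsProbabilityMeasure P] (h : IsNoise 𝒢 P ζ c)
    (hξ : ∀ k, Measurable[𝒢 k] (ξ k)) {δ : ℝ} (hδ : 0 ≤ δ)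
    {i : ℕ → ℕ} (hi : Monotone i) (hi0 : i 0 = 0) (m : ℕ) :
    ∫⁻ ω, min (ENNReal.ofReal (∑ k ∈ Finset.range m,
        (∑ j ∈ Finset.Ico (i k) (i (k + 1)), ξ j ω * ζ j ω) ^ 2)) 1 ∂P
      ≤ ENNReal.ofReal δ + P {ω | δ < ∑ j ∈ Finset.range (i m), c j * ξ j ω ^ 2} := by
  have hc := h.var_nonneg
  set ξ' := stoppedCoeff ξ c δ with hξ'def
  have hξ' : ∀ k, Measurable[𝒢 k] (ξ' k) := measurable_stoppedCoeff hξ δ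
  have hξ2' : ∀ k, MemLp (ξ' k) 2 P := memLp_stoppedCoeff hc hξ hδ
  set B := {ω | δ < ∑ j ∈ Finset.range (i m), c j * ξ j ω ^ 2} with hB
  have hBm : MeasurableSet B := by
    refine measurableSet_lt measurable_const (Finset.measurable_fun_sum _ fun j _ => ?_)
    exact (((hξ j).mono (𝒢.le _) le_rfl).pow_const 2).const_mul _
  set A : Ω → ℝ := fun ω => ∑ k ∈ Finset.range m,
        (∑ j ∈ Finset.Ico (i k) (i (k + 1)), ξ' j ω * ζ j ω) ^ 2 with hA
  have hAi : Integrable A P := integrable_finsetSum _ fun k _ =>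
    (h.integral_sum_Ico_sq hξ' hξ2' _ _).1.integrable_sq
  have hsum : ∀ (f : ℕ → ℝ) (n : ℕ), ∑ k ∈ Finset.range n, ∑ j ∈ Finset.Ico (i k) (i (k + 1)), f j
      = ∑ j ∈ Finset.range (i n), f j := fun f n => by
    induction n with
    | zero => simp [hi0]
    | succ n ih =>
      rw [Finset.sum_range_succ, ih, Finset.range_eq_Ico, Finset.range_eq_Ico,
        Finset.sum_Ico_consecutive _ (Nat.zero_le _) (hi (Nat.le_succ n))]
  -- Orthogonality inside each block turns the mean of `A` into the mean of the stopped bracket,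
  -- which is at most `δ` pointwise.
  have hAint : ∫ ω, A ω ∂P ≤ δ := by
    rw [hA, integral_finsetSum _ fun k _ =>
      (h.integral_sum_Ico_sq hξ' hξ2' _ _).1.integrable_sq]
    simp_rw [(h.integral_sum_Ico_sq hξ' hξ2' _ _).2]
    rw [hsum (fun j => c j * ∫ ω, ξ' j ω ^ 2 ∂P)]
    simp_rw [← integral_const_mul]
    rw [← integral_finsetSum _ fun j _ => (hξ2' j).integrable_sq.const_mul _]
    calc _ ≤ ∫ _, δ ∂P := integral_mono
          (integrable_finsetSum _ fun j _ => (hξ2' j).integrable_sq.const_mul _)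
          (integrable_const _) fun ω => sum_stoppedCoeff_le hc hδ _ ω
      _ = δ := by simp
  -- Off `B` the stopping is never active and the sums agree with the stopped ones; on `B` the
  -- truncation at `1` is used.
  calc _ ≤ ∫⁻ ω, (ENNReal.ofReal (A ω) + B.indicator 1 ω) ∂P := by
        refine lintegral_mono_ae ?_
        filter_upwards [h.ae_eq_zero] with ω hζ
        by_cases hω : ω ∈ B
        · refine (min_le_right _ _).trans ?_
          simp [hω]
        · refine (min_le_left _ _).trans (le_trans (le_of_eq ?_) le_self_add)
          have hω' : ∑ j ∈ Finset.range (i m), c j * ξ j ω ^ 2 ≤ δ := not_lt.1 hω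
          rw [hA]
          congr 1
          refine Finset.sum_congr rfl fun k hk => ?_
          congr 1
          refine Finset.sum_congr rfl fun j hj => ?_
          refine (stoppedCoeff_mul_eq hc hζ hω' ?_).symm
          exact lt_of_lt_of_le (Finset.mem_Ico.1 hj).2 (hi (Finset.mem_range.1 hk))
    _ = ENNReal.ofReal (∫ ω, A ω ∂P) + P B := by
        rw [lintegral_add_right _ (measurable_one.indicator hBm), lintegral_indicator_one hBm,
          ofReal_integral_eq_lintegral_ofReal hAi (ae_of_all _ fun ω => by positivity)]
    _ ≤ _ := by gcongr

/-- The block version with the single block `[0, m)`, obtained from `i k = k * m`. -/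
lemma IsNoise.lintegral_min_sum_le [IsProbabilityMeasure P] (h : IsNoise 𝒢 P ζ c)
    (hξ : ∀ k, Measurable[𝒢 k] (ξ k)) {δ : ℝ} (hδ : 0 ≤ δ) (m : ℕ) :
    ∫⁻ ω, min (ENNReal.ofReal ((∑ j ∈ Finset.range m, ξ j ω * ζ j ω) ^ 2)) 1 ∂P
      ≤ ENNReal.ofReal δ + P {ω | δ < ∑ j ∈ Finset.range m, c j * ξ j ω ^ 2} := by
  have := h.lintegral_min_blocks_le hξ hδ (i := fun k => k * m)
    (fun a b hab => Nat.mul_le_mul_right m hab) (by simp) 1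
  simpa using this

/-- Kolmogorov's maximal inequality. -/
lemma IsNoise.measure_max_ge_le [IsProbabilityMeasure P] (h : IsNoise 𝒢 P ζ c) {R : ℝ}
    (hR : 0 < R) (m : ℕ) :
    P {ω | ∃ k ≤ m, R ≤ |∑ j ∈ Finset.range k, ζ j ω|}
      ≤ ENNReal.ofReal ((∑ j ∈ Finset.range m, c j) / R ^ 2) := by
  classical
  let good : ℕ → Set Ω := fun k => {ω | ∀ l ≤ k, |∑ j ∈ Finset.range l, ζ j ω| < R}
  -- The transform by `ξ` is the partial sum stopped at its first passage above `R`. It keeps the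
  -- value reached there, so at time `m` it still has modulus at least `R` on the event in question,
  -- and Chebyshev's inequality applies.
  let ξ : ℕ → Ω → ℝ := fun k => (good k).indicator 1
  have hone : ∀ k, Measurable[𝒢 k] (fun ω => ∑ j ∈ Finset.range k, ζ j ω) := fun k => by
    simpa using h.measurable_sum (ξ := fun _ _ => 1) (fun _ => measurable_const) k
  have hgood : ∀ k, MeasurableSet[𝒢 k] (good k) := fun k => by
    have : good k = ⋂ l, ⋂ (_ : l ≤ k), {ω | |∑ j ∈ Finset.range l, ζ j ω| < R} := by
      ext ω; simp [good]
    rw [this]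
    refine MeasurableSet.iInter fun l => MeasurableSet.iInter fun hl => ?_
    have := ((hone l).mono (𝒢.mono hl) le_rfl)
    exact measurableSet_lt (measurable_abs.comp this) measurable_const
  have hξ : ∀ k, Measurable[𝒢 k] (ξ k) := fun k =>
    Measurable.indicator (m := 𝒢 k) (@measurable_const _ _ _ (𝒢 k) 1) (hgood k)
  have hξ2 : ∀ k, MemLp (ξ k) 2 P := fun k =>
    MemLp.of_bound ((hξ k).mono (𝒢.le _) le_rfl).aestronglyMeasurable 1 (ae_of_all _ fun ω => by
      by_cases hω : ω ∈ good k <;> simp [ξ, hω])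
  have hmono : ∀ ω k l, k ≤ l → ω ∈ good l → ω ∈ good k := fun ω k l hkl hω n hn =>
    hω n (hn.trans hkl)
  have key : ∀ ω, ∀ n, ω ∉ good n → R ≤ |∑ j ∈ Finset.range n, ξ j ω * ζ j ω| := by
    intro ω n
    induction n with
    | zero =>
      intro h0
      exact absurd (fun l hl => by simpa [Nat.le_zero.1 hl] using hR) h0
    | succ n ih =>
      intro hn
      by_cases hgn : ω ∈ good n
      · have e : ∑ j ∈ Finset.range (n + 1), ξ j ω * ζ j ω = ∑ j ∈ Finset.range (n + 1), ζ j ω := by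
          refine Finset.sum_congr rfl fun j hj => ?_
          have := hmono ω j n (Nat.lt_succ_iff.1 (Finset.mem_range.1 hj)) hgn
          simp [ξ, this]
        rw [e]
        by_contra hlt
        refine hn fun l hl => ?_
        rcases Nat.le_succ_iff.1 hl with hl | rfl
        · exact hgn l hl
        · exact not_le.1 hlt
      · rw [Finset.sum_range_succ]
        simpa [ξ, hgn] using ih hgn
  have hsub : {ω | ∃ k ≤ m, R ≤ |∑ j ∈ Finset.range k, ζ j ω|}
      ⊆ {ω | ENNReal.ofReal (R ^ 2)
        ≤ ENNReal.ofReal ((∑ j ∈ Finset.range m, ξ j ω * ζ j ω) ^ 2)} := by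
    rintro ω ⟨k, hk, hRk⟩
    have hng : ω ∉ good m := fun hg => absurd (hg k hk) (not_lt.2 hRk)
    have := key ω m hng
    refine ENNReal.ofReal_le_ofReal ?_
    rw [← sq_abs (∑ j ∈ Finset.range m, ξ j ω * ζ j ω)]
    exact pow_le_pow_left₀ hR.le this 2
  have hR2 : (0 : ℝ) < R ^ 2 := by positivity
  have hmem := h.memLp_sum hξ hξ2 m
  refine (measure_mono hsub).trans ?_
  refine (meas_ge_le_lintegral_div hmem.integrable_sq.aemeasurable.ennreal_ofReal
    (by simpa using hR.ne') ENNReal.ofReal_ne_top).trans ?_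
  rw [← ofReal_integral_eq_lintegral_ofReal hmem.integrable_sq (ae_of_all _ fun ω => sq_nonneg _),
    ← ENNReal.ofReal_div_of_pos hR2, h.integral_sum_sq hξ hξ2]
  gcongr with k hk
  have : ∫ ω, ξ k ω ^ 2 ∂P ≤ 1 := by
    calc _ ≤ ∫ _, (1 : ℝ) ∂P := integral_mono (hξ2 k).integrable_sq (integrable_const _) fun ω => by
            by_cases hω : ω ∈ good k <;> simp [ξ, hω]
      _ = 1 := by simp
  exact mul_le_of_le_one_right (h.var_nonneg k) this

end

/-! ### Simple stochastic integrals along deterministic partitions. -/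

section

variable {Ω : Type*} {mΩ : MeasurableSpace Ω} {P : Measure Ω}
  {𝓕 : Filtration ℝ≥0 mΩ} {W : ℝ≥0 → Ω → ℝ}

/-- The point `x` does not lie strictly inside one of the intervals of the partition `p`. -/
def Compat (p : ℕ → ℝ≥0) (x : ℝ≥0) : Prop := ∀ j, p (j + 1) ≤ x ∨ x ≤ p j

/-- List `a` and the points of `F` above it in increasing order and repeat the last one forever.
Points of `F` below `a` are compatible for free, since no interval of the partition reaches them. -/
lemma exists_partition (F : Finset ℝ≥0) (a : ℝ≥0) :
    ∃ p : ℕ → ℝ≥0, Monotone p ∧ p 0 = a ∧ (∀ x ∈ F, Compat p x) ∧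
      ∀ x ∈ F, a ≤ x → ∃ j, p j = x := by
  classical
  let G : Finset ℝ≥0 := insert a (F.filter (a ≤ ·))
  have hG : 0 < G.card := Finset.card_pos.2 ⟨a, Finset.mem_insert_self _ _⟩
  let e := G.orderEmbOfFin rfl
  let p : ℕ → ℝ≥0 := fun n => e ⟨min n (G.card - 1), by omega⟩
  have hp : Monotone p := fun i j hij => e.monotone (by
    rw [Fin.mk_le_mk]; exact min_le_min_right _ hij)
  have hmem : ∀ x ∈ G, ∃ j, p j = x := fun x hx => by
    have : x ∈ Set.range e := by rw [Finset.range_orderEmbOfFin]; exact hx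
    obtain ⟨i, hi⟩ := this
    refine ⟨i, ?_⟩
    rw [← hi]
    exact congrArg e (Fin.ext (min_eq_left (by omega)))
  have h0 : p 0 = a := by
    have hle : ∀ x ∈ G, a ≤ x := fun x hx => by
      rcases Finset.mem_insert.1 hx with rfl | hx
      · exact le_rfl
      · exact (Finset.mem_filter.1 hx).2
    obtain ⟨j, hj⟩ := hmem a (Finset.mem_insert_self _ _)
    exact le_antisymm (hj ▸ hp (Nat.zero_le j)) (hle _ (G.orderEmbOfFin_mem rfl _))
  have hF : ∀ x ∈ F, a ≤ x → ∃ j, p j = x := fun x hx hax =>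
    hmem x (Finset.mem_insert_of_mem (Finset.mem_filter.2 ⟨hx, hax⟩))
  refine ⟨p, hp, h0, fun x hx j => ?_, hF⟩
  rcases le_total a x with hax | hax
  · obtain ⟨n, rfl⟩ := hF x hx hax
    rcases le_or_gt (j + 1) n with h | h
    · exact Or.inl (hp h)
    · exact Or.inr (hp (Nat.lt_succ_iff.1 h))
  · exact Or.inr (hax.trans (h0 ▸ hp (Nat.zero_le j)))

/-- The filtration seen along a sequence of deterministic times. -/
def alongTimes (𝓕 : Filtration ℝ≥0 mΩ) {p : ℕ → ℝ≥0} (hp : Monotone p) : Filtration ℕ mΩ :=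
  ⟨fun n => 𝓕 (p n), fun _ _ h => 𝓕.mono (hp h), fun _ => 𝓕.le _⟩

/-- The partition `p` resolves all the jump times of `V`. -/
def SimpleProcess.CompatWith (V : SimpleProcess 𝓕) (p : ℕ → ℝ≥0) : Prop :=
  ∀ i ≤ V.len, Compat p (V.time i)

lemma indicator_Ioc_eq_of_compat {p : ℕ → ℝ≥0} {x y : ℝ≥0} (hx : Compat p x)
    (hy : Compat p y) {j : ℕ} {s : ℝ≥0} (hs : s ∈ Set.Ioc (p j) (p (j + 1))) (c : ℝ) :
    (Set.Ioc x y).indicator (fun _ => c) s = (Set.Ioc x y).indicator (fun _ => c) (p (j + 1)) := by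
  have : s ∈ Set.Ioc x y ↔ p (j + 1) ∈ Set.Ioc x y := by
    constructor
    · rintro ⟨h1, h2⟩
      refine ⟨h1.trans_le hs.2, ?_⟩
      rcases hy j with h | h
      · exact h
      · exact absurd (h2.trans h) (not_le.2 hs.1)
    · rintro ⟨h1, h2⟩
      refine ⟨?_, hs.2.trans h2⟩
      rcases hx j with h | h
      · exact absurd h (not_le.2 h1)
      · exact h.trans_lt hs.1
  by_cases h : s ∈ Set.Ioc x y
  · rw [Set.indicator_of_mem h, Set.indicator_of_mem (this.1 h)]
  · rw [Set.indicator_of_notMem h, Set.indicator_of_notMem (mt this.2 h)]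

namespace SimpleProcess

variable {V : SimpleProcess 𝓕} {p : ℕ → ℝ≥0}

lemma eval_eq_of_compat (hV : V.CompatWith p) {j : ℕ} {s : ℝ≥0}
    (hs : s ∈ Set.Ioc (p j) (p (j + 1))) (ω : Ω) : V.eval s ω = V.eval (p (j + 1)) ω := by
  refine Finset.sum_congr rfl fun i hi => ?_
  have hi' : i + 1 ≤ V.len := Finset.mem_range.1 hi
  exact indicator_Ioc_eq_of_compat (hV i (Nat.le_of_succ_le hi')) (hV _ hi') hs _

/-- The value on the `j`-th interval is read at its right end but known at its left end: a
coefficient active at `p (j + 1)` belongs to a jump interval that started no later than `p j`. -/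
lemma measurable_eval_of_compat (hV : V.CompatWith p) (j : ℕ) :
    Measurable[𝓕 (p j)] (V.eval (p (j + 1))) := by
  refine Finset.measurable_fun_sum _ fun i hi => ?_
  have hi' : i + 1 ≤ V.len := Finset.mem_range.1 hi
  by_cases h : p (j + 1) ∈ Set.Ioc (V.time i) (V.time (i + 1))
  · simp only [Set.indicator_of_mem h]
    refine (V.measurable_coeff i).mono (𝓕.mono ?_) le_rfl
    rcases hV i (Nat.le_of_succ_le hi') j with h' | h'
    · exact absurd h' (not_le.2 h.1)
    · exact h'
  · simp only [Set.indicator_of_notMem h]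
    exact measurable_const

lemma integral_sub_of_compat (hp : Monotone p) (hV : V.CompatWith p) (j : ℕ) (ω : Ω) :
    V.integral W (p (j + 1)) ω - V.integral W (p j) ω
      = V.eval (p (j + 1)) ω * (W (p (j + 1)) ω - W (p j) ω) := by
  rw [integral, integral, eval, ← Finset.sum_sub_distrib, Finset.sum_mul]
  refine Finset.sum_congr rfl fun i hi => ?_
  have hi' : i + 1 ≤ V.len := Finset.mem_range.1 hi
  have hst : V.time i ≤ V.time (i + 1) := V.monotone_time (Nat.le_succ i)
  have hj : p j ≤ p (j + 1) := hp (Nat.le_succ j)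
  rcases hV i (Nat.le_of_succ_le hi') j with h1 | h1
  -- By compatibility the jump interval lies after the partition interval, contains it, or lies
  -- before it. The cases `p j = p (j + 1)` are separate because an empty interval may satisfy
  -- several of these.
  · have h : p (j + 1) ∉ Set.Ioc (V.time i) (V.time (i + 1)) := fun h => absurd h1 (not_le.2 h.1)
    rw [Set.indicator_of_notMem h, min_eq_right h1, min_eq_right (hj.trans h1),
      min_eq_right (h1.trans hst), min_eq_right ((hj.trans h1).trans hst)]
    ring
  · rcases hV (i + 1) hi' j with h2 | h2
    · rcases eq_or_lt_of_le (h1.trans hj) with h3 | h3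
      · have e : p j = p (j + 1) := le_antisymm hj (h3 ▸ h1)
        rw [e]; ring
      · have h : p (j + 1) ∈ Set.Ioc (V.time i) (V.time (i + 1)) := ⟨h3, h2⟩
        rw [Set.indicator_of_mem h, min_eq_left h1, min_eq_left (h1.trans hj),
          min_eq_right h2, min_eq_right (hj.trans h2)]
        ring
    · rw [min_eq_left h1, min_eq_left (h1.trans hj), min_eq_left h2, min_eq_left (h2.trans hj)]
      by_cases h : p (j + 1) ∈ Set.Ioc (V.time i) (V.time (i + 1))
      · have e : p j = p (j + 1) := le_antisymm hj (h.2.trans h2)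
        rw [e]; ring
      · rw [Set.indicator_of_notMem h]; ring

lemma integral_sub_eq_sum (hp : Monotone p) (hV : V.CompatWith p) {a b : ℕ} (hab : a ≤ b) (ω : Ω) :
    V.integral W (p b) ω - V.integral W (p a) ω
      = ∑ j ∈ Finset.Ico a b, V.eval (p (j + 1)) ω * (W (p (j + 1)) ω - W (p j) ω) := by
  simp_rw [← integral_sub_of_compat hp hV]
  exact (Finset.sum_Ico_sub (fun j => V.integral W (p j) ω) hab).symm

/-- The jump times of a simple process. -/
def times (V : SimpleProcess 𝓕) : Finset ℝ≥0 := (Finset.range (V.len + 1)).image V.time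

lemma compatWith_of_times {F : Finset ℝ≥0} (h : ∀ x ∈ F, Compat p x) (hF : V.times ⊆ F) :
    V.CompatWith p := fun i hi =>
  h _ (hF (Finset.mem_image_of_mem _ (Finset.mem_range.2 (Nat.lt_succ_of_le hi))))

lemma measurable_integral (hW : ∀ t, Measurable[𝓕 t] (W t)) (V : SimpleProcess 𝓕) (t : ℝ≥0) :
    Measurable[𝓕 t] (V.integral W t) := by
  refine Finset.measurable_fun_sum _ fun (i : ℕ) _ => ?_
  rcases le_total (V.time i) t with h | h
  · exact ((V.measurable_coeff i).mono (𝓕.mono h) le_rfl).mul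
      (((hW _).mono (𝓕.mono (min_le_right _ _)) le_rfl).sub
        ((hW _).mono (𝓕.mono (min_le_right _ _)) le_rfl))
  · rw [min_eq_right h, min_eq_right (h.trans (V.monotone_time (Nat.le_succ i)))]
    simp

lemma measurable_uncurry_eval (V : SimpleProcess 𝓕) :
    Measurable (fun q : ℝ × Ω => V.eval q.1.toNNReal q.2) := by
  refine Finset.measurable_fun_sum _ fun i _ => ?_
  have h1 : Measurable (fun q : ℝ × Ω => V.coeff i q.2) :=
    ((V.measurable_coeff i).mono (𝓕.le _) le_rfl).comp measurable_snd
  have h2 : MeasurableSet {q : ℝ × Ω |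
      q.1.toNNReal ∈ Set.Ioc (V.time i) (V.time (i + 1))} :=
    (measurable_real_toNNReal.comp measurable_fst) measurableSet_Ioc
  convert! h1.indicator h2 using 1

end SimpleProcess

lemma IsFilteredBrownian.hasLaw_sub (hW : IsFilteredBrownian 𝓕 W P) {s t : ℝ≥0} (hst : s ≤ t) :
    HasLaw (fun ω => W t ω - W s ω) (gaussianReal 0 (t - s)) P := by
  have := hW.isBrownian.hasLaw_sub t s
  have e : nndist t.1 s.1 = t - s := by
    ext
    rw [coe_nndist, Real.dist_eq, NNReal.coe_sub hst, abs_of_nonneg]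
    · rfl
    · exact sub_nonneg.2 hst
  rw [e] at this
  exact this

lemma isNoise_of_gaussian {𝒢 : Filtration ℕ mΩ} {g : ℕ → Ω → ℝ} {v : ℕ → ℝ≥0}
    (hm : ∀ k, Measurable[𝒢 (k + 1)] (g k))
    (hi : ∀ k, Indep (MeasurableSpace.comap (g k) inferInstance) (𝒢 k) P)
    (hl : ∀ k, HasLaw (g k) (gaussianReal 0 (v k)) P) :
    IsNoise 𝒢 P g (fun k => v k) where
  meas := hm
  indep := hi
  memLp k := by
    have h1 : MemLp id 2 (P.map (g k)) := by
      rw [(hl k).map_eq]; exact memLp_id_gaussianReal' 2 (by simp)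
    exact (memLp_map_measure_iff (by fun_prop) (hl k).aemeasurable).1 h1
  mean k := by
    rw [(hl k).integral_eq, integral_id_gaussianReal]
  var k := by
    have h1 : ∫ ω, g k ω ^ 2 ∂P = ∫ x, x ^ 2 ∂(gaussianReal 0 (v k)) :=
      (hl k).integral_comp (f := fun x => x ^ 2) (by fun_prop)
    have h2 := variance_fun_id_gaussianReal (μ := 0) (v := v k)
    rw [variance_of_integral_eq_zero (by fun_prop) integral_id_gaussianReal] at h2
    rw [h1]
    exact h2

lemma IsFilteredBrownian.isNoise (hW : IsFilteredBrownian 𝓕 W P) {p : ℕ → ℝ≥0} (hp : Monotone p) :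
    IsNoise (alongTimes 𝓕 hp) P (fun j ω => W (p (j + 1)) ω - W (p j) ω)
      (fun j => ((p (j + 1) - p j : ℝ≥0) : ℝ)) :=
  isNoise_of_gaussian (𝒢 := alongTimes 𝓕 hp)
    (fun k => (hW.adapted _).sub ((hW.adapted _).mono (𝓕.mono (hp (Nat.le_succ k))) le_rfl))
    (fun k => hW.indep _ _ (hp (Nat.le_succ k))) (fun k => hW.hasLaw_sub (hp (Nat.le_succ k)))

lemma lintegral_Ioc_eq_sum {p : ℕ → ℝ≥0} (hp : Monotone p) (f : ℝ → ℝ≥0∞) {a b : ℕ}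
    (hab : a ≤ b) :
    ∫⁻ s in Set.Ioc (p a : ℝ) (p b), f s
      = ∑ j ∈ Finset.Ico a b, ∫⁻ s in Set.Ioc (p j : ℝ) (p (j + 1)), f s := by
  induction b, hab using Nat.le_induction with
  | base => simp
  | succ b hab ih =>
    rw [Finset.sum_Ico_succ_top hab, ← ih, ← lintegral_union measurableSet_Ioc,
      Set.Ioc_union_Ioc_eq_Ioc (by exact_mod_cast hp hab) (by exact_mod_cast hp (Nat.le_succ b))]
    exact Set.Ioc_disjoint_Ioc_of_le le_rfl

lemma lintegral_Ioc_of_forall_eq {a b : ℝ≥0} {f : ℝ → ℝ} {y : ℝ} (hab : a ≤ b)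
    (h : ∀ s ∈ Set.Ioc (a : ℝ) b, f s = y) :
    ∫⁻ s in Set.Ioc (a : ℝ) b, ‖f s‖ₑ ^ 2
      = ENNReal.ofReal (((b - a : ℝ≥0) : ℝ) * y ^ 2) := by
  rw [setLIntegral_congr_fun measurableSet_Ioc (g := fun _ => ‖y‖ₑ ^ 2)
    (fun s hs => by simp only [h s hs])]
  rw [lintegral_const, Measure.restrict_apply_univ, Real.volume_Ioc, mul_comm, NNReal.coe_sub hab,
    ENNReal.ofReal_mul (by simpa using hab), ← sq_abs, ENNReal.ofReal_pow (abs_nonneg y),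
    ← Real.norm_eq_abs, ofReal_norm]

lemma toNNReal_mem_Ioc {a b : ℝ≥0} {s : ℝ} (hs : s ∈ Set.Ioc (a : ℝ) b) :
    s.toNNReal ∈ Set.Ioc a b :=
  ⟨Real.lt_toNNReal_iff_coe_lt.2 hs.1, Real.toNNReal_le_iff_le_coe.2 hs.2⟩

/-- The Lenglart inequality for the difference of two simple stochastic integrals along coarse
times `t k`, with weights known at the beginning of each coarse interval. -/
lemma SimpleProcess.lintegral_min_le [IsProbabilityMeasure P] (hW : IsFilteredBrownian 𝓕 W P)
    (V U : SimpleProcess 𝓕) {t : ℕ → ℝ≥0} (ht : Monotone t) {z x : ℕ → Ω → ℝ}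
    (hz : ∀ k, Measurable[𝓕 (t k)] (z k)) (hx : ∀ k, Measurable[𝓕 (t k)] (x k))
    {δ : ℝ} (hδ : 0 ≤ δ) (m : ℕ) :
    (∫⁻ ω, min (ENNReal.ofReal ((∑ k ∈ Finset.range m,
        z k ω * (V.integral W (t (k + 1)) ω - V.integral W (t k) ω
          - x k ω * (U.integral W (t (k + 1)) ω - U.integral W (t k) ω))) ^ 2)) 1 ∂P
      ≤ ENNReal.ofReal δ + P {ω | ENNReal.ofReal δ < ∑ k ∈ Finset.range m,
          ∫⁻ s in Set.Ioc (t k : ℝ) (t (k + 1)),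
            ‖z k ω * (V.eval s.toNNReal ω - x k ω * U.eval s.toNNReal ω)‖ₑ ^ 2}) ∧
    (∫⁻ ω, min (ENNReal.ofReal (∑ k ∈ Finset.range m,
        (z k ω * (V.integral W (t (k + 1)) ω - V.integral W (t k) ω
          - x k ω * (U.integral W (t (k + 1)) ω - U.integral W (t k) ω))) ^ 2)) 1 ∂P
      ≤ ENNReal.ofReal δ + P {ω | ENNReal.ofReal δ < ∑ k ∈ Finset.range m,
          ∫⁻ s in Set.Ioc (t k : ℝ) (t (k + 1)),
            ‖z k ω * (V.eval s.toNNReal ω - x k ω * U.eval s.toNNReal ω)‖ₑ ^ 2}) := by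
  classical
  obtain ⟨p, hp, hp0, hpc, hpr⟩ := exists_partition
    (V.times ∪ U.times ∪ (Finset.range (m + 1)).image t) (t 0)
  have hV : V.CompatWith p := compatWith_of_times hpc fun y hy => by simp [hy]
  have hU : U.CompatWith p := compatWith_of_times hpc fun y hy => by simp [hy]
  -- Only the finitely many times `t 0, …, t m` are resolved by the partition, so the coarse times
  -- are frozen after `m`.
  let t' : ℕ → ℝ≥0 := fun k => t (min k m)
  have ht' : Monotone t' := fun a b hab => ht (min_le_min_right _ hab)
  have hex : ∀ k, ∃ j, p j = t' k := fun k =>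
    hpr _ (Finset.mem_union_right _ (Finset.mem_image_of_mem _ (Finset.mem_range.2 (by omega))))
      (ht (Nat.zero_le _))
  -- Taking the least index with `p (i k) = t' k` makes `i` monotone with `i 0 = 0` even when times
  -- are repeated.
  let i : ℕ → ℕ := fun k => Nat.find (hex k)
  have hpi : ∀ k, p (i k) = t' k := fun k => Nat.find_spec (hex k)
  have hi : Monotone i := fun a b hab => by
    rcases eq_or_lt_of_le (ht' hab) with h | h
    · exact Nat.find_min' _ ((hpi b).trans h.symm)
    · rw [← hpi a, ← hpi b] at h
      by_contra hlt
      exact absurd (hp (not_le.1 hlt).le) (not_le.2 h)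
  have hi0 : i 0 = 0 := Nat.le_zero.1 (Nat.find_min' _ (by simp [hp0, t']))
  have hpi1 : ∀ k < m, p (i k) = t k ∧ p (i (k + 1)) = t (k + 1) := fun k hk =>
    ⟨by rw [hpi]; simp only [t']; rw [min_eq_left hk.le],
     by rw [hpi]; simp only [t']; rw [min_eq_left hk]⟩
  let η : ℕ → ℕ → Ω → ℝ := fun k j ω =>
    z k ω * (V.eval (p (j + 1)) ω - x k ω * U.eval (p (j + 1)) ω)
  -- The fine coefficient at `j` uses the weights of the one coarse block containing `j`. These
  -- weights are known at `t k ≤ p j`, so `ξ` is adapted.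
  let ξ : ℕ → Ω → ℝ := fun j ω => ∑ k ∈ Finset.range m,
    if i k ≤ j ∧ j < i (k + 1) then η k j ω else 0
  have hξ : ∀ j, Measurable[alongTimes 𝓕 hp j] (ξ j) := fun j => by
    refine Finset.measurable_fun_sum _ fun k hk => ?_
    by_cases h : i k ≤ j ∧ j < i (k + 1)
    · simp only [h, and_self, if_true]
      have hle : t k ≤ p j := (hpi1 k (Finset.mem_range.1 hk)).1 ▸ hp h.1
      exact ((hz k).mono (𝓕.mono hle) le_rfl).mul ((measurable_eval_of_compat hV j).sub
        (((hx k).mono (𝓕.mono hle) le_rfl).mul (measurable_eval_of_compat hU j)))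
    · simp only [h, if_false]
      exact measurable_const
  have hξη : ∀ k < m, ∀ j ∈ Finset.Ico (i k) (i (k + 1)), ∀ ω, ξ j ω = η k j ω := by
    intro k hk j hj ω
    rw [Finset.mem_Ico] at hj
    simp only [ξ]
    rw [Finset.sum_eq_single k, if_pos hj]
    · intro k' _ hkk'
      rw [if_neg]
      rintro ⟨h1, h2⟩
      rcases lt_or_gt_of_ne hkk' with h | h
      · exact absurd (h2.trans_le ((hi h).trans hj.1)) (lt_irrefl _)
      · exact absurd (hj.2.trans_le ((hi h).trans h1)) (lt_irrefl _)
    · intro h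
      exact absurd (Finset.mem_range.2 hk) h
  have hblock : ∀ k < m, ∀ ω, ∑ j ∈ Finset.Ico (i k) (i (k + 1)),
      ξ j ω * (W (p (j + 1)) ω - W (p j) ω)
      = z k ω * (V.integral W (t (k + 1)) ω - V.integral W (t k) ω
          - x k ω * (U.integral W (t (k + 1)) ω - U.integral W (t k) ω)) := by
    intro k hk ω
    obtain ⟨e1, e2⟩ := hpi1 k hk
    rw [← e1, ← e2, integral_sub_eq_sum hp hV (hi (Nat.le_succ k)),
      integral_sub_eq_sum hp hU (hi (Nat.le_succ k)), Finset.mul_sum, ← Finset.sum_sub_distrib,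
      Finset.mul_sum]
    refine Finset.sum_congr rfl fun j hj => ?_
    rw [hξη k hk j hj]
    simp only [η]
    ring
  have hsum : ∀ (f : ℕ → ℝ) (n : ℕ), ∑ k ∈ Finset.range n, ∑ j ∈ Finset.Ico (i k) (i (k + 1)), f j
      = ∑ j ∈ Finset.range (i n), f j := fun f n => by
    induction n with
    | zero => simp [hi0]
    | succ n ih =>
      rw [Finset.sum_range_succ, ih, Finset.range_eq_Ico, Finset.range_eq_Ico,
        Finset.sum_Ico_consecutive _ (Nat.zero_le _) (hi (Nat.le_succ n))]
  -- The integrands are constant on each fine interval, so the discrete bracket equals the time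
  -- integral exactly.
  have hD : ∀ ω, ENNReal.ofReal (∑ j ∈ Finset.range (i m),
      ((p (j + 1) - p j : ℝ≥0) : ℝ) * ξ j ω ^ 2) = ∑ k ∈ Finset.range m,
          ∫⁻ s in Set.Ioc (t k : ℝ) (t (k + 1)),
            ‖z k ω * (V.eval s.toNNReal ω - x k ω * U.eval s.toNNReal ω)‖ₑ ^ 2 := by
    intro ω
    rw [← hsum, ENNReal.ofReal_sum_of_nonneg
      fun k _ => Finset.sum_nonneg fun j _ => mul_nonneg NNReal.zero_le_coe (sq_nonneg _)]
    refine Finset.sum_congr rfl fun k hk => ?_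
    have hk := Finset.mem_range.1 hk
    obtain ⟨e1, e2⟩ := hpi1 k hk
    rw [← e1, ← e2, lintegral_Ioc_eq_sum hp _ (hi (Nat.le_succ k)), ENNReal.ofReal_sum_of_nonneg
      fun j _ => mul_nonneg NNReal.zero_le_coe (sq_nonneg _)]
    refine Finset.sum_congr rfl fun j hj => ?_
    rw [hξη k hk j hj]
    symm
    refine lintegral_Ioc_of_forall_eq (hp (Nat.le_succ j)) fun s hs => ?_
    simp only [η]
    rw [eval_eq_of_compat hV (toNNReal_mem_Ioc hs), eval_eq_of_compat hU (toNNReal_mem_Ioc hs)]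
  have hev : {ω | δ < ∑ j ∈ Finset.range (i m), ((p (j + 1) - p j : ℝ≥0) : ℝ) * ξ j ω ^ 2}
      ⊆ {ω | ENNReal.ofReal δ < ∑ k ∈ Finset.range m,
          ∫⁻ s in Set.Ioc (t k : ℝ) (t (k + 1)),
            ‖z k ω * (V.eval s.toNNReal ω - x k ω * U.eval s.toNNReal ω)‖ₑ ^ 2} := by
    intro ω hω
    rw [Set.mem_ofPred_eq, ← hD, ENNReal.ofReal_lt_ofReal_iff (hδ.trans_lt hω)]
    exact hω
  have hn := hW.isNoise hp
  constructor
  · refine le_trans (le_of_eq ?_) ((hn.lintegral_min_sum_le hξ hδ (i m)).trans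
      (by gcongr))
    refine lintegral_congr fun ω => ?_
    rw [← hsum]
    congr 3
    exact Finset.sum_congr rfl fun k hk => (hblock k (Finset.mem_range.1 hk) ω).symm
  · refine le_trans (le_of_eq ?_) ((hn.lintegral_min_blocks_le hξ hδ hi hi0 m).trans
      (by gcongr))
    refine lintegral_congr fun ω => ?_
    congr 2
    exact Finset.sum_congr rfl fun k hk => by rw [hblock k (Finset.mem_range.1 hk) ω]

end

/-! ### Gaussian increments through characteristic functions; deterministic simple integrands. -/

section

variable {Ω : Type*} {mΩ : MeasurableSpace Ω} {P : Measure Ω}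
  {𝓕 : Filtration ℝ≥0 mΩ} {W : ℝ≥0 → Ω → ℝ}

/-- The characteristic function identity expressing that `g` is centred Gaussian with variance `v`
and independent of `m`. -/
def CharGauss (P : Measure Ω) (m : MeasurableSpace Ω) (g : Ω → ℝ) (v : ℝ) : Prop :=
  ∀ A, MeasurableSet[m] A → ∀ u : ℝ,
    ∫ ω in A, Complex.exp (u * g ω * Complex.I) ∂P = P.real A * Complex.exp (-(v * u ^ 2 / 2))

section CharGauss

variable {g X Y : Ω → ℝ}

lemma norm_cexp_mul_I_eq (u x : ℝ) : ‖Complex.exp (u * x * Complex.I)‖ = 1 := by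
  rw [← Complex.ofReal_mul]; exact Complex.norm_exp_ofReal_mul_I _

lemma integrable_cexp_mul_I [IsFiniteMeasure P] (hg : Measurable g) (u : ℝ) :
    Integrable (fun ω => Complex.exp (u * g ω * Complex.I)) P :=
  Integrable.of_bound (C := 1)
    (Measurable.aestronglyMeasurable (by fun_prop)) (ae_of_all _ fun ω => (norm_cexp_mul_I_eq _ _).le)

lemma integral_mul_cexp_eq [IsProbabilityMeasure P] {m : MeasurableSpace Ω} (hm : m ≤ mΩ) {F : Ω → ℂ}
    (hF : Measurable[m] F) (hY : Measurable[mΩ] Y)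
    (hi : Indep (MeasurableSpace.comap Y inferInstance) m P)
    {v : ℝ≥0} (hl : HasLaw Y (gaussianReal 0 v) P) (u : ℝ) :
    ∫ ω, F ω * Complex.exp (u * Y ω * Complex.I) ∂P
      = (∫ ω, F ω ∂P) * Complex.exp (-(v * u ^ 2 / 2)) := by
  have hind : IndepFun F (fun ω => Complex.exp (u * Y ω * Complex.I)) P := by
    refine indep_of_indep_of_le_left (indep_of_indep_of_le_right hi.symm ?_) hF.comap_le
    have h1 : Measurable[MeasurableSpace.comap Y inferInstance] Y := comap_measurable Y
    have h2 : Measurable (fun y : ℝ => Complex.exp (u * y * Complex.I)) := by fun_prop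
    exact (h2.comp h1).comap_le
  rw [hind.integral_fun_mul_eq_mul_integral (hF.mono hm le_rfl).aestronglyMeasurable
    (Measurable.aestronglyMeasurable (by fun_prop))]
  congr 1
  have h1 : ∫ ω, Complex.exp (u * Y ω * Complex.I) ∂P
      = ∫ y, Complex.exp (u * y * Complex.I) ∂(gaussianReal 0 v) :=
    hl.integral_comp (f := fun y : ℝ => Complex.exp (u * y * Complex.I)) (by fun_prop)
  rw [h1, ← charFun_apply_real, charFun_gaussianReal]
  congr 1
  push_cast
  ring

lemma CharGauss.zero (P : Measure Ω) (m : MeasurableSpace Ω) :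
    CharGauss P m (fun _ => 0) 0 := fun A _ u => by simp [Measure.real]

/-- The indicator of `A` and the exponential of `X` form one factor measurable for `m'`. The new
increment `Y` is independent of `m'`, so its Gaussian characteristic function splits off and the
variances add. -/
lemma CharGauss.add_const_mul [IsProbabilityMeasure P] {m m' : MeasurableSpace Ω} (hm' : m' ≤ mΩ) (hmm' : m ≤ m')
    (hX : Measurable[m'] X) {v : ℝ} (hXv : CharGauss P m X v) (hY : Measurable[mΩ] Y)
    (hi : Indep (MeasurableSpace.comap Y inferInstance) m' P) {v' : ℝ≥0}
    (hl : HasLaw Y (gaussianReal 0 v') P) (a : ℝ) :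
    CharGauss P m (fun ω => X ω + a * Y ω) (v + v' * a ^ 2) := by
  intro A hA u
  have hA' : MeasurableSet[mΩ] A := hm' _ (hmm' _ hA)
  have hF : Measurable[m'] (A.indicator fun ω => Complex.exp (u * X ω * Complex.I)) := by
    refine Measurable.indicator (m := m') ?_ (hmm' _ hA)
    have h2 : Measurable (fun y : ℝ => Complex.exp (u * y * Complex.I)) := by fun_prop
    exact h2.comp hX
  have h1 := integral_mul_cexp_eq hm' hF hY hi hl (u * a)
  rw [integral_indicator hA', hXv A hA u] at h1
  rw [← integral_indicator hA']
  have e : ∀ ω, A.indicator (fun ω => Complex.exp (u * (X ω + a * Y ω : ℝ) * Complex.I)) ω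
      = A.indicator (fun ω => Complex.exp (u * X ω * Complex.I)) ω
        * Complex.exp ((u * a : ℝ) * Y ω * Complex.I) := fun ω => by
    by_cases h : ω ∈ A
    · simp only [Set.indicator_of_mem h]
      rw [← Complex.exp_add]
      congr 1
      push_cast
      ring
    · simp [Set.indicator_of_notMem h]
  simp_rw [e]
  rw [h1, mul_assoc, ← Complex.exp_add]
  congr 2
  push_cast
  ring

lemma CharGauss.of_tendsto [IsFiniteMeasure P] {m : MeasurableSpace Ω} {g : ℕ → Ω → ℝ} {g' : Ω → ℝ} {v : ℕ → ℝ} {v' : ℝ}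
    (hg : ∀ n, Measurable[mΩ] (g n)) (h : ∀ n, CharGauss P m (g n) (v n))
    (hlim : ∀ᵐ ω ∂P, Tendsto (fun n => g n ω) atTop (𝓝 (g' ω)))
    (hv : Tendsto v atTop (𝓝 v')) : CharGauss P m g' v' := by
  intro A hA u
  have h1 : Tendsto (fun n => ∫ ω in A, Complex.exp (u * g n ω * Complex.I) ∂P) atTop
      (𝓝 (∫ ω in A, Complex.exp (u * g' ω * Complex.I) ∂P)) := by
    refine tendsto_integral_of_dominated_convergence (fun _ => 1)
      (fun n => (integrable_cexp_mul_I (hg n) u).aestronglyMeasurable) (integrable_const _)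
      (fun n => ae_of_all _ fun ω => (norm_cexp_mul_I_eq _ _).le) ?_
    filter_upwards [ae_restrict_of_ae hlim] with ω hω
    have hc : Continuous (fun y : ℝ => Complex.exp (u * y * Complex.I)) := by fun_prop
    exact (hc.tendsto _).comp hω
  have h2 : Tendsto (fun n => (P.real A : ℂ) * Complex.exp (-(v n * u ^ 2 / 2))) atTop
      (𝓝 (P.real A * Complex.exp (-(v' * u ^ 2 / 2)))) := by
    have hc : Continuous (fun y : ℝ => (P.real A : ℂ) * Complex.exp (-(y * u ^ 2 / 2))) := by
      fun_prop
    exact (hc.tendsto _).comp hv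
  simp_rw [h _ A hA u] at h1
  exact tendsto_nhds_unique h1 h2

/-- For each `A` in `m`, the identity determines the characteristic function of the law of `g` under
`P` restricted to `A`. By uniqueness for finite measures this law is `P A` times the Gaussian: `A =
univ` gives the law, general `A` the independence. -/
lemma CharGauss.indep_and_hasLaw {Ω : Type*} {m mΩ : MeasurableSpace Ω} {P : Measure Ω}
    [IsProbabilityMeasure P] {g : Ω → ℝ} (hm : m ≤ mΩ) (hg : Measurable g) {v : ℝ≥0} (h : CharGauss P m g v) :
    Indep (MeasurableSpace.comap g inferInstance) m P ∧ HasLaw g (gaussianReal 0 v) P := by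
  have key : ∀ A, MeasurableSet[m] A → (P.restrict A).map g = P A • gaussianReal 0 v := by
    intro A hA
    have : IsFiniteMeasure (P A • gaussianReal 0 v) :=
      Measure.smul_finite _ (measure_ne_top P A)
    refine Measure.ext_of_charFun ?_
    ext u
    rw [charFun_apply_real, charFun_apply_real, integral_map hg.aemeasurable (by fun_prop),
      h A hA u, integral_smul_measure, ← charFun_apply_real, charFun_gaussianReal]
    simp [Measure.real]
  have hlaw : P.map g = gaussianReal 0 v := by
    simpa using key Set.univ MeasurableSet.univ
  refine ⟨?_, ⟨hg.aemeasurable, hlaw⟩⟩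
  rw [Indep_iff]
  rintro _ A ⟨B, hB, rfl⟩ hA
  have h1 := congrArg (fun μ => μ B) (key A hA)
  simp only [Measure.smul_apply, smul_eq_mul] at h1
  rw [Measure.map_apply hg hB, Measure.restrict_apply (hg hB)] at h1
  rw [h1, ← hlaw, Measure.map_apply hg hB, mul_comm]

end CharGauss

/-- A sequence of nonnegative functions with summable integrals tends to zero almost everywhere. -/
lemma ae_tendsto_zero_of_tsum_lintegral {f : ℕ → Ω → ℝ≥0∞} (hf : ∀ n, AEMeasurable (f n) P)
    (h : ∑' n, ∫⁻ ω, f n ω ∂P ≠ ∞) : ∀ᵐ ω ∂P, Tendsto (fun n => f n ω) atTop (𝓝 0) := by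
  rw [← lintegral_tsum hf] at h
  filter_upwards [ae_lt_top' (AEMeasurable.tsum hf) h] with ω hω
  exact ENNReal.tendsto_atTop_zero_of_tsum_ne_top hω.ne

lemma lintegral_enorm_sq_eq {α : Type*} {mα : MeasurableSpace α} (μ : Measure α) (f : α → ℝ) :
    ∫⁻ x, ‖f x‖ₑ ^ 2 ∂μ = eLpNorm f 2 μ ^ 2 := by
  have := eLpNorm_nnreal_pow_eq_lintegral (μ := μ) (f := f) (p := 2) two_ne_zero
  norm_num at this
  exact_mod_cast this.symm

/-- The simple process with deterministic coefficients `f` at the times `i h`. -/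
def gridProcess (𝓕 : Filtration ℝ≥0 mΩ) (h : ℝ≥0) (n : ℕ) (f : ℕ → ℝ)
    (hf : ∃ C : ℝ, ∀ i, |f i| ≤ C) : SimpleProcess 𝓕 where
  len := n
  time i := i * h
  coeff i _ := f i
  monotone_time := fun i j hij => mul_le_mul_left (Nat.cast_le.2 hij) h
  measurable_coeff _ := measurable_const
  bounded_coeff := hf.imp fun _ h i _ => h i

/-- A simple process whose values do not depend on `ω`. -/
def SimpleProcess.Deterministic (V : SimpleProcess 𝓕) : Prop :=
  ∃ f : ℝ≥0 → ℝ, ∀ s ω, V.eval s ω = f s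

lemma gridProcess_deterministic {h : ℝ≥0} {n : ℕ} {f : ℕ → ℝ} {hf : ∃ C : ℝ, ∀ i, |f i| ≤ C} :
    (gridProcess 𝓕 h n f hf).Deterministic :=
  ⟨fun s => ∑ i ∈ Finset.range n,
    (Set.Ioc ((i : ℝ≥0) * h) (((i + 1 : ℕ) : ℝ≥0) * h)).indicator (fun _ => f i) s, fun _ _ => rfl⟩

lemma gridProcess_eval {h : ℝ≥0} {n : ℕ} {f : ℕ → ℝ} {hf : ∃ C : ℝ, ∀ i, |f i| ≤ C} {s : ℝ≥0}
    (hs0 : 0 < s) (hs : s ≤ n * h) (ω : Ω) :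
    ∃ i < n, (gridProcess 𝓕 h n f hf).eval s ω = f i ∧
      s ∈ Set.Ioc ((i : ℝ≥0) * h) (((i + 1 : ℕ) : ℝ≥0) * h) := by
  classical
  have hex : ∃ k : ℕ, s ≤ k * h := ⟨n, hs⟩
  obtain ⟨k, hk⟩ : ∃ k, Nat.find hex = k + 1 := Nat.exists_eq_succ_of_ne_zero fun h0 => by
    have := Nat.find_spec hex
    rw [h0] at this
    simp only [Nat.cast_zero, zero_mul] at this
    exact absurd this (not_le.2 hs0)
  have hmem : s ∈ Set.Ioc ((k : ℝ≥0) * h) (((k + 1 : ℕ) : ℝ≥0) * h) :=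
    ⟨not_le.1 (Nat.find_min hex (by omega)), hk ▸ Nat.find_spec hex⟩
  have hkn : k < n := by
    have := Nat.find_min' hex hs
    omega
  refine ⟨k, hkn, ?_, hmem⟩
  simp only [SimpleProcess.eval, gridProcess]
  rw [Finset.sum_eq_single k, Set.indicator_of_mem hmem]
  · intro j _ hjk
    refine Set.indicator_of_notMem (fun hj => ?_) _
    rcases lt_or_gt_of_ne hjk with hlt | hlt
    · have h1 : ((j + 1 : ℕ) : ℝ≥0) * h ≤ k * h := by gcongr; omega
      exact absurd (hj.2.trans h1) (not_le.2 hmem.1)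
    · have h1 : ((k + 1 : ℕ) : ℝ≥0) * h ≤ j * h := by gcongr; omega
      exact absurd (hmem.2.trans h1) (not_le.2 hj.1)
  · intro h
    exact absurd (Finset.mem_range.2 hkn) h

/-- Deterministic square integrable functions are limits of deterministic simple processes. -/
lemma exists_simple_eLpNorm_sub_le (𝓕 : Filtration ℝ≥0 mΩ) {T : ℝ≥0} {σ : ℝ → ℝ}
    (hσ : MemLp σ 2 (volume.restrict (Set.Icc (0 : ℝ) T))) {ε : ℝ≥0∞} (hε : ε ≠ 0) :
    ∃ U : SimpleProcess 𝓕, U.Deterministic ∧ ∀ ω,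
      eLpNorm ((fun s : ℝ => U.eval s.toNNReal ω) - σ) 2 (volume.restrict (Set.Icc (0 : ℝ) T))
        ≤ ε := by
  set μ := volume.restrict (Set.Icc (0 : ℝ) T) with hμ
  have hε2 : ε / 2 ≠ 0 := by simpa using hε
  obtain ⟨g, hg, hgm⟩ := hσ.exists_boundedContinuous_eLpNorm_sub_le (by simp) hε2
  have hfin : μ Set.univ ^ (2 : ℝ≥0∞).toReal⁻¹ ≠ ∞ := by
    refine ENNReal.rpow_ne_top_of_nonneg (by positivity) ?_
    exact measure_ne_top _ _
  -- A uniform error `η` on `[0, T]` costs at most `ε / 2` in `L²`; the other half is spent on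
  -- replacing `σ` by the continuous function `g`.
  obtain ⟨η, hη0, hη⟩ : ∃ η : ℝ, 0 < η ∧
      μ Set.univ ^ (2 : ℝ≥0∞).toReal⁻¹ * ENNReal.ofReal η ≤ ε / 2 := by
    have h1 : Tendsto (fun η : ℝ => μ Set.univ ^ (2 : ℝ≥0∞).toReal⁻¹ * ENNReal.ofReal η)
        (𝓝[>] 0) (𝓝 0) := by
      have h2 : Tendsto (fun η : ℝ => ENNReal.ofReal η) (𝓝[>] 0) (𝓝 0) := by
        have := (ENNReal.continuous_ofReal.tendsto 0).mono_left (nhdsWithin_le_nhds (s := Set.Ioi 0))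
        simpa using this
      simpa using ENNReal.Tendsto.const_mul h2 (Or.inr hfin)
    have h3 := (h1.eventually_le_const (pos_iff_ne_zero.2 hε2)).and self_mem_nhdsWithin
    obtain ⟨η, h4, h5⟩ := h3.exists
    exact ⟨η, h5, h4⟩
  have huc := isCompact_Icc.uniformContinuousOn_of_continuous
    (g.continuous.continuousOn (s := Set.Icc (0 : ℝ) T))
  rw [Metric.uniformContinuousOn_iff_le] at huc
  obtain ⟨d, hd0, hd⟩ := huc η hη0
  obtain ⟨n, hn⟩ := exists_nat_gt (max ((T : ℝ) / d) 0)
  have hn0 : (0 : ℝ) < n := (le_max_right _ _).trans_lt hn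
  have hnT : (T : ℝ) / n ≤ d := by
    rw [div_le_iff₀ hn0, mul_comm]
    exact ((div_lt_iff₀ hd0).1 ((le_max_left _ _).trans_lt hn)).le
  have hn0' : (n : ℝ≥0) ≠ 0 := by
    have : (n : ℝ) ≠ 0 := hn0.ne'
    exact_mod_cast this
  let U : SimpleProcess 𝓕 := gridProcess 𝓕 (T / n) n (fun i => g (i * (T / n)))
    ⟨‖g‖, fun i => g.norm_coe_le_norm _⟩
  refine ⟨U, gridProcess_deterministic, fun ω => ?_⟩
  have hUm : AEStronglyMeasurable (fun s : ℝ => U.eval s.toNNReal ω) μ :=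
    (U.measurable_uncurry_eval.comp (measurable_prodMk_right (y := ω))).aestronglyMeasurable
  have h1 : eLpNorm ((fun s : ℝ => U.eval s.toNNReal ω) - (g : ℝ → ℝ)) 2 μ ≤ ε / 2 := by
    refine (eLpNorm_le_of_ae_bound (C := η) ?_).trans hη
    -- The intervals of a simple process are open on the left, so its value at `0` is `0` and this
    -- point has to be discarded.
    have h0 : ∀ᵐ s : ℝ ∂μ, s ≠ 0 := by
      refine ae_restrict_of_ae ?_
      exact Measure.ae_ne volume 0
    filter_upwards [ae_restrict_mem measurableSet_Icc, h0] with s hs hs0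
    have hspos : 0 < s := lt_of_le_of_ne hs.1 (Ne.symm hs0)
    have hs' : s.toNNReal ≤ n * (T / n) := by
      rw [mul_div_cancel₀ _ hn0']
      exact Real.toNNReal_le_iff_le_coe.2 hs.2
    obtain ⟨i, hi, he, hmem⟩ := gridProcess_eval (𝓕 := 𝓕) (h := T / n) (n := n)
      (f := fun i => g (i * (T / n))) (hf := ⟨‖g‖, fun i => g.norm_coe_le_norm _⟩)
      (Real.toNNReal_pos.2 hspos) hs' ω
    rw [Pi.sub_apply, show U.eval s.toNNReal ω = g (i * (T / n)) from he]
    refine (Real.dist_eq _ _).symm.trans_le ?_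
    have hsl : (i : ℝ) * (T / n) < s := by
      have := Real.lt_toNNReal_iff_coe_lt.1 hmem.1
      push_cast at this
      exact this
    have hsu : s ≤ ((i : ℝ) + 1) * (T / n) := by
      have := Real.toNNReal_le_iff_le_coe.1 hmem.2
      push_cast at this
      exact this
    refine hd _ ⟨by positivity, hsl.le.trans hs.2⟩ _ hs ?_
    rw [Real.dist_eq, abs_sub_comm, abs_of_pos (sub_pos.2 hsl)]
    linarith
  calc eLpNorm ((fun s : ℝ => U.eval s.toNNReal ω) - σ) 2 μ
      = eLpNorm (((fun s : ℝ => U.eval s.toNNReal ω) - (g : ℝ → ℝ)) + ((g : ℝ → ℝ) - σ)) 2 μ := by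
        congr 1; abel
    _ ≤ ε / 2 + ε / 2 := by
        refine (eLpNorm_add_le (hUm.sub hgm.1) (hgm.1.sub hσ.1) (by norm_num)).trans ?_
        gcongr
        rwa [eLpNorm_sub_comm]
    _ = ε := ENNReal.add_halves ε

/-- The increments of the integral of a deterministic simple process. -/
lemma SimpleProcess.charGauss_integral_sub [IsProbabilityMeasure P]
    (hW : IsFilteredBrownian 𝓕 W P) {U : SimpleProcess 𝓕} (hU : U.Deterministic) {s t : ℝ≥0}
    (hst : s ≤ t) (ω₀ : Ω) :
    CharGauss P (𝓕 s) (fun ω => U.integral W t ω - U.integral W s ω)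
      (∫⁻ y in Set.Ioc (s : ℝ) t, ‖U.eval y.toNNReal ω₀‖ₑ ^ 2).toReal := by
  classical
  -- The partition starts at `s`, passes through `t` and resolves the jumps of `U`. The claim is
  -- then proved by induction over all points `p b`, adding one Brownian increment at a time.
  obtain ⟨p, hp, hp0, hpc, hpr⟩ := exists_partition (U.times ∪ {s, t}) s
  have hUp : U.CompatWith p := compatWith_of_times hpc fun y hy => by simp [hy]
  obtain ⟨b, hb⟩ := hpr t (by simp) hst
  obtain ⟨f, hf⟩ := hU
  rw [← hb, ← hp0]
  clear hb hst
  induction b with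
  | zero => simpa using CharGauss.zero P (𝓕 (p 0))
  | succ b ih =>
    have hle := hp (Nat.le_succ b)
    have hX : Measurable[𝓕 (p b)] (fun ω => U.integral W (p b) ω - U.integral W (p 0) ω) :=
      (measurable_integral hW.adapted U _).sub
        ((measurable_integral hW.adapted U _).mono (𝓕.mono (hp (Nat.zero_le b))) le_rfl)
    have hY : Measurable (fun ω => W (p (b + 1)) ω - W (p b) ω) :=
      ((hW.adapted _).mono (𝓕.le _) le_rfl).sub ((hW.adapted _).mono (𝓕.le _) le_rfl)
    have := ih.add_const_mul (𝓕.le _) (𝓕.mono (hp (Nat.zero_le b))) hX hY (hW.indep _ _ hle)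
      (hW.hasLaw_sub hle) (f (p (b + 1)))
    convert this using 1
    · ext ω
      have := integral_sub_of_compat (W := W) hp hUp b ω
      rw [hf] at this
      linarith
    · rw [lintegral_Ioc_eq_sum hp _ (Nat.zero_le _), Finset.sum_Ico_succ_top (Nat.zero_le _),
        ← lintegral_Ioc_eq_sum hp _ (Nat.zero_le _), lintegral_Ioc_of_forall_eq hle
        (y := f (p (b + 1))) fun y hy => by
          rw [eval_eq_of_compat hUp (toNNReal_mem_Ioc hy), hf]]
      rw [ENNReal.toReal_add _ ENNReal.ofReal_ne_top,
        ENNReal.toReal_ofReal (mul_nonneg NNReal.zero_le_coe (sq_nonneg _))]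
      rw [lintegral_Ioc_eq_sum hp _ (Nat.zero_le _)]
      refine ENNReal.sum_ne_top.2 fun j _ => ?_
      rw [lintegral_Ioc_of_forall_eq (hp (Nat.le_succ j)) (y := f (p (j + 1))) fun y hy => by
          rw [eval_eq_of_compat hUp (toNNReal_mem_Ioc hy), hf]]
      exact ENNReal.ofReal_ne_top

end

/-! ### Construction of the Wiener integral. -/

section

variable {Ω : Type*} {mΩ : MeasurableSpace Ω} {P : Measure Ω}
  {𝓕 : Filtration ℝ≥0 mΩ} {W : ℝ≥0 → Ω → ℝ}

/-- `J` is the Wiener integral process of the deterministic function `σ` on `[0, T]`, approximated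
by the integrals of the simple processes `U n`. -/
structure IsWienerIntegral (𝓕 : Filtration ℝ≥0 mΩ) (W : ℝ≥0 → Ω → ℝ) (P : Measure Ω) (T : ℝ≥0)
    (σ : ℝ → ℝ) (U : ℕ → SimpleProcess 𝓕) (J : ℝ≥0 → Ω → ℝ) : Prop where
  approx : ∀ ω, Tendsto (fun n => ∫⁻ s in Set.Icc (0 : ℝ) T,
    ‖(U n).eval s.toNNReal ω - σ s‖ₑ ^ 2) atTop (𝓝 0)
  adapted : ∀ t, Measurable[𝓕 t] (J t)
  tendsto : ∀ t ≤ T, ∀ᵐ ω ∂P, Tendsto (fun n => (U n).integral W t ω) atTop (𝓝 (J t ω))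
  indep : ∀ s t, s ≤ t → t ≤ T →
    Indep (MeasurableSpace.comap (fun ω => J t ω - J s ω) inferInstance) (𝓕 s) P
  hasLaw : ∀ s t, s ≤ t → t ≤ T →
    HasLaw (fun ω => J t ω - J s ω) (gaussianReal 0 (∫ y in (s : ℝ)..t, σ y ^ 2).toNNReal) P

lemma SimpleProcess.integral_zero (V : SimpleProcess 𝓕) (ω : Ω) : V.integral W 0 ω = 0 := by
  simp [SimpleProcess.integral]

/-- Closeness of deterministic integrands gives closeness of the integrals. -/
lemma SimpleProcess.lintegral_min_sub_le [IsProbabilityMeasure P] (hW : IsFilteredBrownian 𝓕 W P)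
    (V U : SimpleProcess 𝓕) {T t : ℝ≥0} (htT : t ≤ T) {D : ℝ≥0∞} (hD : D ≠ ∞)
    (h : ∀ ω, ∫⁻ s in Set.Icc (0 : ℝ) T, ‖V.eval s.toNNReal ω - U.eval s.toNNReal ω‖ₑ ^ 2 ≤ D) :
    ∫⁻ ω, min (ENNReal.ofReal ((V.integral W t ω - U.integral W t ω) ^ 2)) 1 ∂P ≤ D := by
  -- A single coarse block `[0, t]` with unit weights; taking `δ = D` makes the exceptional event of
  -- the Lenglart bound empty.
  have h0 : Monotone (fun k : ℕ => if k = 0 then (0 : ℝ≥0) else t) := by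
    refine monotone_nat_of_le_succ fun k => ?_
    by_cases hk : k = 0 <;> simp [hk]
  have := (SimpleProcess.lintegral_min_le hW V U h0 (z := fun _ _ => 1) (x := fun _ _ => 1)
    (fun _ => measurable_const) (fun _ => measurable_const) (ENNReal.toReal_nonneg (a := D)) 1).1
  simp only [Finset.range_one, Finset.sum_singleton, one_mul, zero_add, if_true, one_ne_zero,
    if_false, integral_zero, sub_zero, ENNReal.ofReal_toReal hD] at this
  have he : {ω | D < ∫⁻ s in Set.Ioc ((0 : ℝ≥0) : ℝ) t,
      ‖V.eval s.toNNReal ω - U.eval s.toNNReal ω‖ₑ ^ 2} = ∅ := by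
    ext ω
    simp only [Set.mem_ofPred_eq, Set.mem_empty_iff_false, iff_false, not_lt]
    refine le_trans (lintegral_mono_set ?_) (h ω)
    exact Set.Ioc_subset_Icc_self.trans (Set.Icc_subset_Icc_right (by exact_mod_cast htT))
  rw [he, measure_empty, add_zero] at this
  exact this

/-- Since `4 ^ n ≥ 1`, a product below `1` rules out that the truncation is active; the root of `4 ^
n` gives the rate `2 ^ (-n)`. -/
lemma abs_lt_of_four_pow_mul_min_lt {n : ℕ} {x : ℝ}
    (h : (4 : ℝ≥0∞) ^ n * min (ENNReal.ofReal (x ^ 2)) 1 < 1) : |x| < (1 / 2) ^ n := by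
  have h4 : (1 : ℝ≥0∞) ≤ 4 ^ n := one_le_pow₀ (by norm_num)
  have h1 : (4 : ℝ≥0∞) ^ n * ENNReal.ofReal (x ^ 2) < 1 := by
    rcases le_total (ENNReal.ofReal (x ^ 2)) 1 with h' | h'
    · rwa [min_eq_left h'] at h
    · rw [min_eq_right h', mul_one] at h
      exact absurd h (not_lt.2 h4)
  have h2 : (4 : ℝ) ^ n * x ^ 2 < 1 := by
    have e : (4 : ℝ≥0∞) ^ n = ENNReal.ofReal ((4 : ℝ) ^ n) := by
      rw [ENNReal.ofReal_pow (by norm_num)]; norm_num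
    rw [e, ← ENNReal.ofReal_mul (by positivity), ← ENNReal.ofReal_one,
      ENNReal.ofReal_lt_ofReal_iff one_pos] at h1
    exact h1
  have h3 : |2 ^ n * x| < 1 := by
    rw [← sq_lt_one_iff_abs_lt_one, mul_pow, ← pow_mul, mul_comm n 2, pow_mul]
    norm_num
    exact h2
  rw [abs_mul, abs_of_pos (by positivity : (0 : ℝ) < 2 ^ n)] at h3
  rw [one_div, inv_pow, ← one_div, lt_div_iff₀ (by positivity), mul_comm]
  exact h3

/-- With `L²` errors `4 ^ (-n)` the squared distance of consecutive approximations is at most `4 *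
16 ^ (-n)`. The weight `4 ^ n` still leaves a summable sequence. -/
lemma four_pow_mul_le (n : ℕ) :
    (4 : ℝ≥0∞) ^ n * (((4 : ℝ≥0∞)⁻¹ ^ n + (4 : ℝ≥0∞)⁻¹ ^ (n + 1)) ^ 2) ≤ 4 * (4 : ℝ≥0∞)⁻¹ ^ n := by
  have h1 : (4 : ℝ≥0∞)⁻¹ ^ (n + 1) ≤ (4 : ℝ≥0∞)⁻¹ ^ n :=
    pow_le_pow_right_of_le_one' (ENNReal.inv_le_one.2 (by norm_num)) (Nat.le_succ n)
  have h2 : (4 : ℝ≥0∞) ^ n * (4 : ℝ≥0∞)⁻¹ ^ n = 1 := by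
    rw [← mul_pow, ENNReal.mul_inv_cancel (by norm_num) (by norm_num), one_pow]
  calc _ ≤ (4 : ℝ≥0∞) ^ n * (((4 : ℝ≥0∞)⁻¹ ^ n + (4 : ℝ≥0∞)⁻¹ ^ n) ^ 2) := by gcongr
    _ = 4 * ((4 : ℝ≥0∞) ^ n * (4 : ℝ≥0∞)⁻¹ ^ n) * (4 : ℝ≥0∞)⁻¹ ^ n := by ring
    _ = _ := by rw [h2, mul_one]

lemma tsum_four_inv_ne_top : ∑' n : ℕ, 4 * (4 : ℝ≥0∞)⁻¹ ^ n ≠ ∞ := by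
  rw [ENNReal.tsum_mul_left, ENNReal.tsum_geometric]
  refine ENNReal.mul_ne_top (by norm_num) (ENNReal.inv_ne_top.2 ?_)
  exact (tsub_pos_of_lt (ENNReal.inv_lt_one.2 (by norm_num))).ne'

/-- Continuity of the `L²` norm, in the form needed for variances. -/
lemma tendsto_toReal_lintegral_sq {α : Type*} {mα : MeasurableSpace α} {μ : Measure α}
    {f : ℕ → α → ℝ} {g : α → ℝ} (hf : ∀ n, MemLp (f n) 2 μ) (hg : MemLp g 2 μ)
    (h : Tendsto (fun n => eLpNorm (f n - g) 2 μ) atTop (𝓝 0)) :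
    Tendsto (fun n => (∫⁻ x, ‖f n x‖ₑ ^ 2 ∂μ).toReal) atTop (𝓝 (∫⁻ x, ‖g x‖ₑ ^ 2 ∂μ).toReal) := by
  simp_rw [lintegral_enorm_sq_eq, ENNReal.toReal_pow]
  refine Tendsto.pow ?_ 2
  have h1 : Tendsto (fun n => (hf n).toLp (f n)) atTop (𝓝 (hg.toLp g)) :=
    (Lp.tendsto_Lp_iff_tendsto_eLpNorm'' _ hf _ hg).2 h
  simpa [Lp.norm_toLp] using h1.norm

lemma toReal_lintegral_enorm_sq {σ : ℝ → ℝ} {s t : ℝ≥0} (hst : s ≤ t)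
    (hσ : MemLp σ 2 (volume.restrict (Set.Ioc (s : ℝ) t))) :
    (∫⁻ y in Set.Ioc (s : ℝ) t, ‖σ y‖ₑ ^ 2).toReal = ∫ y in (s : ℝ)..t, σ y ^ 2 := by
  rw [intervalIntegral.integral_of_le (by exact_mod_cast hst),
    integral_eq_lintegral_of_nonneg_ae (ae_of_all _ fun y => sq_nonneg _)
      hσ.integrable_sq.aestronglyMeasurable]
  congr 1
  refine lintegral_congr fun y => ?_
  rw [← sq_abs, ENNReal.ofReal_pow (abs_nonneg _), ← Real.norm_eq_abs, ofReal_norm]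

/-- Existence of the Wiener integral. -/
theorem exists_isWienerIntegral [IsProbabilityMeasure P] (hW : IsFilteredBrownian 𝓕 W P)
    {T : ℝ≥0} {σ : ℝ → ℝ} (hσ : MemLp σ 2 (volume.restrict (Set.Icc (0 : ℝ) T))) :
    ∃ U J, IsWienerIntegral 𝓕 W P T σ U J := by
  have hne : ∀ n : ℕ, (4 : ℝ≥0∞)⁻¹ ^ n ≠ 0 := fun n => pow_ne_zero _ (by simp)
  choose U hUd hU using fun n : ℕ => exists_simple_eLpNorm_sub_le 𝓕 hσ (hne n)
  obtain ⟨ω₀⟩ : Nonempty Ω := nonempty_of_isProbabilityMeasure P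
  set μ := volume.restrict (Set.Icc (0 : ℝ) T) with hμ
  have hUm : ∀ n ω, AEStronglyMeasurable (fun s : ℝ => (U n).eval s.toNNReal ω) μ := fun n ω =>
    ((U n).measurable_uncurry_eval.comp (measurable_prodMk_right (y := ω))).aestronglyMeasurable
  have hUL : ∀ n ω, MemLp (fun s : ℝ => (U n).eval s.toNNReal ω) 2 μ := fun n ω => by
    have h1 : MemLp ((fun s : ℝ => (U n).eval s.toNNReal ω) - σ) 2 μ :=
      ⟨(hUm n ω).sub hσ.1, (hU n ω).trans_lt (by
        exact ENNReal.pow_lt_top (by simp))⟩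
    simpa using h1.add hσ
  have hpow0 : Tendsto (fun n : ℕ => (4 : ℝ≥0∞)⁻¹ ^ n) atTop (𝓝 0) :=
    ENNReal.tendsto_pow_atTop_nhds_zero_of_lt_one (ENNReal.inv_lt_one.2 (by norm_num))
  have happ : ∀ ω, Tendsto (fun n =>
      eLpNorm ((fun s : ℝ => (U n).eval s.toNNReal ω) - σ) 2 μ) atTop (𝓝 0) := fun ω =>
    tendsto_of_tendsto_of_tendsto_of_le_of_le tendsto_const_nhds hpow0 (fun _ => zero_le)
      (fun n => hU n ω)
  -- Defining `J` as a limit at every `ω`, with a junk value where there is none, makes it adapted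
  -- to `𝓕` itself, with no completion by null sets.
  let J : ℝ≥0 → Ω → ℝ := fun t ω => limUnder atTop (fun n => (U n).integral W t ω)
  have hJm : ∀ t, Measurable[𝓕 t] (J t) := fun t =>
    (@StronglyMeasurable.limUnder ℕ Ω ℝ (𝓕 t) _ _ _ _ _ _ _ (fun n =>
      (SimpleProcess.measurable_integral hW.adapted (U n) t).stronglyMeasurable)).measurable
  have hUmeas : ∀ n t, Measurable ((U n).integral W t) := fun n t =>
    (SimpleProcess.measurable_integral hW.adapted (U n) t).mono (𝓕.le t) le_rfl
  have hconv : ∀ t ≤ T, ∀ᵐ ω ∂P,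
      Tendsto (fun n => (U n).integral W t ω) atTop (𝓝 (J t ω)) := by
    intro t ht
    have hb : ∀ n, ∫⁻ ω, min (ENNReal.ofReal
        (((U n).integral W t ω - (U (n + 1)).integral W t ω) ^ 2)) 1 ∂P
        ≤ ((4 : ℝ≥0∞)⁻¹ ^ n + (4 : ℝ≥0∞)⁻¹ ^ (n + 1)) ^ 2 := by
      intro n
      refine SimpleProcess.lintegral_min_sub_le hW _ _ ht ?_ fun ω => ?_
      · exact ENNReal.pow_ne_top (ENNReal.add_ne_top.2 ⟨ENNReal.pow_ne_top (by simp),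
          ENNReal.pow_ne_top (by simp)⟩)
      · rw [lintegral_enorm_sq_eq]
        gcongr
        have e : (fun s : ℝ => (U n).eval s.toNNReal ω - (U (n + 1)).eval s.toNNReal ω)
            = ((fun s : ℝ => (U n).eval s.toNNReal ω) - σ)
              + (σ - fun s : ℝ => (U (n + 1)).eval s.toNNReal ω) := by
          ext s; simp
        rw [e]
        refine (eLpNorm_add_le ((hUm n ω).sub hσ.1) (hσ.1.sub (hUm _ ω)) (by norm_num)).trans ?_
        rw [eLpNorm_sub_comm σ]
        exact add_le_add (hU n ω) (hU (n + 1) ω)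
    -- The weighted truncated squares have summable integrals. Hence almost surely consecutive
    -- integrals eventually differ by less than `2 ^ (-n)`, and the sequence is Cauchy.
    have h0 := ae_tendsto_zero_of_tsum_lintegral (P := P) (f := fun n ω => (4 : ℝ≥0∞) ^ n *
      min (ENNReal.ofReal (((U n).integral W t ω - (U (n + 1)).integral W t ω) ^ 2)) 1)
      (fun n => by
        have h1 := hUmeas n t
        have h2 := hUmeas (n + 1) t
        fun_prop)
      (ne_top_of_le_ne_top tsum_four_inv_ne_top (ENNReal.tsum_le_tsum fun n => by
        rw [lintegral_const_mul' _ _ (ENNReal.pow_ne_top (by norm_num))]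
        exact le_trans (by gcongr; exact hb n) (four_pow_mul_le n)))
    filter_upwards [h0] with ω hω
    refine CauchySeq.tendsto_limUnder (cauchySeq_of_summable_dist ?_)
    have hev := hω.eventually_lt_const one_pos
    refine Summable.of_norm_bounded_eventually_nat (g := fun n : ℕ => (1 / 2 : ℝ) ^ n)
      (summable_geometric_of_lt_one (by norm_num) (by norm_num)) ?_
    filter_upwards [hev] with n hn
    rw [Real.norm_eq_abs, abs_of_nonneg dist_nonneg, Real.dist_eq]
    exact (abs_lt_of_four_pow_mul_min_lt hn).le
  have hchar : ∀ s t, s ≤ t → t ≤ T → CharGauss P (𝓕 s) (fun ω => J t ω - J s ω)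
      ((∫ y in (s : ℝ)..t, σ y ^ 2).toNNReal : ℝ) := by
    intro s t hst htT
    have hsub : Set.Ioc (s : ℝ) t ⊆ Set.Icc (0 : ℝ) T :=
      Set.Ioc_subset_Icc_self.trans (Set.Icc_subset_Icc s.2 (by exact_mod_cast htT))
    have hle : volume.restrict (Set.Ioc (s : ℝ) t) ≤ μ := Measure.restrict_mono hsub le_rfl
    rw [Real.coe_toNNReal _ (intervalIntegral.integral_nonneg (by exact_mod_cast hst)
      fun y _ => sq_nonneg _)]
    refine CharGauss.of_tendsto (fun n => (hUmeas n t).sub (hUmeas n s))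
      (fun n => SimpleProcess.charGauss_integral_sub hW (hUd n) hst ω₀) ?_ ?_
    · filter_upwards [hconv t htT, hconv s (hst.trans htT)] with ω h1 h2
      exact h1.sub h2
    · rw [← toReal_lintegral_enorm_sq hst (hσ.mono_measure hle)]
      refine tendsto_toReal_lintegral_sq (fun n => (hUL n ω₀).mono_measure hle)
        (hσ.mono_measure hle) ?_
      exact tendsto_of_tendsto_of_tendsto_of_le_of_le tendsto_const_nhds (happ ω₀)
        (fun _ => zero_le) (fun n => eLpNorm_mono_measure _ hle)
  have hJm' : ∀ t, Measurable (J t) := fun t => (hJm t).mono (𝓕.le t) le_rfl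
  refine ⟨U, J, fun ω => ?_, hJm, hconv, fun s t hst htT => ?_, fun s t hst htT => ?_⟩
  · have := ENNReal.Tendsto.pow (n := 2) (happ ω)
    simp_rw [← lintegral_enorm_sq_eq] at this
    simpa using this
  · exact ((hchar s t hst htT).indep_and_hasLaw (𝓕.le s) ((hJm' t).sub (hJm' s))).1
  · exact ((hchar s t hst htT).indep_and_hasLaw (𝓕.le s) ((hJm' t).sub (hJm' s))).2

end

/-! ### Itô integrals compared with frozen multiples of the Wiener integral. -/

section

variable {Ω : Type*} {mΩ : MeasurableSpace Ω} {P : Measure Ω}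
  {𝓕 : Filtration ℝ≥0 mΩ} {W : ℝ≥0 → Ω → ℝ}

/-- Along a subsequence, the simple approximations of an Itô integral converge almost surely. -/
lemma IsItoIntegral.exists_ae_approx {T : ℝ≥0} {H Y : ℝ≥0 → Ω → ℝ}
    (h : IsItoIntegral 𝓕 W P T H Y) :
    ∃ V : ℕ → SimpleProcess 𝓕, ∀ᵐ ω ∂P,
      Tendsto (fun n => ∫⁻ s in Set.Icc (0 : ℝ) T,
        ‖(V n).eval s.toNNReal ω - H s.toNNReal ω‖ₑ ^ 2) atTop (𝓝 0) ∧
      ∀ t ≤ T, Tendsto (fun n => (V n).integral W t ω) atTop (𝓝 (Y t ω)) := by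
  obtain ⟨V, hV1, hV2⟩ := h.approx
  have hpos : ∀ n : ℕ, (0 : ℝ≥0∞) < (2⁻¹ : ℝ≥0∞) ^ n := fun n =>
    pos_iff_ne_zero.2 (pow_ne_zero n (by simp))
  have hpos' : ∀ n : ℕ, (0 : ℝ) < (1 / 2 : ℝ) ^ n := fun n => by positivity
  -- One index serves both approximations, with exceptional probabilities at most `2 ^ (-n)`;
  -- Borel–Cantelli then applies.
  have hex : ∀ n : ℕ, ∃ k, P {ω | (2⁻¹ : ℝ≥0∞) ^ n ≤ ∫⁻ s in Set.Icc (0 : ℝ) T,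
        ‖(V k).eval s.toNNReal ω - H s.toNNReal ω‖ₑ ^ 2} ≤ (2⁻¹ : ℝ≥0∞) ^ n ∧
      P {ω | ∃ t ≤ T, (1 / 2 : ℝ) ^ n ≤ |(V k).integral W t ω - Y t ω|} ≤ (2⁻¹ : ℝ≥0∞) ^ n :=
    fun n => (((hV1 _ (hpos n)).eventually_le_const (hpos n)).and
      ((hV2 _ (hpos' n)).eventually_le_const (hpos n))).exists
  choose k hk1 hk2 using hex
  have hsum : ∑' n : ℕ, (2⁻¹ : ℝ≥0∞) ^ n ≠ ∞ := by
    rw [ENNReal.tsum_geometric]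
    exact ENNReal.inv_ne_top.2 (tsub_pos_of_lt (ENNReal.inv_lt_one.2 (by norm_num))).ne'
  refine ⟨fun n => V (k n), ?_⟩
  filter_upwards [ae_eventually_notMem (ne_top_of_le_ne_top hsum (ENNReal.tsum_le_tsum hk1)),
    ae_eventually_notMem (ne_top_of_le_ne_top hsum (ENNReal.tsum_le_tsum hk2))] with ω h1 h2
  constructor
  · refine tendsto_of_tendsto_of_tendsto_of_le_of_le' tendsto_const_nhds
      (ENNReal.tendsto_pow_atTop_nhds_zero_of_lt_one (r := 2⁻¹) (ENNReal.inv_lt_one.2 (by norm_num)))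
      (Eventually.of_forall fun _ => zero_le) ?_
    filter_upwards [h1] with n hn
    exact (not_le.1 hn).le
  · intro t ht
    rw [tendsto_iff_dist_tendsto_zero]
    refine tendsto_of_tendsto_of_tendsto_of_le_of_le' tendsto_const_nhds
      (tendsto_pow_atTop_nhds_zero_of_lt_one (r := (1 / 2 : ℝ)) (by norm_num) (by norm_num))
      (Eventually.of_forall fun _ => dist_nonneg) ?_
    filter_upwards [h2] with n hn
    rw [Real.dist_eq]
    exact (not_le.1 fun hle => hn ⟨t, ht, hle⟩).le

/-- Write `z (a - y c) = z (b - y d) + z (a - b) - z y (c - d)` and bound the square of a sum of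
three terms. This is the source of the factor `3` in front of every bracket below. -/
lemma enorm_add_sq_le (a b c d y z : ℝ) :
    ‖z * (a - y * c)‖ₑ ^ 2 ≤ 3 * (‖z * (b - y * d)‖ₑ ^ 2
      + ‖z‖ₑ ^ 2 * (‖a - b‖ₑ ^ 2 + ‖y‖ₑ ^ 2 * ‖c - d‖ₑ ^ 2)) := by
  have e : ∀ x : ℝ, ‖x‖ₑ ^ 2 = ENNReal.ofReal (x ^ 2) := fun x => by
    rw [← sq_abs, ENNReal.ofReal_pow (abs_nonneg x), ← Real.norm_eq_abs, ofReal_norm]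
  simp_rw [e]
  rw [← ENNReal.ofReal_mul (sq_nonneg _), ← ENNReal.ofReal_add (by positivity) (by positivity),
    ← ENNReal.ofReal_mul (sq_nonneg _), ← ENNReal.ofReal_add (by positivity) (by positivity),
    show (3 : ℝ≥0∞) = ENNReal.ofReal 3 by norm_num, ← ENNReal.ofReal_mul (by norm_num)]
  refine ENNReal.ofReal_le_ofReal ?_
  have h : ∀ p q r : ℝ, (p + q + r) ^ 2 ≤ 3 * (p ^ 2 + q ^ 2 + r ^ 2) := fun p q r => by
    nlinarith [sq_nonneg (p - q), sq_nonneg (p - r), sq_nonneg (q - r)]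
  have := h (z * (b - y * d)) (z * (a - b)) (-(z * y * (c - d)))
  calc _ = (z * (b - y * d) + z * (a - b) + -(z * y * (c - d))) ^ 2 := by ring
    _ ≤ _ := this
    _ = _ := by ring

section CoarseLenglart

variable {T : ℝ≥0} {H Y : ℝ≥0 → Ω → ℝ} {σ : ℝ → ℝ} {U : ℕ → SimpleProcess 𝓕} {J : ℝ≥0 → Ω → ℝ}

/-- The error made on `[t k, t (k + 1)]` when replacing the integrand `H` by `x k * σ`. -/
def blockError (Y J : ℝ≥0 → Ω → ℝ) (t : ℕ → ℝ≥0) (x : ℕ → Ω → ℝ) (k : ℕ) (ω : Ω) : ℝ :=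
  Y (t (k + 1)) ω - Y (t k) ω - x k ω * (J (t (k + 1)) ω - J (t k) ω)

/-- The bracket of the weighted sum of the block errors. -/
def blockBracket (H : ℝ≥0 → Ω → ℝ) (σ : ℝ → ℝ) (t : ℕ → ℝ≥0) (z x : ℕ → Ω → ℝ) (m : ℕ) (ω : Ω) :
    ℝ≥0∞ :=
  ∑ k ∈ Finset.range m, ∫⁻ s in Set.Ioc (t k : ℝ) (t (k + 1)),
    ‖z k ω * (H s.toNNReal ω - x k ω * σ s)‖ₑ ^ 2

lemma aemeasurable_lintegral_Ioc [SFinite P] {f : ℝ × Ω → ℝ}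
    (hf : AEStronglyMeasurable f ((volume.restrict (Set.Icc (0 : ℝ) T)).prod P))
    {s : Set ℝ} (hs : s ⊆ Set.Icc 0 T) :
    AEMeasurable (fun ω => ∫⁻ r in s, ‖f (r, ω)‖ₑ ^ 2) P := by
  have h1 : AEStronglyMeasurable f ((volume.restrict s).prod P) :=
    hf.mono_ac (Measure.AbsolutelyContinuous.prod
      (Measure.restrict_mono hs le_rfl).absolutelyContinuous (Measure.AbsolutelyContinuous.refl P))
  exact (h1.enorm.pow_const 2).lintegral_prod_left'

/-- The Lenglart inequality for simple processes passed to the limit: `V n` approximates the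
integrand `H` and `U n` approximates `σ`. The first conclusion controls the weighted sum of block
errors, the second their sum of squares. Only adaptedness of the weights `z` and `x` is needed, no
integrability. -/
lemma IsItoIntegral.lintegral_min_blockError_le [IsProbabilityMeasure P]
    (hW : IsFilteredBrownian 𝓕 W P) (hY : IsItoIntegral 𝓕 W P T H Y)
    (hJ : IsWienerIntegral 𝓕 W P T σ U J)
    (hσ : AEStronglyMeasurable σ (volume.restrict (Set.Icc (0 : ℝ) T)))
    {t : ℕ → ℝ≥0} (ht : Monotone t) (htT : ∀ k, t k ≤ T) {z x : ℕ → Ω → ℝ}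
    (hz : ∀ k, Measurable[𝓕 (t k)] (z k)) (hx : ∀ k, Measurable[𝓕 (t k)] (x k))
    {δ : ℝ} (hδ : 0 < δ) (m : ℕ) :
    (AEMeasurable (fun ω => ∑ k ∈ Finset.range m, z k ω * blockError Y J t x k ω) P ∧
     AEMeasurable (fun ω => ∑ k ∈ Finset.range m, (z k ω * blockError Y J t x k ω) ^ 2) P ∧
     AEMeasurable (blockBracket H σ t z x m) P) ∧
    (∫⁻ ω, min (ENNReal.ofReal ((∑ k ∈ Finset.range m, z k ω * blockError Y J t x k ω) ^ 2)) 1 ∂P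
      ≤ ENNReal.ofReal δ
        + ∫⁻ ω, min (3 * blockBracket H σ t z x m ω / ENNReal.ofReal δ) 1 ∂P) ∧
    (∫⁻ ω, min (ENNReal.ofReal (∑ k ∈ Finset.range m, (z k ω * blockError Y J t x k ω) ^ 2)) 1 ∂P
      ≤ ENNReal.ofReal δ
        + ∫⁻ ω, min (3 * blockBracket H σ t z x m ω / ENNReal.ofReal δ) 1 ∂P) := by
  obtain ⟨V, hV⟩ := hY.exists_ae_approx
  have hz' : ∀ k, Measurable (z k) := fun k => (hz k).mono (𝓕.le _) le_rfl
  have hx' : ∀ k, Measurable (x k) := fun k => (hx k).mono (𝓕.le _) le_rfl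
  have hSm : ∀ (G : SimpleProcess 𝓕) (s : ℝ≥0), Measurable (G.integral W s) := fun G s =>
    (SimpleProcess.measurable_integral hW.adapted G s).mono (𝓕.le s) le_rfl
  let e : ℕ → ℕ → Ω → ℝ := fun n k ω =>
    (V n).integral W (t (k + 1)) ω - (V n).integral W (t k) ω
          - x k ω * ((U n).integral W (t (k + 1)) ω - (U n).integral W (t k) ω)
  have hem : ∀ n k, Measurable (e n k) := fun n k =>
    ((hSm _ _).sub (hSm _ _)).sub ((hx' k).mul ((hSm _ _).sub (hSm _ _)))
  have hJt : ∀ᵐ ω ∂P, ∀ k, Tendsto (fun n => (U n).integral W (t k) ω) atTop (𝓝 (J (t k) ω)) :=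
    ae_all_iff.2 fun k => hJ.tendsto _ (htT k)
  have he : ∀ᵐ ω ∂P, ∀ k, Tendsto (fun n => e n k ω) atTop (𝓝 (blockError Y J t x k ω)) := by
    filter_upwards [hV, hJt] with ω h1 h2 k
    exact ((h1.2 _ (htT (k + 1))).sub (h1.2 _ (htT k))).sub
      (((h2 (k + 1)).sub (h2 k)).const_mul _)
  -- the two functionals
  let A : ℕ → Ω → ℝ := fun n ω => ∑ k ∈ Finset.range m, z k ω * e n k ω
  let B : ℕ → Ω → ℝ := fun n ω => ∑ k ∈ Finset.range m, (z k ω * e n k ω) ^ 2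
  have hAm : ∀ n, Measurable (A n) := fun n =>
    Finset.measurable_fun_sum _ fun k _ => (hz' k).mul (hem n k)
  have hBm : ∀ n, Measurable (B n) := fun n =>
    Finset.measurable_fun_sum _ fun k _ => ((hz' k).mul (hem n k)).pow_const 2
  have hA : ∀ᵐ ω ∂P, Tendsto (fun n => A n ω) atTop
      (𝓝 (∑ k ∈ Finset.range m, z k ω * blockError Y J t x k ω)) := by
    filter_upwards [he] with ω h
    exact tendsto_finsetSum _ fun k _ => (h k).const_mul _
  have hB : ∀ᵐ ω ∂P, Tendsto (fun n => B n ω) atTop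
      (𝓝 (∑ k ∈ Finset.range m, (z k ω * blockError Y J t x k ω) ^ 2)) := by
    filter_upwards [he] with ω h
    exact tendsto_finsetSum _ fun k _ => ((h k).const_mul _).pow 2
  -- the brackets
  have hsub : ∀ k, Set.Ioc (t k : ℝ) (t (k + 1)) ⊆ Set.Icc (0 : ℝ) T := fun k =>
    Set.Ioc_subset_Icc_self.trans (Set.Icc_subset_Icc (t k).2 (by exact_mod_cast htT (k + 1)))
  have hDm : AEMeasurable (blockBracket H σ t z x m) P := by
    refine Finset.aemeasurable_fun_sum _ fun k _ => ?_
    refine aemeasurable_lintegral_Ioc (P := P) (T := T)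
      (f := fun q => z k q.2 * (H q.1.toNNReal q.2 - x k q.2 * σ q.1)) ?_ (hsub k)
    exact ((hz' k).comp measurable_snd).aestronglyMeasurable.mul
      (hY.aestronglyMeasurable.sub
        (((hx' k).comp measurable_snd).aestronglyMeasurable.mul hσ.comp_fst))
  let R : ℕ → Ω → ℝ≥0∞ := fun n ω => ∫⁻ s in Set.Icc (0 : ℝ) T,
    ‖(V n).eval s.toNNReal ω - H s.toNNReal ω‖ₑ ^ 2
  let Q : ℕ → Ω → ℝ≥0∞ := fun n ω => ∫⁻ s in Set.Icc (0 : ℝ) T,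
    ‖(U n).eval s.toNNReal ω - σ s‖ₑ ^ 2
  have hRm : ∀ n, AEMeasurable (R n) P := fun n =>
    aemeasurable_lintegral_Ioc (P := P) (T := T)
      (f := fun q => (V n).eval q.1.toNNReal q.2 - H q.1.toNNReal q.2)
      ((V n).measurable_uncurry_eval.aestronglyMeasurable.sub hY.aestronglyMeasurable)
      (Set.Subset.refl _)
  have hQm : ∀ n, AEMeasurable (Q n) P := fun n =>
    aemeasurable_lintegral_Ioc (P := P) (T := T)
      (f := fun q => (U n).eval q.1.toNNReal q.2 - σ q.1)
      ((U n).measurable_uncurry_eval.aestronglyMeasurable.sub hσ.comp_fst)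
      (Set.Subset.refl _)
  -- This dominates the change of the bracket when `H`, `σ` are replaced by `V n`, `U n`; crudely,
  -- each block is charged with the errors on the whole of `[0, T]`.
  let r : ℕ → Ω → ℝ≥0∞ := fun n ω => ∑ k ∈ Finset.range m,
    ‖z k ω‖ₑ ^ 2 * (R n ω + ‖x k ω‖ₑ ^ 2 * Q n ω)
  have hrm : ∀ n, AEMeasurable (r n) P := fun n =>
    Finset.aemeasurable_fun_sum _ fun k _ => ((hz' k).enorm.pow_const 2).aemeasurable.mul
      ((hRm n).add (((hx' k).enorm.pow_const 2).aemeasurable.mul (hQm n)))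
  have hr0 : ∀ᵐ ω ∂P, Tendsto (fun n => r n ω) atTop (𝓝 0) := by
    filter_upwards [hV] with ω h
    have h1 : ∀ k, Tendsto (fun n => ‖z k ω‖ₑ ^ 2 * (R n ω + ‖x k ω‖ₑ ^ 2 * Q n ω)) atTop
        (𝓝 (‖z k ω‖ₑ ^ 2 * (0 + ‖x k ω‖ₑ ^ 2 * 0))) := fun k =>
      ENNReal.Tendsto.const_mul (h.1.add (ENNReal.Tendsto.const_mul (hJ.approx ω)
        (Or.inr (ENNReal.pow_ne_top enorm_ne_top)))) (Or.inr (ENNReal.pow_ne_top enorm_ne_top))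
    simpa using tendsto_finsetSum (Finset.range m) fun k _ => h1 k
  have hδ' : ENNReal.ofReal δ ≠ 0 := by simpa using hδ
  have hHm : ∀ᵐ ω ∂P, AEStronglyMeasurable (fun s : ℝ => H s.toNNReal ω)
      (volume.restrict (Set.Icc (0 : ℝ) T)) :=
    hY.aestronglyMeasurable.prod_swap.prodMk_left
  have hDle : ∀ n, ∀ᵐ ω ∂P, (∑ k ∈ Finset.range m, ∫⁻ s in Set.Ioc (t k : ℝ) (t (k + 1)),
      ‖z k ω * ((V n).eval s.toNNReal ω - x k ω * (U n).eval s.toNNReal ω)‖ₑ ^ 2)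
      ≤ 3 * (blockBracket H σ t z x m ω + r n ω) := by
    intro n
    filter_upwards [hHm] with ω hω
    have hVm : AEStronglyMeasurable (fun s : ℝ => (V n).eval s.toNNReal ω)
        (volume.restrict (Set.Icc (0 : ℝ) T)) :=
      ((V n).measurable_uncurry_eval.comp (measurable_prodMk_right (y := ω))).aestronglyMeasurable
    simp only [blockBracket, r]
    rw [← Finset.sum_add_distrib, Finset.mul_sum]
    refine Finset.sum_le_sum fun k _ => ?_
    have hr := Measure.restrict_mono (μ := volume) (hsub k) le_rfl
    calc _ ≤ ∫⁻ s in Set.Ioc (t k : ℝ) (t (k + 1)), 3 * (‖z k ω * (H s.toNNReal ω - x k ω * σ s)‖ₑ ^ 2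
            + ‖z k ω‖ₑ ^ 2 * (‖(V n).eval s.toNNReal ω - H s.toNNReal ω‖ₑ ^ 2
              + ‖x k ω‖ₑ ^ 2 * ‖(U n).eval s.toNNReal ω - σ s‖ₑ ^ 2)) :=
          lintegral_mono fun s => enorm_add_sq_le _ _ _ _ _ _
      _ = 3 * ((∫⁻ s in Set.Ioc (t k : ℝ) (t (k + 1)), ‖z k ω * (H s.toNNReal ω - x k ω * σ s)‖ₑ ^ 2)
            + ∫⁻ s in Set.Ioc (t k : ℝ) (t (k + 1)),
              ‖z k ω‖ₑ ^ 2 * (‖(V n).eval s.toNNReal ω - H s.toNNReal ω‖ₑ ^ 2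
              + ‖x k ω‖ₑ ^ 2 * ‖(U n).eval s.toNNReal ω - σ s‖ₑ ^ 2)) := by
          rw [lintegral_const_mul' _ _ (by norm_num), lintegral_add_left']
          exact (((hω.mono_measure hr).sub ((hσ.mono_measure hr).const_mul _)).const_mul
            _).enorm.pow_const 2
      _ ≤ _ := by
          gcongr
          refine (lintegral_mono' hr le_rfl).trans (le_of_eq ?_)
          rw [lintegral_const_mul' _ _ (ENNReal.pow_ne_top enorm_ne_top), lintegral_add_left',
            lintegral_const_mul' _ _ (ENNReal.pow_ne_top enorm_ne_top)]
          exact (hVm.sub hω).enorm.pow_const 2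
  -- Markov's inequality trades the event for a truncated integral, which depends continuously on
  -- the bracket and so passes to the limit by dominated convergence.
  have hP : ∀ n, P {ω | ENNReal.ofReal δ < ∑ k ∈ Finset.range m,
      ∫⁻ s in Set.Ioc (t k : ℝ) (t (k + 1)),
        ‖z k ω * ((V n).eval s.toNNReal ω - x k ω * (U n).eval s.toNNReal ω)‖ₑ ^ 2}
      ≤ ∫⁻ ω, min (3 * (blockBracket H σ t z x m ω + r n ω) / ENNReal.ofReal δ) 1 ∂P := by
    intro n
    have hm : AEMeasurable (fun ω =>
        min (3 * (blockBracket H σ t z x m ω + r n ω) / ENNReal.ofReal δ) 1) P :=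
      (((hDm.add (hrm n)).const_mul 3).div_const _).min aemeasurable_const
    refine le_trans (measure_mono_ae ?_) ((meas_ge_le_lintegral_div hm one_ne_zero
      ENNReal.one_ne_top).trans (by simp))
    filter_upwards [hDle n] with ω hDω hω
    refine le_min ?_ le_rfl
    rw [ENNReal.le_div_iff_mul_le (Or.inl hδ') (Or.inl ENNReal.ofReal_ne_top), one_mul]
    exact (le_of_lt hω).trans hDω
  have hlim : Tendsto (fun n =>
      ENNReal.ofReal δ +
        ∫⁻ ω, min (3 * (blockBracket H σ t z x m ω + r n ω) / ENNReal.ofReal δ) 1 ∂P)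
      atTop (𝓝 (ENNReal.ofReal δ
        + ∫⁻ ω, min (3 * blockBracket H σ t z x m ω / ENNReal.ofReal δ) 1 ∂P)) := by
    refine Tendsto.const_add _ ?_
    refine tendsto_lintegral_of_dominated_convergence' (fun _ => 1)
      (fun n => (((hDm.add (hrm n)).const_mul 3).div_const _).min
        aemeasurable_const)
      (fun n => ae_of_all _ fun ω => min_le_right _ _) (by simp) ?_
    filter_upwards [hr0] with ω h
    refine Tendsto.min ?_ tendsto_const_nhds
    refine ENNReal.Tendsto.div_const ?_ (Or.inr hδ')
    refine ENNReal.Tendsto.const_mul ?_ (Or.inr (by norm_num))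
    simpa using h.const_add (blockBracket H σ t z x m ω)
  have hc : Continuous fun y : ℝ => min (ENNReal.ofReal y) 1 :=
    ENNReal.continuous_ofReal.min continuous_const
  refine ⟨⟨aemeasurable_of_tendsto_metrizable_ae _ (fun n => (hAm n).aemeasurable) hA,
    aemeasurable_of_tendsto_metrizable_ae _ (fun n => (hBm n).aemeasurable) hB, hDm⟩, ?_, ?_⟩
  · refine le_of_tendsto_of_tendsto' (tendsto_lintegral_of_dominated_convergence'
      (F := fun n ω => min (ENNReal.ofReal (A n ω ^ 2)) 1) (fun _ => 1)
      (fun n => (hc.measurable.comp ((hAm n).pow_const 2)).aemeasurable)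
      (fun n => ae_of_all _ fun ω => min_le_right _ _) (by simp) ?_) hlim fun n => ?_
    · filter_upwards [hA] with ω h
      exact (hc.tendsto _).comp (h.pow 2)
    · exact ((SimpleProcess.lintegral_min_le hW (V n) (U n) ht hz hx hδ.le m).1).trans
        (add_le_add le_rfl (hP n))
  · refine le_of_tendsto_of_tendsto' (tendsto_lintegral_of_dominated_convergence'
      (F := fun n ω => min (ENNReal.ofReal (B n ω)) 1) (fun _ => 1)
      (fun n => (hc.measurable.comp (hBm n)).aemeasurable)
      (fun n => ae_of_all _ fun ω => min_le_right _ _) (by simp) ?_) hlim fun n => ?_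
    · filter_upwards [hB] with ω h
      exact (hc.tendsto _).comp h
    · exact ((SimpleProcess.lintegral_min_le hW (V n) (U n) ht hz hx hδ.le m).2).trans
        (add_le_add le_rfl (hP n))

end CoarseLenglart

end

/-! ### Gaussian moments and convergence in probability. -/

section

variable {Ω : Type*} {mΩ : MeasurableSpace Ω} {P : Measure Ω}

/-- The fourth moment of the standard normal distribution. -/
def fourthMoment : ℝ := ∫ x, x ^ 4 ∂(gaussianReal 0 1)

/-- The variance of the square of a standard normal variable. -/
def sqVariance : ℝ := ∫ x, (x ^ 2 - 1) ^ 2 ∂(gaussianReal 0 1)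

lemma fourthMoment_nonneg : 0 ≤ fourthMoment := integral_nonneg fun _ => by positivity

lemma sqVariance_nonneg : 0 ≤ sqVariance := integral_nonneg fun _ => by positivity

/-- Scaling reduces all moments to those of the standard normal law. Their numerical values, `3` and
`2`, play no role later. -/
lemma gaussianReal_eq_map_sqrt (v : ℝ≥0) :
    gaussianReal 0 v = (gaussianReal 0 1).map (fun x => √v * x) := by
  rw [gaussianReal_map_const_mul]
  congr 1
  · simp
  · ext; simp

lemma integral_pow_four_gaussianReal (v : ℝ≥0) :
    ∫ x, x ^ 4 ∂(gaussianReal 0 v) = fourthMoment * (v : ℝ) ^ 2 := by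
  rw [gaussianReal_eq_map_sqrt, integral_map (by fun_prop) (by fun_prop), fourthMoment,
    ← integral_mul_const]
  congr 1
  ext x
  have : √(v : ℝ) ^ 4 = (v : ℝ) ^ 2 := by
    rw [show 4 = 2 * 2 by norm_num, pow_mul, Real.sq_sqrt v.coe_nonneg]
  rw [mul_pow, this]; ring

lemma integral_sq_sub_sq_gaussianReal (v : ℝ≥0) :
    ∫ x, (x ^ 2 - v) ^ 2 ∂(gaussianReal 0 v) = sqVariance * (v : ℝ) ^ 2 := by
  rw [gaussianReal_eq_map_sqrt, integral_map (by fun_prop) (by fun_prop), sqVariance,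
    ← integral_mul_const]
  congr 1
  ext x
  rw [mul_pow, Real.sq_sqrt v.coe_nonneg]; ring

lemma memLp_of_hasLaw_gaussian {g : Ω → ℝ} {v : ℝ≥0} (hl : HasLaw g (gaussianReal 0 v) P)
    {p : ℝ≥0∞} (hp : p ≠ ∞) : MemLp g p P := by
  have h1 : MemLp id p (P.map g) := by
    rw [hl.map_eq]; exact memLp_id_gaussianReal' p hp
  exact (memLp_map_measure_iff (by fun_prop) hl.aemeasurable).1 h1

lemma memLp_sq_sub {g : Ω → ℝ} {v : ℝ≥0} [IsProbabilityMeasure P]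
    (hl : HasLaw g (gaussianReal 0 v) P) (x : ℝ) : MemLp (fun ω => g ω ^ 2 - x) 2 P := by
  have h4 := memLp_of_hasLaw_gaussian hl (p := 4) (by norm_num)
  have h2 : MemLp (fun ω => g ω ^ 2) 2 P := by
    have := h4.norm_rpow_div 2
    norm_num at this
    have e : (4 : ℝ≥0∞) / 2 = 2 := by
      rw [show (4 : ℝ≥0∞) = 2 * 2 by norm_num, mul_div_assoc,
        ENNReal.div_self (by norm_num) (by norm_num), mul_one]
    rw [e] at this
    exact_mod_cast this
  exact h2.sub (memLp_const x)

lemma integrable_pow_four {g : Ω → ℝ} {v : ℝ≥0}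
    (hl : HasLaw g (gaussianReal 0 v) P) : Integrable (fun ω => g ω ^ 4) P := by
  have h4 := (memLp_of_hasLaw_gaussian hl (p := 4) (by norm_num)).integrable_norm_pow (p := 4)
    (by norm_num)
  refine h4.congr (ae_of_all _ fun ω => ?_)
  simp only [Real.norm_eq_abs]
  exact Even.pow_abs (by decide) _

lemma integral_pow_four {g : Ω → ℝ} {v : ℝ≥0} (hl : HasLaw g (gaussianReal 0 v) P) :
    ∫ ω, g ω ^ 4 ∂P = fourthMoment * (v : ℝ) ^ 2 := by
  rw [← integral_pow_four_gaussianReal]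
  exact hl.integral_comp (f := fun x => x ^ 4) (by fun_prop)

/-- The compensated squares of Gaussian innovations are innovations. -/
lemma isNoise_sq_of_gaussian [IsProbabilityMeasure P] {𝒢 : Filtration ℕ mΩ} {g : ℕ → Ω → ℝ}
    {v : ℕ → ℝ≥0} (hm : ∀ k, Measurable[𝒢 (k + 1)] (g k))
    (hi : ∀ k, Indep (MeasurableSpace.comap (g k) inferInstance) (𝒢 k) P)
    (hl : ∀ k, HasLaw (g k) (gaussianReal 0 (v k)) P) :
    IsNoise 𝒢 P (fun k ω => g k ω ^ 2 - v k) (fun k => sqVariance * (v k : ℝ) ^ 2) where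
  meas k := ((hm k).pow_const 2).sub_const _
  indep k := by
    refine indep_of_indep_of_le_left (hi k) ?_
    have h1 : Measurable[MeasurableSpace.comap (g k) inferInstance] (g k) :=
      comap_measurable (g k)
    have h2 : Measurable (fun y : ℝ => y ^ 2 - v k) := by fun_prop
    exact (h2.comp h1).comap_le
  memLp k := memLp_sq_sub (hl k) _
  mean k := by
    have h1 := (isNoise_of_gaussian hm hi hl).var k
    have h2 := (isNoise_of_gaussian hm hi hl).memLp k
    rw [integral_sub h2.integrable_sq (integrable_const _), h1]
    simp
  var k := by
    rw [← integral_sq_sub_sq_gaussianReal]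
    exact (hl k).integral_comp (f := fun x => (x ^ 2 - (v k : ℝ)) ^ 2) (by fun_prop)

/-- For fixed `δ` the second term vanishes by dominated convergence, since the brackets tend to zero
almost everywhere; then `δ` is arbitrary. -/
lemma tendsto_lintegral_zero_of_lenglart {f D : ℕ → Ω → ℝ≥0∞} [IsProbabilityMeasure P]
    (hD : ∀ n, AEMeasurable (D n) P) (hD0 : ∀ᵐ ω ∂P, Tendsto (fun n => D n ω) atTop (𝓝 0))
    (h : ∀ δ : ℝ, 0 < δ → ∀ n, ∫⁻ ω, f n ω ∂P
      ≤ ENNReal.ofReal δ + ∫⁻ ω, min (3 * D n ω / ENNReal.ofReal δ) 1 ∂P) :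
    Tendsto (fun n => ∫⁻ ω, f n ω ∂P) atTop (𝓝 0) := by
  rw [ENNReal.tendsto_nhds_zero]
  intro ε hε
  obtain ⟨δ, hδ0, hδ⟩ : ∃ δ : ℝ, 0 < δ ∧ ENNReal.ofReal δ ≤ ε / 2 := by
    rcases eq_or_ne ε ∞ with rfl | h'
    · exact ⟨1, one_pos, by simp [ENNReal.top_div]⟩
    · refine ⟨(ε / 2).toReal, ENNReal.toReal_pos (by simpa using hε.ne') ?_, ?_⟩
      · exact (ENNReal.div_lt_top h' (by norm_num)).ne
      · rw [ENNReal.ofReal_toReal]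
        exact (ENNReal.div_lt_top h' (by norm_num)).ne
  have hδ' : ENNReal.ofReal δ ≠ 0 := by simpa using hδ0
  have h1 : Tendsto (fun n => ∫⁻ ω, min (3 * D n ω / ENNReal.ofReal δ) 1 ∂P) atTop
      (𝓝 (∫⁻ _, 0 ∂P)) := by
    refine tendsto_lintegral_of_dominated_convergence' (fun _ => 1)
      (fun n => (((hD n).const_mul 3).div_const _).min aemeasurable_const)
      (fun n => ae_of_all _ fun ω => min_le_right _ _) (by simp) ?_
    filter_upwards [hD0] with ω hω
    have h2 := ENNReal.Tendsto.div_const (ENNReal.Tendsto.const_mul (a := 3) hω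
      (Or.inr (by norm_num))) (Or.inr hδ')
    have h3 := h2.min (tendsto_const_nhds (x := (1 : ℝ≥0∞)))
    simpa using h3
  rw [lintegral_zero] at h1
  have hε2 : 0 < ε / 2 := ENNReal.half_pos hε.ne'
  filter_upwards [h1.eventually_le_const hε2] with n hn
  calc _ ≤ _ := h δ hδ0 n
    _ ≤ ε / 2 + ε / 2 := add_le_add hδ hn
    _ = ε := ENNReal.add_halves ε

lemma exists_subseq_ae_tendsto_zero {f : ℕ → Ω → ℝ≥0∞} (hf : ∀ n, AEMeasurable (f n) P)
    (h : Tendsto (fun n => ∫⁻ ω, f n ω ∂P) atTop (𝓝 0)) :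
    ∃ φ : ℕ → ℕ, StrictMono φ ∧ ∀ᵐ ω ∂P, Tendsto (fun n => f (φ n) ω) atTop (𝓝 0) := by
  have hpos : ∀ n : ℕ, (0 : ℝ≥0∞) < (2⁻¹ : ℝ≥0∞) ^ n := fun n =>
    pos_iff_ne_zero.2 (pow_ne_zero n (by simp))
  obtain ⟨φ, hφ, hle⟩ := extraction_forall_of_eventually
    (P := fun n k => ∫⁻ ω, f k ω ∂P ≤ (2⁻¹ : ℝ≥0∞) ^ n)
    fun n => (h.eventually_le_const (hpos n))
  refine ⟨φ, hφ, ae_tendsto_zero_of_tsum_lintegral (fun n => hf _)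
    (ne_top_of_le_ne_top ?_ (ENNReal.tsum_le_tsum hle))⟩
  rw [ENNReal.tsum_geometric]
  exact ENNReal.inv_ne_top.2 (tsub_pos_of_lt (ENNReal.inv_lt_one.2 (by norm_num))).ne'

lemma tendsto_zero_of_min_ofReal {x : ℕ → ℝ} (hx : ∀ n, 0 ≤ x n)
    (h : Tendsto (fun n => min (ENNReal.ofReal (x n)) 1) atTop (𝓝 0)) :
    Tendsto x atTop (𝓝 0) := by
  have h1 : Tendsto (fun n => ENNReal.ofReal (x n)) atTop (𝓝 0) := by
    refine h.congr' ?_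
    filter_upwards [h.eventually_lt_const one_pos] with n hn
    rcases min_lt_iff.1 hn with h' | h'
    · exact min_eq_left h'.le
    · exact absurd h' (lt_irrefl _)
  have h2 := (ENNReal.tendsto_toReal ENNReal.zero_ne_top).comp h1
  simpa [Function.comp_def, ENNReal.toReal_ofReal (hx _)] using h2

end

/-! ### Second order expansions and the discrete product formula. -/

section

lemma abs_exp_sub_two_le {x : ℝ} (hx : |x| ≤ 1) :
    |Real.exp x - (1 + x + x ^ 2 / 2)| ≤ |x| ^ 3 / 4 := by
  -- The constant supplied here is `4 / (3! * 3) = 2/9`, below `1/4`.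
  have h := Real.exp_bound hx (n := 3) (by norm_num)
  norm_num [Finset.sum_range_succ, Nat.factorial] at h
  refine h.trans ?_
  have : 0 ≤ |x| ^ 3 := by positivity
  linarith

/-- Second order expansion of `(1 + y) exp (-y + q)`. -/
lemma abs_one_add_mul_exp_sub_le {y q : ℝ} (hy : |y| ≤ 1) (hq0 : 0 ≤ q) (hq : q ≤ 1) :
    |(1 + y) * Real.exp (-y + q) - 1 - q + y ^ 2 / 2| ≤ 4 * |y| ^ 3 + q ^ 2 + q * y ^ 2 := by
  have h1 := abs_exp_sub_two_le (x := -y) (by rwa [abs_neg])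
  rw [abs_neg] at h1
  have h2 := Real.abs_exp_sub_one_sub_id_le (x := q) (by rwa [abs_of_nonneg hq0])
  obtain ⟨u, hu⟩ : ∃ u, u = Real.exp (-y) - (1 + -y + (-y) ^ 2 / 2) := ⟨_, rfl⟩
  obtain ⟨p, hp⟩ : ∃ p, p = Real.exp q - 1 - q := ⟨_, rfl⟩
  rw [← hu] at h1
  rw [← hp] at h2
  have e1 : Real.exp (-y) = u + (1 - y + y ^ 2 / 2) := by rw [hu]; ring
  have e2 : Real.exp q = p + 1 + q := by rw [hp]; ring
  rw [Real.exp_add, e1, e2]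
  obtain ⟨ρ, hρ⟩ : ∃ ρ, ρ = (1 + y) * u + y ^ 3 / 2 := ⟨_, rfl⟩
  have e3 : (1 + y) * ((u + (1 - y + y ^ 2 / 2)) * (p + 1 + q)) - 1 - q + y ^ 2 / 2
      = ρ * (p + 1 + q) + (p * (1 - y ^ 2 / 2) - q * y ^ 2 / 2) := by rw [hρ]; ring
  have hy3 : |y ^ 3| = |y| ^ 3 := abs_pow _ _
  have h3 : |ρ| ≤ |y| ^ 3 := by
    rw [hρ]
    calc |(1 + y) * u + y ^ 3 / 2| ≤ |(1 + y) * u| + |y ^ 3 / 2| := abs_add_le _ _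
      _ = |1 + y| * |u| + |y| ^ 3 / 2 := by rw [abs_mul, abs_div, hy3]; norm_num
      _ ≤ 2 * (|y| ^ 3 / 4) + |y| ^ 3 / 2 := by
          gcongr
          calc |1 + y| ≤ |1| + |y| := abs_add_le _ _
            _ ≤ 2 := by rw [abs_one]; linarith
      _ = |y| ^ 3 := by ring
  have hp1 : |p| ≤ 1 := h2.trans (by nlinarith)
  have h4 : |p + 1 + q| ≤ 3 := by
    have := abs_le.1 hp1
    rw [abs_le]; constructor <;> linarith
  have hy2 : y ^ 2 ≤ 1 := by rw [← sq_abs]; exact pow_le_one₀ (abs_nonneg _) hy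
  have h5 : |p * (1 - y ^ 2 / 2)| ≤ q ^ 2 := by
    rw [abs_mul]
    have : |1 - y ^ 2 / 2| ≤ 1 := by
      rw [abs_le]; constructor <;> nlinarith [sq_nonneg y]
    calc _ ≤ q ^ 2 * 1 := by gcongr
      _ = _ := mul_one _
  have h6 : |q * y ^ 2 / 2| ≤ q * y ^ 2 := by
    rw [abs_of_nonneg (by positivity)]
    have : 0 ≤ q * y ^ 2 := by positivity
    linarith
  rw [e3]
  calc _ ≤ |ρ * (p + 1 + q)| + |p * (1 - y ^ 2 / 2) - q * y ^ 2 / 2| := abs_add_le _ _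
    _ ≤ |ρ * (p + 1 + q)| + (|p * (1 - y ^ 2 / 2)| + |q * y ^ 2 / 2|) := by
        gcongr; exact abs_sub _ _
    _ ≤ |y| ^ 3 * 3 + (q ^ 2 + q * y ^ 2) := by
        rw [abs_mul]
        gcongr
    _ ≤ _ := by nlinarith [pow_nonneg (abs_nonneg y) 3]

section OneStep

variable {A Δ η w g b q : ℝ}

lemma abs_add_mul_le (hA : 1 ≤ A) (hb : |b| ≤ A * Δ) (hw : |w| ≤ A) (hg : |g| ≤ η) :
    |b + w * g| ≤ A * (Δ + η) := by
  calc |b + w * g| ≤ |b| + |w| * |g| := by rw [← abs_mul]; exact abs_add_le _ _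
    _ ≤ A * Δ + A * η := by gcongr
    _ = _ := by ring

lemma sq_add_mul_le (hA : 1 ≤ A) (hΔ0 : 0 ≤ Δ) (hΔ1 : Δ ≤ 1) (hb : |b| ≤ A * Δ)
    (hw : |w| ≤ A) : (b + w * g) ^ 2 ≤ 2 * A ^ 2 * (Δ + g ^ 2) := by
  have h1 : b ^ 2 ≤ (A * Δ) ^ 2 := by rw [← sq_abs]; gcongr
  have h2 : w ^ 2 ≤ A ^ 2 := by rw [← sq_abs]; gcongr
  have h3 : Δ ^ 2 ≤ Δ := by nlinarith
  have h4 : (w * g) ^ 2 ≤ A ^ 2 * g ^ 2 := by rw [mul_pow]; gcongr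
  have h5 : (A * Δ) ^ 2 ≤ A ^ 2 * Δ := by rw [mul_pow]; gcongr
  nlinarith [sq_nonneg (b - w * g)]

/-- Here `y = b + w g` is the relative increment of the solution and `q` stands for the Itô
correction `w² v / 2`. After multiplication by the inverse exponential only `q - w² g² / 2`
survives, a multiple of the compensated square `g² - v`. Replacing `y²` by `w² g²` costs terms
containing `b`, which are of higher order because `b` is of order `Δ`. -/
lemma abs_remainder_le (hA : 1 ≤ A) (hΔ0 : 0 ≤ Δ) (hη0 : 0 ≤ η)
    (hsmall : 2 * A * (Δ + η) ≤ 1) (hb : |b| ≤ A * Δ) (hq0 : 0 ≤ q) (hq : q ≤ A * Δ)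
    (hw : |w| ≤ A) (hg : |g| ≤ η) :
    |(1 + (b + w * g)) * Real.exp (-(b + w * g) + q) - 1 - q + w ^ 2 * g ^ 2 / 2|
      ≤ 16 * A ^ 3 * (η + Δ) * (Δ + g ^ 2) := by
  have hA0 : 0 < A := by linarith
  have hΔη : Δ + η ≤ 1 := by nlinarith
  have hΔ1 : Δ ≤ 1 := by linarith
  have hy := abs_add_mul_le hA hb hw hg
  have hy2 := sq_add_mul_le (g := g) hA hΔ0 hΔ1 hb hw
  have hy1 : |b + w * g| ≤ 1 := by nlinarith
  have hq1 : q ≤ 1 := by nlinarith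
  have h := abs_one_add_mul_exp_sub_le hy1 hq0 hq1
  set y := b + w * g with hydef
  have hS : 0 ≤ Δ + g ^ 2 := by positivity
  have hB : 0 ≤ (η + Δ) * (Δ + g ^ 2) := by positivity
  have hA2 : A ^ 2 ≤ A ^ 3 := pow_le_pow_right₀ hA (by norm_num)
  have t1 : |y| ^ 3 ≤ 2 * A ^ 3 * ((η + Δ) * (Δ + g ^ 2)) := by
    calc |y| ^ 3 = |y| * y ^ 2 := by rw [← sq_abs y]; ring
      _ ≤ (A * (Δ + η)) * (2 * A ^ 2 * (Δ + g ^ 2)) := by gcongr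
      _ = _ := by ring
  have hΔB : Δ * (Δ + g ^ 2) ≤ (η + Δ) * (Δ + g ^ 2) := by gcongr; linarith
  have hΔ2 : Δ * Δ ≤ (η + Δ) * (Δ + g ^ 2) := by
    gcongr
    · linarith
    · nlinarith [sq_nonneg g]
  have hηΔ : Δ * η ≤ (η + Δ) * (Δ + g ^ 2) := by
    rw [mul_comm]; gcongr
    · linarith
    · nlinarith [sq_nonneg g]
  have t2 : q ^ 2 ≤ A ^ 3 * ((η + Δ) * (Δ + g ^ 2)) := by
    calc q ^ 2 ≤ (A * Δ) ^ 2 := by gcongr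
      _ = A ^ 2 * (Δ * Δ) := by ring
      _ ≤ _ := by gcongr
  have t3 : q * y ^ 2 ≤ 2 * A ^ 3 * ((η + Δ) * (Δ + g ^ 2)) := by
    calc q * y ^ 2 ≤ (A * Δ) * (2 * A ^ 2 * (Δ + g ^ 2)) := by gcongr
      _ = 2 * A ^ 3 * (Δ * (Δ + g ^ 2)) := by ring
      _ ≤ _ := by gcongr
  have t4 : |b * (w * g)| ≤ A ^ 3 * ((η + Δ) * (Δ + g ^ 2)) := by
    rw [abs_mul, abs_mul]
    calc _ ≤ (A * Δ) * (A * η) := by gcongr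
      _ = A ^ 2 * (Δ * η) := by ring
      _ ≤ _ := by gcongr
  have t5 : b ^ 2 ≤ A ^ 3 * ((η + Δ) * (Δ + g ^ 2)) := by
    rw [← sq_abs]
    calc _ ≤ (A * Δ) ^ 2 := by gcongr
      _ = A ^ 2 * (Δ * Δ) := by ring
      _ ≤ _ := by gcongr
  have e : (1 + y) * Real.exp (-y + q) - 1 - q + w ^ 2 * g ^ 2 / 2
      = ((1 + y) * Real.exp (-y + q) - 1 - q + y ^ 2 / 2) - (b * (w * g) + b ^ 2 / 2) := by
    rw [hydef]; ring
  have h5 : |b * (w * g) + b ^ 2 / 2| ≤ 2 * (A ^ 3 * ((η + Δ) * (Δ + g ^ 2))) := by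
    calc _ ≤ |b * (w * g)| + |b ^ 2 / 2| := abs_add_le _ _
      _ ≤ _ := by
        rw [abs_of_nonneg (by positivity : 0 ≤ b ^ 2 / 2)]
        nlinarith [sq_nonneg b]
  rw [e]
  calc _ ≤ _ := abs_sub _ _
    _ ≤ (4 * |y| ^ 3 + q ^ 2 + q * y ^ 2) + 2 * (A ^ 3 * ((η + Δ) * (Δ + g ^ 2))) := by gcongr
    _ ≤ _ := by
        have : 0 ≤ A ^ 3 * ((η + Δ) * (Δ + g ^ 2)) := by positivity
        nlinarith

/-- The one-step change of the inverse exponential is of order `√Δ`. Its squares therefore have a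
bounded sum, as the Cauchy–Schwarz step of the product formula requires. -/
lemma sq_exp_sub_one_le (hA : 1 ≤ A) (hΔ0 : 0 ≤ Δ) (hη0 : 0 ≤ η)
    (hsmall : 2 * A * (Δ + η) ≤ 1) (hb : |b| ≤ A * Δ) (hq0 : 0 ≤ q) (hq : q ≤ A * Δ)
    (hw : |w| ≤ A) (hg : |g| ≤ η) :
    (Real.exp (-(b + w * g) + q) - 1) ^ 2 ≤ 24 * A ^ 2 * (Δ + g ^ 2) := by
  have hA0 : 0 < A := by linarith
  have hΔη : Δ + η ≤ 1 := by nlinarith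
  have hΔ1 : Δ ≤ 1 := by linarith
  have hy := abs_add_mul_le hA hb hw hg
  have hy2 := sq_add_mul_le (g := g) hA hΔ0 hΔ1 hb hw
  have h1 : |(-(b + w * g) + q)| ≤ 1 := by
    calc _ ≤ |(-(b + w * g))| + |q| := abs_add_le _ _
      _ ≤ A * (Δ + η) + A * Δ := by rw [abs_neg, abs_of_nonneg hq0]; gcongr
      _ ≤ 1 := by nlinarith
  have h2 := Real.abs_exp_sub_one_le h1
  have h3 : q ^ 2 ≤ A ^ 2 * Δ := by
    calc q ^ 2 ≤ (A * Δ) ^ 2 := by gcongr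
      _ = A ^ 2 * (Δ * Δ) := by ring
      _ ≤ A ^ 2 * (Δ * 1) := by gcongr
      _ = _ := by ring
  have hg2 : 0 ≤ A ^ 2 * g ^ 2 := by positivity
  have hD2 : 0 ≤ A ^ 2 * Δ := by positivity
  calc _ = |Real.exp (-(b + w * g) + q) - 1| ^ 2 := (sq_abs _).symm
    _ ≤ (2 * |(-(b + w * g) + q)|) ^ 2 := by gcongr
    _ = 4 * (-(b + w * g) + q) ^ 2 := by rw [mul_pow, sq_abs]; norm_num
    _ ≤ 4 * (2 * (b + w * g) ^ 2 + 2 * q ^ 2) := by nlinarith [sq_nonneg (b + w * g + q)]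
    _ ≤ _ := by nlinarith

end OneStep

/-- Discrete product formula: stability of `E k * X k` when `X` follows a perturbed linear
recursion and `E` is the inverse of the associated exponential. -/
lemma abs_prod_sub_le {M : ℕ} {A Δ η o w : ℝ} {X E g b v a ε : ℕ → ℝ} (hA : 1 ≤ A)
    (hΔ0 : 0 ≤ Δ) (hη0 : 0 ≤ η) (hsmall : 2 * A * (Δ + η) ≤ 1) (hw : |w| ≤ A)
    (hX : ∀ k, |X k| ≤ A) (hE : ∀ k, |E k| ≤ A)
    (hg : ∀ k < M, |g k| ≤ η) (hb : ∀ k < M, |b k| ≤ A * Δ)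
    (hv0 : ∀ k, 0 ≤ v k) (hv : ∀ k < M, w ^ 2 * v k / 2 ≤ A * Δ) (ha : ∀ k < M, |a k| ≤ o * Δ)
    (hXs : ∀ k < M, X (k + 1) = X k * (1 + (b k + w * g k)) + a k + ε k)
    (hEs : ∀ k < M, E (k + 1) = E k * Real.exp (-(b k + w * g k) + w ^ 2 * v k / 2)) :
    |E M * X M - E 0 * X 0| ≤
      16 * A ^ 5 * (η + Δ) * (M * Δ + ∑ k ∈ Finset.range M, g k ^ 2)
      + w ^ 2 / 2 * |∑ k ∈ Finset.range M, E k * X k * (g k ^ 2 - v k)|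
      + A * (o * (M * Δ)) + |∑ k ∈ Finset.range M, E k * ε k|
      + A * (√(24 * A ^ 2 * (M * Δ + ∑ k ∈ Finset.range M, g k ^ 2))
        * √(∑ k ∈ Finset.range M, ε k ^ 2)) := by
  have hA0 : 0 < A := by linarith
  set U : ℕ → ℝ := fun k => Real.exp (-(b k + w * g k) + w ^ 2 * v k / 2) with hU
  set R : ℕ → ℝ := fun k => (1 + (b k + w * g k)) * U k - 1 - w ^ 2 * v k / 2
    + w ^ 2 * g k ^ 2 / 2 with hR
  -- Each error `ε k` meets `E (k + 1)`. Splitting this factor as `E k + E k (U k - 1)` separates a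
  -- weight known at the start of the block, open to martingale estimates, from a small one that is
  -- not.
  have htel : E M * X M - E 0 * X 0 = ∑ k ∈ Finset.range M, E k * X k * R k
      + (-(w ^ 2 / 2) * ∑ k ∈ Finset.range M, E k * X k * (g k ^ 2 - v k))
      + ∑ k ∈ Finset.range M, E (k + 1) * a k + ∑ k ∈ Finset.range M, E k * ε k
      + ∑ k ∈ Finset.range M, (E k * (U k - 1)) * ε k := by
    rw [← Finset.sum_range_sub (fun k => E k * X k) M, Finset.mul_sum]
    simp only [← Finset.sum_add_distrib]
    refine Finset.sum_congr rfl fun k hk => ?_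
    have hk := Finset.mem_range.1 hk
    rw [hXs k hk, hEs k hk]
    simp only [hR, hU]
    ring
  have hsumΔ : ∑ k ∈ Finset.range M, (Δ + g k ^ 2)
      = M * Δ + ∑ k ∈ Finset.range M, g k ^ 2 := by
    rw [Finset.sum_add_distrib]; simp
  have b1 : |∑ k ∈ Finset.range M, E k * X k * R k|
      ≤ 16 * A ^ 5 * (η + Δ) * (M * Δ + ∑ k ∈ Finset.range M, g k ^ 2) := by
    rw [← hsumΔ, Finset.mul_sum]
    refine (Finset.abs_sum_le_sum_abs _ _).trans (Finset.sum_le_sum fun k hk => ?_)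
    have hk := Finset.mem_range.1 hk
    have := abs_remainder_le hA hΔ0 hη0 hsmall (hb k hk)
      (by have := hv0 k; positivity : 0 ≤ w ^ 2 * v k / 2) (hv k hk) hw (hg k hk)
    rw [abs_mul, abs_mul]
    calc _ ≤ A * A * (16 * A ^ 3 * (η + Δ) * (Δ + g k ^ 2)) := by
          gcongr
          · exact hE k
          · exact hX k
      _ = _ := by ring
  have b3 : |∑ k ∈ Finset.range M, E (k + 1) * a k| ≤ A * (o * (M * Δ)) := by
    refine (Finset.abs_sum_le_sum_abs _ _).trans ?_
    calc _ ≤ ∑ k ∈ Finset.range M, A * (o * Δ) := by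
          refine Finset.sum_le_sum fun k hk => ?_
          rw [abs_mul]
          exact mul_le_mul (hE _) (ha k (Finset.mem_range.1 hk)) (abs_nonneg _) hA0.le
      _ = _ := by rw [Finset.sum_const, Finset.card_range, nsmul_eq_mul]; ring
  -- The weight depends on the increment of its own block, so Cauchy–Schwarz is used in place of
  -- orthogonality.
  have b5 : |∑ k ∈ Finset.range M, (E k * (U k - 1)) * ε k|
      ≤ A * (√(24 * A ^ 2 * (M * Δ + ∑ k ∈ Finset.range M, g k ^ 2))
        * √(∑ k ∈ Finset.range M, ε k ^ 2)) := by
    have hcs := Finset.sum_mul_sq_le_sq_mul_sq (Finset.range M) (fun k => E k * (U k - 1)) ε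
    have h1 : ∑ k ∈ Finset.range M, (E k * (U k - 1)) ^ 2
        ≤ A ^ 2 * (24 * A ^ 2 * (M * Δ + ∑ k ∈ Finset.range M, g k ^ 2)) := by
      rw [← hsumΔ, Finset.mul_sum, Finset.mul_sum]
      refine Finset.sum_le_sum fun k hk => ?_
      have hk := Finset.mem_range.1 hk
      have := sq_exp_sub_one_le hA hΔ0 hη0 hsmall (hb k hk)
        (by have := hv0 k; positivity : 0 ≤ w ^ 2 * v k / 2) (hv k hk) hw (hg k hk)
      rw [mul_pow]
      have hE2 : E k ^ 2 ≤ A ^ 2 := by rw [← sq_abs]; gcongr; exact hE k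
      gcongr
    have h2 : 0 ≤ ∑ k ∈ Finset.range M, ε k ^ 2 := Finset.sum_nonneg fun _ _ => sq_nonneg _
    have h3 : (∑ k ∈ Finset.range M, E k * (U k - 1) * ε k) ^ 2
        ≤ (A ^ 2 * (24 * A ^ 2 * (M * Δ + ∑ k ∈ Finset.range M, g k ^ 2)))
          * ∑ k ∈ Finset.range M, ε k ^ 2 := hcs.trans (by gcongr)
    refine (Real.abs_le_sqrt h3).trans (le_of_eq ?_)
    rw [Real.sqrt_mul' _ h2, Real.sqrt_mul (sq_nonneg A), Real.sqrt_sq hA0.le, mul_assoc]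
  rw [htel]
  have b2 : |(-(w ^ 2 / 2) * ∑ k ∈ Finset.range M, E k * X k * (g k ^ 2 - v k))|
      = w ^ 2 / 2 * |∑ k ∈ Finset.range M, E k * X k * (g k ^ 2 - v k)| := by
    rw [abs_mul, abs_neg, abs_of_nonneg (by positivity)]
  refine (abs_add_le _ _).trans (add_le_add ((abs_add_le _ _).trans (add_le_add
    ((abs_add_le _ _).trans (add_le_add ((abs_add_le _ _).trans
      (add_le_add b1 b2.le)) b3)) le_rfl)) b5)

end

/-! ### Bounded coefficients, dyadic times, and paths of the Wiener integral. -/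

section

variable {Ω : Type*} {mΩ : MeasurableSpace Ω} {P : Measure Ω}
  {𝓕 : Filtration ℝ≥0 mΩ} {W : ℝ≥0 → Ω → ℝ}

lemma exists_ae_abs_le {T : ℝ≥0} {f : ℝ → ℝ}
    (hf : MemLp f ∞ (volume.restrict (Set.Icc (0 : ℝ) T))) :
    ∃ C : ℝ, 0 ≤ C ∧ ∀ᵐ t ∂(volume.restrict (Set.Icc (0 : ℝ) T)), |f t| ≤ C := by
  refine ⟨(eLpNorm f ∞ (volume.restrict (Set.Icc (0 : ℝ) T))).toReal, ENNReal.toReal_nonneg, ?_⟩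
  filter_upwards [ae_le_eLpNormEssSup (f := f) (μ := volume.restrict (Set.Icc (0 : ℝ) T))] with t ht
  rw [← eLpNorm_exponent_top] at ht
  have := ENNReal.toReal_mono hf.2.ne ht
  simpa using this

section Bounded

variable {T : ℝ≥0} {f : ℝ → ℝ} {C : ℝ}

lemma Ioc_subset_Icc_of_le {s t : ℝ≥0} (htT : t ≤ T) :
    Set.Ioc (s : ℝ) t ⊆ Set.Icc (0 : ℝ) T :=
  Set.Ioc_subset_Icc_self.trans (Set.Icc_subset_Icc s.2 (by exact_mod_cast htT))

lemma intervalIntegrable_of_memLp (hf : MemLp f ∞ (volume.restrict (Set.Icc (0 : ℝ) T)))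
    {s t : ℝ≥0} (hst : s ≤ t) (htT : t ≤ T) : IntervalIntegrable f volume s t := by
  rw [intervalIntegrable_iff_integrableOn_Ioc_of_le (by exact_mod_cast hst)]
  exact ((hf.mono_exponent (p := 1) le_top).integrable le_rfl).mono_measure
    (Measure.restrict_mono (Ioc_subset_Icc_of_le htT) le_rfl)

lemma abs_intervalIntegral_le (hC : ∀ᵐ t ∂(volume.restrict (Set.Icc (0 : ℝ) T)), |f t| ≤ C)
    {s t : ℝ≥0} (hst : s ≤ t) (htT : t ≤ T) :
    |∫ y in (s : ℝ)..t, f y| ≤ C * (t - s) := by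
  have hst' : (s : ℝ) ≤ t := by exact_mod_cast hst
  have h1 : ∀ᵐ y, y ∈ Set.uIoc (s : ℝ) t → ‖f y‖ ≤ C := by
    rw [Set.uIoc_of_le hst', ← ae_restrict_iff' measurableSet_Ioc]
    exact ae_mono (Measure.restrict_mono (Ioc_subset_Icc_of_le htT) le_rfl) hC
  have := intervalIntegral.norm_integral_le_of_norm_le_const_ae h1
  rwa [abs_of_nonneg (sub_nonneg.2 hst'), Real.norm_eq_abs] at this

lemma memLp_sq (hf : MemLp f ∞ (volume.restrict (Set.Icc (0 : ℝ) T))) :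
    MemLp (fun y => f y ^ 2) ∞ (volume.restrict (Set.Icc (0 : ℝ) T)) := by
  obtain ⟨C, -, h⟩ := exists_ae_abs_le hf
  refine memLp_top_of_bound (hf.1.pow 2) (C ^ 2) ?_
  filter_upwards [h] with t ht
  rw [norm_pow, Real.norm_eq_abs]
  gcongr

lemma ae_sq_le (hC : ∀ᵐ t ∂(volume.restrict (Set.Icc (0 : ℝ) T)), |f t| ≤ C) :
    ∀ᵐ t ∂(volume.restrict (Set.Icc (0 : ℝ) T)), |f t ^ 2| ≤ C ^ 2 := by
  filter_upwards [hC] with t ht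
  rw [abs_pow]
  gcongr

lemma integral_sq_nonneg {s t : ℝ≥0} (hst : s ≤ t) : 0 ≤ ∫ y in (s : ℝ)..t, f y ^ 2 :=
  intervalIntegral.integral_nonneg (by exact_mod_cast hst) fun _ _ => sq_nonneg _

end Bounded

/-- The dyadic points of level `N` of the interval `[a, c]`. -/
def dyTime (a c : ℝ≥0) (N k : ℕ) : ℝ≥0 := a + ((min k (2 ^ N) : ℕ) : ℝ≥0) / 2 ^ N * (c - a)

section dyTime

variable {a c : ℝ≥0} {N k : ℕ}

lemma dyTime_mono (a c : ℝ≥0) (N : ℕ) : Monotone (dyTime a c N) := fun i j hij => by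
  unfold dyTime
  have : ((min i (2 ^ N) : ℕ) : ℝ≥0) ≤ ((min j (2 ^ N) : ℕ) : ℝ≥0) :=
    Nat.cast_le.2 (min_le_min_right _ hij)
  gcongr

@[simp] lemma dyTime_zero (a c : ℝ≥0) (N : ℕ) : dyTime a c N 0 = a := by simp [dyTime]

lemma dyTime_last (hac : a ≤ c) (N : ℕ) : dyTime a c N (2 ^ N) = c := by
  simp [dyTime, add_tsub_cancel_of_le hac]

lemma le_dyTime (a c : ℝ≥0) (N k : ℕ) : a ≤ dyTime a c N k :=
  (dyTime_zero a c N).symm.le.trans (dyTime_mono a c N (Nat.zero_le k))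

lemma dyTime_le (hac : a ≤ c) (N k : ℕ) : dyTime a c N k ≤ c := by
  rcases le_total k (2 ^ N) with h | h
  · exact (dyTime_mono a c N h).trans_eq (dyTime_last hac N)
  · simp [dyTime, min_eq_right h, add_tsub_cancel_of_le hac]

/-- The dyadic levels are nested, so exceptional events for maxima over them increase with the
level. -/
lemma dyTime_succ_level (a c : ℝ≥0) (N k : ℕ) : dyTime a c (N + 1) (2 * k) = dyTime a c N k := by
  have : min (2 * k) (2 ^ (N + 1)) = 2 * min k (2 ^ N) := by omega
  unfold dyTime
  rw [this]
  push_cast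
  rw [pow_succ, mul_comm ((2 : ℝ≥0) ^ N) 2, mul_div_mul_left _ _ two_ne_zero]

lemma dyTime_sub (hac : a ≤ c) (hk : k < 2 ^ N) :
    (dyTime a c N (k + 1) : ℝ) - dyTime a c N k = (c - a) / 2 ^ N := by
  have h1 : min k (2 ^ N) = k := min_eq_left hk.le
  have h2 : min (k + 1) (2 ^ N) = k + 1 := min_eq_left hk
  unfold dyTime
  rw [h1, h2]
  push_cast [NNReal.coe_sub hac]
  ring

end dyTime

section Paths

variable {T : ℝ≥0} {σ : ℝ → ℝ} {U : ℕ → SimpleProcess 𝓕} {J : ℝ≥0 → Ω → ℝ} {a c : ℝ≥0}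

/-- Increments of the Wiener integral along a sequence of times. -/
lemma IsWienerIntegral.noise (hJ : IsWienerIntegral 𝓕 W P T σ U J) {t : ℕ → ℝ≥0}
    (ht : Monotone t) (htT : ∀ k, t k ≤ T) :
    (∀ k, Measurable[alongTimes 𝓕 ht (k + 1)] fun ω => J (t (k + 1)) ω - J (t k) ω) ∧
    (∀ k, Indep (MeasurableSpace.comap (fun ω => J (t (k + 1)) ω - J (t k) ω) inferInstance)
      (alongTimes 𝓕 ht k) P) ∧
    (∀ k, HasLaw (fun ω => J (t (k + 1)) ω - J (t k) ω)
      (gaussianReal 0 (∫ y in (t k : ℝ)..t (k + 1), σ y ^ 2).toNNReal) P) :=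
  ⟨fun k => (hJ.adapted _).sub ((hJ.adapted _).mono (𝓕.mono (ht (Nat.le_succ k))) le_rfl),
    fun k => hJ.indep _ _ (ht (Nat.le_succ k)) (htT _),
    fun k => hJ.hasLaw _ _ (ht (Nat.le_succ k)) (htT _)⟩

/-- Kolmogorov's inequality bounds the probability that level `N` exceeds `R + 1` by `v / (R + 1)²`,
uniformly in `N`. As the events increase with `N`, their union obeys the same bound; let `R` grow.
Path continuity of `J` is never established or used. -/
lemma IsWienerIntegral.ae_bounded_dyTime [IsProbabilityMeasure P]
    (hJ : IsWienerIntegral 𝓕 W P T σ U J)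
    (hσ : MemLp σ ∞ (volume.restrict (Set.Icc (0 : ℝ) T))) (hac : a ≤ c) (hcT : c ≤ T) :
    ∀ᵐ ω ∂P, ∃ C : ℝ, ∀ N k, |J (dyTime a c N k) ω - J a ω| ≤ C := by
  set v : ℝ := ∫ y in (a : ℝ)..c, σ y ^ 2
  let B : ℕ → ℕ → Set Ω := fun R N =>
    {ω | ∃ k ≤ 2 ^ N, ((R : ℝ) + 1) ≤ |J (dyTime a c N k) ω - J a ω|}
  have hB : ∀ R N, P (B R N) ≤ ENNReal.ofReal (v / ((R : ℝ) + 1) ^ 2) := by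
    intro R N
    obtain ⟨h1, h2, h3⟩ := hJ.noise (dyTime_mono a c N) fun k => (dyTime_le hac N k).trans hcT
    have := (isNoise_of_gaussian h1 h2 h3).measure_max_ge_le
      (by positivity : (0 : ℝ) < (R : ℝ) + 1) (2 ^ N)
    have e1 : ∀ k ω, ∑ j ∈ Finset.range k, (J (dyTime a c N (j + 1)) ω - J (dyTime a c N j) ω)
        = J (dyTime a c N k) ω - J a ω := fun k ω => by
      rw [Finset.sum_range_sub (fun j => J (dyTime a c N j) ω), dyTime_zero]
    have e2 : ∑ j ∈ Finset.range (2 ^ N),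
        ((∫ y in (dyTime a c N j : ℝ)..dyTime a c N (j + 1), σ y ^ 2).toNNReal : ℝ) = v := by
      have : ∀ j, ((∫ y in (dyTime a c N j : ℝ)..dyTime a c N (j + 1), σ y ^ 2).toNNReal : ℝ)
          = ∫ y in (dyTime a c N j : ℝ)..dyTime a c N (j + 1), σ y ^ 2 := fun j =>
        Real.coe_toNNReal _ (integral_sq_nonneg (dyTime_mono a c N (Nat.le_succ j)))
      simp_rw [this]
      have h := intervalIntegral.sum_integral_adjacent_intervals (μ := volume)
        (f := fun y => σ y ^ 2) (a := fun j => (dyTime a c N j : ℝ)) (n := 2 ^ N) (fun k _ =>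
          intervalIntegrable_of_memLp (memLp_sq hσ) (dyTime_mono a c N (Nat.le_succ k))
            ((dyTime_le hac N _).trans hcT))
      rw [h, dyTime_zero, dyTime_last hac]
    simp_rw [e1] at this
    rwa [e2] at this
  have hmono : ∀ R, Monotone (B R) := fun R => monotone_nat_of_le_succ fun N => by
    rintro ω ⟨k, hk, h⟩
    refine ⟨2 * k, by rw [pow_succ]; omega, ?_⟩
    rwa [dyTime_succ_level]
  have hU : ∀ R, P (⋃ N, B R N) ≤ ENNReal.ofReal (v / ((R : ℝ) + 1) ^ 2) := fun R => by
    rw [(hmono R).measure_iUnion]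
    exact iSup_le (hB R)
  have h0 : P (⋂ R, ⋃ N, B R N) = 0 := by
    have hlim : Tendsto (fun R : ℕ => ENNReal.ofReal (v / ((R : ℝ) + 1) ^ 2)) atTop (𝓝 0) := by
      rw [← ENNReal.ofReal_zero]
      refine ENNReal.tendsto_ofReal (Tendsto.div_atTop tendsto_const_nhds ?_)
      exact (tendsto_pow_atTop two_ne_zero).comp
        (tendsto_atTop_add_const_right _ _ tendsto_natCast_atTop_atTop)
    exact le_antisymm (ge_of_tendsto' hlim fun R =>
      (measure_mono (Set.iInter_subset _ R)).trans (hU R)) zero_le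
  filter_upwards [measure_eq_zero_iff_ae_notMem.1 h0] with ω hω
  simp only [Set.mem_iInter, not_forall, Set.mem_iUnion, not_exists] at hω
  obtain ⟨R, hR⟩ := hω
  refine ⟨(R : ℝ) + 1, fun N k => ?_⟩
  by_contra hlt
  refine hR N ⟨min k (2 ^ N), min_le_right _ _, ?_⟩
  have : dyTime a c N (min k (2 ^ N)) = dyTime a c N k := by simp [dyTime]
  rw [this]
  exact (not_le.1 hlt).le

/-- Quadratic and quartic variation of the Wiener integral along dyadic partitions. -/
lemma IsWienerIntegral.ae_tendsto_variation [IsProbabilityMeasure P]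
    (hJ : IsWienerIntegral 𝓕 W P T σ U J)
    (hσ : MemLp σ ∞ (volume.restrict (Set.Icc (0 : ℝ) T))) (hac : a ≤ c) (hcT : c ≤ T) :
    ∀ᵐ ω ∂P,
      Tendsto (fun N => ∑ k ∈ Finset.range (2 ^ N),
        ((J (dyTime a c N (k + 1)) ω - J (dyTime a c N k) ω) ^ 2
          - ∫ y in (dyTime a c N k : ℝ)..dyTime a c N (k + 1), σ y ^ 2)) atTop (𝓝 0) ∧
      Tendsto (fun N => ∑ k ∈ Finset.range (2 ^ N),
        (J (dyTime a c N (k + 1)) ω - J (dyTime a c N k) ω) ^ 4) atTop (𝓝 0) := by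
  obtain ⟨C, hC0, hC⟩ := exists_ae_abs_le hσ
  set v : ℕ → ℕ → ℝ := fun N k => ∫ y in (dyTime a c N k : ℝ)..dyTime a c N (k + 1), σ y ^ 2
  have hv0 : ∀ N k, 0 ≤ v N k := fun N k =>
    integral_sq_nonneg (dyTime_mono a c N (Nat.le_succ k))
  have hvc : ∀ N k, ((v N k).toNNReal : ℝ) = v N k := fun N k => Real.coe_toNNReal _ (hv0 N k)
  set ℓ : ℝ := (c : ℝ) - a
  have hℓ : 0 ≤ ℓ := sub_nonneg.2 (by exact_mod_cast hac)
  have hvle : ∀ N, ∀ k ∈ Finset.range (2 ^ N), v N k ≤ C ^ 2 * (ℓ / 2 ^ N) := fun N k hk => by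
    have h1 := abs_intervalIntegral_le (ae_sq_le hC) (dyTime_mono a c N (Nat.le_succ k))
      ((dyTime_le hac N _).trans hcT)
    rw [Nat.succ_eq_add_one, dyTime_sub hac (Finset.mem_range.1 hk)] at h1
    exact (le_abs_self _).trans h1
  -- There are `2 ^ N` terms of size `4 ^ (-N)`. The geometric decay yields almost sure convergence
  -- along all levels, without passing to a subsequence.
  have hsum : ∀ N, ∑ k ∈ Finset.range (2 ^ N), v N k ^ 2 ≤ (C ^ 2 * ℓ) ^ 2 * (1 / 2) ^ N := by
    intro N
    calc _ ≤ ∑ k ∈ Finset.range (2 ^ N), (C ^ 2 * (ℓ / 2 ^ N)) ^ 2 :=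
          Finset.sum_le_sum fun k hk => pow_le_pow_left₀ (hv0 N k) (hvle N k hk) 2
      _ = _ := by
          rw [Finset.sum_const, Finset.card_range, nsmul_eq_mul]
          push_cast
          rw [one_div, inv_pow]
          field_simp
  have hfin : ∀ K : ℝ, ∑' N : ℕ, ENNReal.ofReal (K * (1 / 2) ^ N) ≠ ∞ := fun K =>
    ((summable_geometric_of_lt_one (by norm_num) (by norm_num : (1 / 2 : ℝ) < 1)).mul_left
      K).tsum_ofReal_ne_top
  have hnoise := fun N => hJ.noise (dyTime_mono a c N) fun k => (dyTime_le hac N k).trans hcT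
  have hl : ∀ N k, HasLaw (fun ω => J (dyTime a c N (k + 1)) ω - J (dyTime a c N k) ω)
      (gaussianReal 0 (v N k).toNNReal) P := fun N k => (hnoise N).2.2 k
  have hJm : ∀ t, Measurable (J t) := fun t => (hJ.adapted t).mono (𝓕.le t) le_rfl
  have h1 := ae_tendsto_zero_of_tsum_lintegral (P := P)
    (f := fun N ω => ENNReal.ofReal ((∑ k ∈ Finset.range (2 ^ N),
        ((J (dyTime a c N (k + 1)) ω - J (dyTime a c N k) ω) ^ 2 - v N k)) ^ 2))
    (fun N => (Measurable.pow_const (Finset.measurable_fun_sum _ fun k _ =>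
      (((hJm _).sub (hJm _)).pow_const 2).sub_const _) 2).ennreal_ofReal.aemeasurable)
    (ne_top_of_le_ne_top (hfin (sqVariance * (C ^ 2 * ℓ) ^ 2)) (ENNReal.tsum_le_tsum fun N => by
      have hn := isNoise_sq_of_gaussian (v := fun k => (v N k).toNNReal) (hnoise N).1
        (hnoise N).2.1 (hl N)
      have hs := hn.integral_sum_sq (ξ := fun _ _ => 1) (fun _ => measurable_const)
        (fun _ => memLp_const 1) (2 ^ N)
      have hm := hn.memLp_sum (ξ := fun _ _ => 1) (fun _ => measurable_const)
        (fun _ => memLp_const 1) (2 ^ N)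
      simp only [one_mul, hvc] at hs hm
      rw [← ofReal_integral_eq_lintegral_ofReal hm.integrable_sq
        (ae_of_all _ fun ω => sq_nonneg _), hs]
      refine ENNReal.ofReal_le_ofReal ?_
      have hval : ∀ k, sqVariance * v N k ^ 2 * ∫ _ : Ω, (1 : ℝ) ^ 2 ∂P
          = sqVariance * v N k ^ 2 := fun k => by simp
      simp only [hval]
      rw [← Finset.mul_sum, mul_assoc]
      exact mul_le_mul_of_nonneg_left (hsum N) sqVariance_nonneg))
  have h2 := ae_tendsto_zero_of_tsum_lintegral (P := P)
    (f := fun N ω => ENNReal.ofReal (∑ k ∈ Finset.range (2 ^ N),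
        (J (dyTime a c N (k + 1)) ω - J (dyTime a c N k) ω) ^ 4))
    (fun N => (Finset.measurable_fun_sum _ fun k _ =>
      ((hJm _).sub (hJm _)).pow_const 4).ennreal_ofReal.aemeasurable)
    (ne_top_of_le_ne_top (hfin (fourthMoment * (C ^ 2 * ℓ) ^ 2)) (ENNReal.tsum_le_tsum fun N => by
      rw [← ofReal_integral_eq_lintegral_ofReal
        (integrable_finsetSum _ fun k _ => integrable_pow_four (hl N k))
        (ae_of_all _ fun ω => Finset.sum_nonneg fun k _ => by positivity),
        integral_finsetSum _ fun k _ => integrable_pow_four (hl N k)]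
      refine ENNReal.ofReal_le_ofReal ?_
      simp_rw [integral_pow_four (hl N _), hvc]
      rw [← Finset.mul_sum, mul_assoc]
      exact mul_le_mul_of_nonneg_left (hsum N) fourthMoment_nonneg))
  filter_upwards [h1, h2] with ω h1 h2
  constructor
  · have h3 := (ENNReal.tendsto_toReal ENNReal.zero_ne_top).comp h1
    simp only [Function.comp_def, ENNReal.toReal_ofReal (sq_nonneg _), ENNReal.toReal_zero] at h3
    have h4 := h3.sqrt
    simp only [Real.sqrt_sq_eq_abs, Real.sqrt_zero] at h4
    exact tendsto_zero_iff_abs_tendsto_zero _ |>.2 h4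
  · have h3 := (ENNReal.tendsto_toReal ENNReal.zero_ne_top).comp h2
    have h5 : ∀ N, 0 ≤ ∑ k ∈ Finset.range (2 ^ N),
        (J (dyTime a c N (k + 1)) ω - J (dyTime a c N k) ω) ^ 4 := fun N =>
      Finset.sum_nonneg fun k _ => by positivity
    simpa only [Function.comp_def, ENNReal.toReal_ofReal (h5 _), ENNReal.toReal_zero] using h3

end Paths

end

/-! ### Pathwise solution of the linear equation. -/

section

variable {Ω : Type*} {mΩ : MeasurableSpace Ω} {P : Measure Ω}
  {𝓕 : Filtration ℝ≥0 mΩ} {W : ℝ≥0 → Ω → ℝ}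

section Deterministic

variable {T a c : ℝ≥0}

/-- The modulus `o N` is the supremum of oscillations over pairs at distance at most the mesh;
uniform continuity on the compact interval sends it to zero. -/
lemma exists_modulus_dyTime {f : ℝ≥0 → ℝ} (hac : a ≤ c) (hf : ContinuousOn f (Set.Icc a c)) :
    ∃ o : ℕ → ℝ, Tendsto o atTop (𝓝 0) ∧ ∀ N, ∀ k < 2 ^ N,
      ∀ s ∈ Set.Icc (dyTime a c N k) (dyTime a c N (k + 1)), |f s - f (dyTime a c N k)| ≤ o N := by
  have hK : IsCompact (Set.Icc a c) := isCompact_Icc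
  obtain ⟨C, hC⟩ := hK.exists_bound_of_continuousOn hf
  set ℓ : ℝ := (c : ℝ) - a
  let A : ℕ → Set ℝ := fun N => (fun p : ℝ≥0 × ℝ≥0 => |f p.1 - f p.2|) ''
    {p | p.1 ∈ Set.Icc a c ∧ p.2 ∈ Set.Icc a c ∧ dist p.1 p.2 ≤ ℓ / 2 ^ N}
  have hbdd : ∀ N, BddAbove (A N) := by
    rintro N
    refine ⟨C + C, ?_⟩
    rintro _ ⟨p, ⟨h1, h2, -⟩, rfl⟩
    exact (abs_sub _ _).trans (add_le_add (hC _ h1) (hC _ h2))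
  have hℓ : 0 ≤ ℓ := sub_nonneg.2 (by exact_mod_cast hac)
  have hne : ∀ N, (A N).Nonempty := fun N =>
    ⟨_, (a, a), ⟨⟨le_rfl, hac⟩, ⟨le_rfl, hac⟩, by simpa using by positivity⟩, rfl⟩
  have hnn : ∀ N, 0 ≤ sSup (A N) := fun N => Real.sSup_nonneg fun x hx => by
    obtain ⟨p, -, rfl⟩ := hx
    exact abs_nonneg _
  refine ⟨fun N => sSup (A N), ?_, fun N k hk s hs => ?_⟩
  · rw [Metric.tendsto_atTop]
    intro ε hε
    obtain ⟨δ, hδ, h⟩ := Metric.uniformContinuousOn_iff.1 (hK.uniformContinuousOn_of_continuous hf)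
      (ε / 2) (by positivity)
    have hlim : Tendsto (fun N : ℕ => ℓ / 2 ^ N) atTop (𝓝 0) :=
      Tendsto.div_atTop tendsto_const_nhds (tendsto_pow_atTop_atTop_of_one_lt one_lt_two)
    obtain ⟨N₀, hN₀⟩ := eventually_atTop.1 (hlim.eventually_lt_const hδ)
    refine ⟨N₀, fun N hN => ?_⟩
    rw [Real.dist_eq, sub_zero, abs_of_nonneg (hnn N)]
    refine lt_of_le_of_lt (csSup_le (hne N) ?_) (half_lt_self hε)
    rintro _ ⟨p, ⟨h1, h2, h3⟩, rfl⟩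
    exact (h _ h1 _ h2 (h3.trans_lt (hN₀ N hN))).le
  · refine le_csSup (hbdd N) ⟨(s, dyTime a c N k), ⟨⟨(le_dyTime a c N k).trans hs.1,
      hs.2.trans (dyTime_le hac N _)⟩, ⟨le_dyTime a c N k, dyTime_le hac N k⟩, ?_⟩, rfl⟩
    rw [NNReal.dist_eq, ← dyTime_sub hac hk, abs_of_nonneg (sub_nonneg.2 (by exact_mod_cast hs.1))]
    exact sub_le_sub_right (by exact_mod_cast hs.2) _

lemma abs_integral_sub_le {s t : ℝ≥0} (hst : s ≤ t) (htT : t ≤ T) {f β : ℝ → ℝ} {x : ℝ≥0 → ℝ}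
    {y C o : ℝ} (hβ : MemLp β ∞ (volume.restrict (Set.Icc (0 : ℝ) T)))
    (hC0 : 0 ≤ C) (hC : ∀ᵐ u ∂(volume.restrict (Set.Icc (0 : ℝ) T)), |β u| ≤ C)
    (hfi : IntervalIntegrable f volume s t)
    (hf : ∀ᵐ u ∂(volume.restrict (Set.Ioc (s : ℝ) t)), f u = β u * x u.toNNReal)
    (hx : ∀ u ∈ Set.Icc s t, |x u - y| ≤ o) :
    |(∫ u in (s : ℝ)..t, f u) - y * ∫ u in (s : ℝ)..t, β u| ≤ C * o * (t - s) := by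
  have hst' : (s : ℝ) ≤ t := by exact_mod_cast hst
  rw [← intervalIntegral.integral_const_mul, ← intervalIntegral.integral_sub hfi
    ((intervalIntegrable_of_memLp hβ hst htT).const_mul y)]
  have h1 : ∀ᵐ u, u ∈ Set.uIoc (s : ℝ) t → ‖f u - y * β u‖ ≤ C * o := by
    rw [Set.uIoc_of_le hst', ← ae_restrict_iff' measurableSet_Ioc]
    filter_upwards [hf, ae_mono (Measure.restrict_mono (Ioc_subset_Icc_of_le htT) le_rfl) hC,
      ae_restrict_mem measurableSet_Ioc] with u h1 h2 h3
    rw [h1, show β u * x u.toNNReal - y * β u = β u * (x u.toNNReal - y) by ring, norm_mul]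
    exact mul_le_mul h2 (hx _ (Set.Ioc_subset_Icc_self (toNNReal_mem_Ioc h3)))
      (norm_nonneg _) hC0
  have := intervalIntegral.norm_integral_le_of_norm_le_const_ae h1
  rwa [abs_of_nonneg (sub_nonneg.2 hst'), Real.norm_eq_abs] at this

lemma lintegral_enorm_block_le {s t : ℝ≥0} (htT : t ≤ T) {H σ : ℝ → ℝ} {x : ℝ≥0 → ℝ}
    {y z w C K A o : ℝ} (hC0 : 0 ≤ C)
    (hC : ∀ᵐ u ∂(volume.restrict (Set.Icc (0 : ℝ) T)), |σ u| ≤ C)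
    (hz : |z| ≤ A) (hw : |w| ≤ K)
    (hf : ∀ᵐ u ∂(volume.restrict (Set.Ioc (s : ℝ) t)), H u = w * σ u * x u.toNNReal)
    (hx : ∀ u ∈ Set.Icc s t, |x u - y| ≤ o) :
    ∫⁻ u in Set.Ioc (s : ℝ) t, ‖z * (H u - w * y * σ u)‖ₑ ^ 2
      ≤ ENNReal.ofReal ((A * K * C * o) ^ 2 * (t - s)) := by
  calc _ ≤ ∫⁻ u in Set.Ioc (s : ℝ) t, ENNReal.ofReal ((A * K * C * o) ^ 2) := by
        refine lintegral_mono_ae ?_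
        filter_upwards [hf, ae_mono (Measure.restrict_mono (Ioc_subset_Icc_of_le htT) le_rfl) hC,
          ae_restrict_mem measurableSet_Ioc] with u h1 h2 h3
        rw [h1, ← ofReal_norm, ← ENNReal.ofReal_pow (norm_nonneg _)]
        refine ENNReal.ofReal_le_ofReal (pow_le_pow_left₀ (norm_nonneg _) ?_ 2)
        rw [show z * (w * σ u * x u.toNNReal - w * y * σ u)
          = z * w * σ u * (x u.toNNReal - y) by ring, norm_mul, norm_mul, norm_mul]
        have h4 := hx _ (Set.Ioc_subset_Icc_self (toNNReal_mem_Ioc h3))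
        simp only [Real.norm_eq_abs]
        have hA0 := (abs_nonneg _).trans hz
        have hK0 := (abs_nonneg _).trans hw
        gcongr
    _ = _ := by
        rw [lintegral_const, Measure.restrict_apply_univ, Real.volume_Ioc,
          ENNReal.ofReal_mul (sq_nonneg _)]

end Deterministic

/-- The logarithmic growth over `[s, t]` of the strategy holding the fraction `w` in the stock. -/
def logGrowth (r ρ σ : ℝ → ℝ) (J : ℝ≥0 → Ω → ℝ) (w : Ω → ℝ) (s t : ℝ≥0) (ω : Ω) : ℝ :=
  ((1 - w ω) * (∫ y in (s : ℝ)..t, r y) + w ω * (∫ y in (s : ℝ)..t, ρ y))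
    + w ω * (J t ω - J s ω) - w ω ^ 2 / 2 * ∫ y in (s : ℝ)..t, σ y ^ 2

section Linear

variable {T : ℝ≥0} {r ρ σ : ℝ → ℝ} {U : ℕ → SimpleProcess 𝓕} {J : ℝ≥0 → Ω → ℝ} {a c : ℝ≥0}
  {w : Ω → ℝ}

lemma logGrowth_add (hr : MemLp r ∞ (volume.restrict (Set.Icc (0 : ℝ) T)))
    (hρ : MemLp ρ ∞ (volume.restrict (Set.Icc (0 : ℝ) T)))
    (hσ : MemLp σ ∞ (volume.restrict (Set.Icc (0 : ℝ) T)))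
    {s t u : ℝ≥0} (hst : s ≤ t) (htu : t ≤ u) (huT : u ≤ T) (ω : Ω) :
    logGrowth r ρ σ J w s u ω = logGrowth r ρ σ J w s t ω + logGrowth r ρ σ J w t u ω := by
  have h : ∀ {f : ℝ → ℝ}, MemLp f ∞ (volume.restrict (Set.Icc (0 : ℝ) T)) →
      ∫ y in (s : ℝ)..u, f y = (∫ y in (s : ℝ)..t, f y) + ∫ y in (t : ℝ)..u, f y := fun hf =>
    (intervalIntegral.integral_add_adjacent_intervals
      (intervalIntegrable_of_memLp hf hst (htu.trans huT))
      (intervalIntegrable_of_memLp hf htu huT)).symm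
  unfold logGrowth
  rw [h hr, h hρ, h (memLp_sq hσ)]
  ring

lemma logGrowth_self (s : ℝ≥0) (ω : Ω) : logGrowth r ρ σ J w s s ω = 0 := by simp [logGrowth]

lemma measurable_logGrowth (hJ : IsWienerIntegral 𝓕 W P T σ U J) (hw : Measurable[𝓕 a] w)
    {t : ℝ≥0} (hat : a ≤ t) : Measurable[𝓕 t] (logGrowth r ρ σ J w a t) := by
  have hw' : Measurable[𝓕 t] w := hw.mono (𝓕.mono hat) le_rfl
  have hJa : Measurable[𝓕 t] (J a) := (hJ.adapted a).mono (𝓕.mono hat) le_rfl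
  exact ((((measurable_const.sub hw').mul_const _).add (hw'.mul_const _)).add
    (hw'.mul ((hJ.adapted t).sub hJa))).sub (((hw'.pow_const 2).div_const 2).mul_const _)

/-- The values along dyadic times of the inverse of the exponential are bounded. -/
lemma exists_abs_exp_neg_logGrowth_le (hr : MemLp r ∞ (volume.restrict (Set.Icc (0 : ℝ) T)))
    (hρ : MemLp ρ ∞ (volume.restrict (Set.Icc (0 : ℝ) T)))
    (hσ : MemLp σ ∞ (volume.restrict (Set.Icc (0 : ℝ) T))) (hac : a ≤ c) (hcT : c ≤ T) {ω : Ω}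
    (h : ∃ C : ℝ, ∀ N k, |J (dyTime a c N k) ω - J a ω| ≤ C) :
    ∃ C : ℝ, ∀ N k, |Real.exp (-logGrowth r ρ σ J w a (dyTime a c N k) ω)| ≤ C := by
  obtain ⟨CJ, hCJ⟩ := h
  obtain ⟨Cr, hr0, hCr⟩ := exists_ae_abs_le hr
  obtain ⟨Cp, hp0, hCp⟩ := exists_ae_abs_le hρ
  obtain ⟨Cs, hs0, hCs⟩ := exists_ae_abs_le (memLp_sq hσ)
  refine ⟨Real.exp (|1 - w ω| * (Cr * T) + |w ω| * (Cp * T) + |w ω| * CJ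
    + w ω ^ 2 / 2 * (Cs * T)), fun N k => ?_⟩
  rw [abs_of_pos (Real.exp_pos _)]
  refine Real.exp_le_exp.2 ((neg_le_abs _).trans ?_)
  have hb : ∀ {f : ℝ → ℝ} {C : ℝ}, 0 ≤ C →
      (∀ᵐ t ∂(volume.restrict (Set.Icc (0 : ℝ) T)), |f t| ≤ C) →
      |∫ y in (a : ℝ)..dyTime a c N k, f y| ≤ C * T := fun hC0 hC => by
    refine (abs_intervalIntegral_le hC (le_dyTime a c N k) ((dyTime_le hac N k).trans hcT)).trans ?_
    refine mul_le_mul_of_nonneg_left ?_ hC0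
    have h1 : (dyTime a c N k : ℝ) ≤ T := by exact_mod_cast (dyTime_le hac N k).trans hcT
    linarith [a.coe_nonneg]
  unfold logGrowth
  refine (abs_sub _ _).trans (add_le_add ((abs_add_le _ _).trans (add_le_add
    ((abs_add_le _ _).trans (add_le_add ?_ ?_)) ?_)) ?_)
  · rw [abs_mul]
    exact mul_le_mul_of_nonneg_left (hb hr0 hCr) (abs_nonneg _)
  · rw [abs_mul]
    exact mul_le_mul_of_nonneg_left (hb hp0 hCp) (abs_nonneg _)
  · rw [abs_mul]
    exact mul_le_mul_of_nonneg_left (hCJ N k) (abs_nonneg _)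
  · rw [abs_mul, abs_of_nonneg (by positivity : 0 ≤ w ω ^ 2 / 2)]
    exact mul_le_mul_of_nonneg_left (hb hs0 hCs) (by positivity)

/-- Pathwise convergence of the bracket. -/
lemma tendsto_blockBracket (hσ : MemLp σ ∞ (volume.restrict (Set.Icc (0 : ℝ) T)))
    (hac : a ≤ c) (hcT : c ≤ T) {ω : Ω} {H X : ℝ≥0 → Ω → ℝ} {z : ℕ → ℕ → Ω → ℝ}
    (hz : ∃ C : ℝ, ∀ N k, |z N k ω| ≤ C)
    (hX : ContinuousOn (fun t => X t ω) (Set.Icc a c))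
    (hH : ∀ᵐ s ∂(volume.restrict (Set.Ioc (a : ℝ) c)),
      H s.toNNReal ω = w ω * σ s * X s.toNNReal ω) :
    Tendsto (fun N => blockBracket H σ (dyTime a c N) (z N)
      (fun k ω => w ω * X (dyTime a c N k) ω) (2 ^ N) ω) atTop (𝓝 0) := by
  obtain ⟨A, hA⟩ := hz
  obtain ⟨C, hC0, hC⟩ := exists_ae_abs_le hσ
  obtain ⟨o, ho, hoX⟩ := exists_modulus_dyTime hac hX
  have hlim : Tendsto (fun N => ENNReal.ofReal ((A * |w ω| * C * o N) ^ 2 * ((c : ℝ) - a))) atTop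
      (𝓝 0) := by
    have : Tendsto (fun N => (A * |w ω| * C * o N) ^ 2 * ((c : ℝ) - a)) atTop (𝓝 0) := by
      have h := ((ho.const_mul (A * |w ω| * C)).pow 2).mul_const ((c : ℝ) - a)
      simpa using h
    simpa using ENNReal.tendsto_ofReal this
  refine tendsto_of_tendsto_of_tendsto_of_le_of_le tendsto_const_nhds hlim
    (fun _ => zero_le) fun N => ?_
  calc _ ≤ ∑ k ∈ Finset.range (2 ^ N),
        ENNReal.ofReal ((A * |w ω| * C * o N) ^ 2 * (((c : ℝ) - a) / 2 ^ N)) := by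
        refine Finset.sum_le_sum fun k hk => ?_
        have hk' := Finset.mem_range.1 hk
        rw [← dyTime_sub hac hk']
        refine lintegral_enorm_block_le ((dyTime_le hac N _).trans hcT) hC0 hC (hA N k) le_rfl
          (x := fun t => X t ω) (H := fun u => H u.toNNReal ω) ?_ (hoX N k hk')
        exact ae_mono (Measure.restrict_mono (Set.Ioc_subset_Ioc
          (by exact_mod_cast le_dyTime a c N k) (by exact_mod_cast dyTime_le hac N _)) le_rfl) hH
    _ = ENNReal.ofReal ((A * |w ω| * C * o N) ^ 2 * ((c : ℝ) - a)) := by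
        rw [Finset.sum_const, Finset.card_range, nsmul_eq_mul, ← ENNReal.ofReal_natCast,
          ← ENNReal.ofReal_mul (by positivity)]
        congr 1
        push_cast
        field_simp

/-- Pathwise form of the product formula: if the three martingale type sums tend to zero along a
sequence of dyadic levels then the linear equation is solved by the exponential. -/
lemma eq_mul_exp_of_tendsto (hr : MemLp r ∞ (volume.restrict (Set.Icc (0 : ℝ) T)))
    (hρ : MemLp ρ ∞ (volume.restrict (Set.Icc (0 : ℝ) T)))
    (hσ : MemLp σ ∞ (volume.restrict (Set.Icc (0 : ℝ) T)))
    (hac : a ≤ c) (hcT : c ≤ T) {ω : Ω} {B X : ℝ≥0 → Ω → ℝ} {Y : ℝ≥0 → Ω → ℝ}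
    (hY : ∀ t, Y t ω = X t ω - X 0 ω - ∫ s in (0 : ℝ)..t, B s.toNNReal ω)
    (hX : ContinuousOn (fun t => X t ω) (Set.Icc a c))
    (hBi : IntegrableOn (fun s : ℝ => B s.toNNReal ω) (Set.Icc (0 : ℝ) T))
    (hB : ∀ᵐ s ∂(volume.restrict (Set.Ioc (a : ℝ) c)),
      B s.toNNReal ω = ((1 - w ω) * r s + w ω * ρ s) * X s.toNNReal ω)
    (hJb : ∃ C : ℝ, ∀ N k, |J (dyTime a c N k) ω - J a ω| ≤ C)
    (hJ2 : Tendsto (fun N => ∑ k ∈ Finset.range (2 ^ N),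
        ((J (dyTime a c N (k + 1)) ω - J (dyTime a c N k) ω) ^ 2
          - ∫ y in (dyTime a c N k : ℝ)..dyTime a c N (k + 1), σ y ^ 2)) atTop (𝓝 0))
    (hJ4 : Tendsto (fun N => ∑ k ∈ Finset.range (2 ^ N),
        (J (dyTime a c N (k + 1)) ω - J (dyTime a c N k) ω) ^ 4) atTop (𝓝 0))
    {φ : ℕ → ℕ} (hφ : StrictMono φ)
    (h1 : Tendsto (fun n => ∑ k ∈ Finset.range (2 ^ φ n),
      Real.exp (-logGrowth r ρ σ J w a (dyTime a c (φ n) k) ω)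
        * blockError Y J (dyTime a c (φ n)) (fun k ω => w ω * X (dyTime a c (φ n) k) ω) k ω)
      atTop (𝓝 0))
    (h2 : Tendsto (fun n => ∑ k ∈ Finset.range (2 ^ φ n),
      blockError Y J (dyTime a c (φ n)) (fun k ω => w ω * X (dyTime a c (φ n) k) ω) k ω ^ 2)
      atTop (𝓝 0))
    (h3 : Tendsto (fun n => ∑ k ∈ Finset.range (2 ^ φ n),
      Real.exp (-logGrowth r ρ σ J w a (dyTime a c (φ n) k) ω) * X (dyTime a c (φ n) k) ω
        * ((J (dyTime a c (φ n) (k + 1)) ω - J (dyTime a c (φ n) k) ω) ^ 2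
          - ∫ y in (dyTime a c (φ n) k : ℝ)..dyTime a c (φ n) (k + 1), σ y ^ 2)) atTop (𝓝 0)) :
    X c ω = X a ω * Real.exp (logGrowth r ρ σ J w a c ω) := by
  obtain ⟨Cr, hr0, hCr⟩ := exists_ae_abs_le hr
  obtain ⟨Cp, hp0, hCp⟩ := exists_ae_abs_le hρ
  obtain ⟨Cs, hs0, hCs⟩ := exists_ae_abs_le hσ
  obtain ⟨CE, hCE⟩ := exists_abs_exp_neg_logGrowth_le (w := w) hr hρ hσ hac hcT hJb
  obtain ⟨CX, hCX⟩ := isCompact_Icc.exists_bound_of_continuousOn hX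
  obtain ⟨o, ho, hoX⟩ := exists_modulus_dyTime hac hX
  set β : ℝ → ℝ := fun s => (1 - w ω) * r s + w ω * ρ s with hβ
  set Cb : ℝ := |1 - w ω| * Cr + |w ω| * Cp with hCb
  have hCb0 : 0 ≤ Cb := by positivity
  have hβm : MemLp β ∞ (volume.restrict (Set.Icc (0 : ℝ) T)) :=
    (hr.const_mul _).add (hρ.const_mul _)
  have hβb : ∀ᵐ t ∂(volume.restrict (Set.Icc (0 : ℝ) T)), |β t| ≤ Cb := by
    filter_upwards [hCr, hCp] with t h1 h2
    refine (abs_add_le _ _).trans ?_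
    rw [abs_mul, abs_mul]
    exact add_le_add (mul_le_mul_of_nonneg_left h1 (abs_nonneg _))
      (mul_le_mul_of_nonneg_left h2 (abs_nonneg _))
  set ℓ : ℝ := (c : ℝ) - a
  have hℓ : 0 ≤ ℓ := sub_nonneg.2 (by exact_mod_cast hac)
  -- One constant, at least `1`, dominating every quantity bounded along this path. It may depend on
  -- `ω` but not on the level.
  set A : ℝ := 1 + |w ω| + |CX| + |CE| + Cb + w ω ^ 2 * Cs ^ 2 with hA
  have hsq : 0 ≤ w ω ^ 2 * Cs ^ 2 := by positivity
  have hA1 : 1 ≤ A := by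
    have := abs_nonneg (w ω); have := abs_nonneg CX; have := abs_nonneg CE; linarith
  have hwA : |w ω| ≤ A := by
    have := abs_nonneg CX; have := abs_nonneg CE; linarith
  have hXA : |CX| ≤ A := by
    have := abs_nonneg (w ω); have := abs_nonneg CE; linarith
  have hEA : |CE| ≤ A := by
    have := abs_nonneg (w ω); have := abs_nonneg CX; linarith
  have hbA : Cb ≤ A := by
    have := abs_nonneg (w ω); have := abs_nonneg CX; have := abs_nonneg CE; linarith
  have hvA : w ω ^ 2 * Cs ^ 2 ≤ A := by
    have := abs_nonneg (w ω); have := abs_nonneg CX; have := abs_nonneg CE; linarith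
  have hstep := fun N k => dyTime_mono a c N (Nat.le_succ k)
  have hleT := fun N k => (dyTime_le hac N k).trans hcT
  let g : ℕ → ℕ → ℝ := fun N k => J (dyTime a c N (k + 1)) ω - J (dyTime a c N k) ω
  let v : ℕ → ℕ → ℝ := fun N k => ∫ y in (dyTime a c N k : ℝ)..dyTime a c N (k + 1), σ y ^ 2
  let b : ℕ → ℕ → ℝ := fun N k => ∫ y in (dyTime a c N k : ℝ)..dyTime a c N (k + 1), β y
  let ε : ℕ → ℕ → ℝ := fun N k =>
    blockError Y J (dyTime a c N) (fun k ω => w ω * X (dyTime a c N k) ω) k ω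
  -- The error of freezing `X` at the left end inside the drift integral, controlled by the modulus
  -- of continuity of `X`.
  let e : ℕ → ℕ → ℝ := fun N k =>
    (∫ u in (dyTime a c N k : ℝ)..dyTime a c N (k + 1), B u.toNNReal ω)
      - X (dyTime a c N k) ω * b N k
  let Δ : ℕ → ℝ := fun N => ℓ / 2 ^ N
  -- The fourth root of the quartic variation bounds every single increment of `J`. This gives
  -- uniform smallness of the increments without continuity of the path.
  let η : ℕ → ℝ := fun N => √√(∑ k ∈ Finset.range (2 ^ N), g N k ^ 4)
  let Q : ℕ → ℝ := fun N => ∑ k ∈ Finset.range (2 ^ N), g N k ^ 2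
  have hBint : ∀ s t : ℝ≥0, s ≤ t → t ≤ T →
      IntervalIntegrable (fun s : ℝ => B s.toNNReal ω) volume s t := fun s t hst htT => by
    rw [intervalIntegrable_iff_integrableOn_Ioc_of_le (by exact_mod_cast hst)]
    exact hBi.mono_set (Ioc_subset_Icc_of_le htT)
  have hb_eq : ∀ N k, b N k = (1 - w ω) * (∫ y in (dyTime a c N k : ℝ)..dyTime a c N (k + 1), r y)
      + w ω * (∫ y in (dyTime a c N k : ℝ)..dyTime a c N (k + 1), ρ y) := fun N k => by
    simp only [b, hβ]
    rw [intervalIntegral.integral_add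
      ((intervalIntegrable_of_memLp hr (hstep N k) (hleT N _)).const_mul _)
      ((intervalIntegrable_of_memLp hρ (hstep N k) (hleT N _)).const_mul _),
      intervalIntegral.integral_const_mul, intervalIntegral.integral_const_mul]
  have hΔlim : Tendsto Δ atTop (𝓝 0) :=
    Tendsto.div_atTop tendsto_const_nhds (tendsto_pow_atTop_atTop_of_one_lt one_lt_two)
  have hηlim : Tendsto η atTop (𝓝 0) := by simpa using hJ4.sqrt.sqrt
  have hMΔ : ∀ N, ((2 ^ N : ℕ) : ℝ) * Δ N = ℓ := fun N => by
    simp only [Δ]; push_cast; field_simp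
  have hmain : ∀ N, 2 * A * (Δ N + η N) ≤ 1 →
      |Real.exp (-logGrowth r ρ σ J w a c ω) * X c ω - X a ω| ≤
      16 * A ^ 5 * (η N + Δ N) * (ℓ + Q N)
      + w ω ^ 2 / 2 * |∑ k ∈ Finset.range (2 ^ N),
          Real.exp (-logGrowth r ρ σ J w a (dyTime a c N k) ω) * X (dyTime a c N k) ω
            * (g N k ^ 2 - v N k)|
      + A * (Cb * o N * ℓ) + |∑ k ∈ Finset.range (2 ^ N),
          Real.exp (-logGrowth r ρ σ J w a (dyTime a c N k) ω) * ε N k|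
      + A * (√(24 * A ^ 2 * (ℓ + Q N)) * √(∑ k ∈ Finset.range (2 ^ N), ε N k ^ 2)) := by
    intro N hsmall
    have h := abs_prod_sub_le (M := 2 ^ N) (A := A) (Δ := Δ N) (η := η N) (o := Cb * o N) (w := w ω)
      (X := fun k => X (dyTime a c N k) ω)
      (E := fun k => Real.exp (-logGrowth r ρ σ J w a (dyTime a c N k) ω))
      (g := g N) (b := b N) (v := v N) (a := e N) (ε := ε N) hA1 (by positivity) (Real.sqrt_nonneg _)
      hsmall hwA
      (fun k => ((hCX _ ⟨le_dyTime a c N k, dyTime_le hac N k⟩).trans (le_abs_self _)).trans hXA)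
      (fun k => ((hCE N k).trans (le_abs_self _)).trans hEA)
      (fun k hk => ?_) (fun k hk => ?_) (fun k => integral_sq_nonneg (hstep N k))
      (fun k hk => ?_) (fun k hk => ?_) (fun k hk => ?_) (fun k hk => ?_)
    · simp only [dyTime_last hac, dyTime_zero, logGrowth_self, neg_zero, Real.exp_zero, one_mul]
        at h
      rwa [hMΔ] at h
    · have : g N k ^ 4 ≤ ∑ k ∈ Finset.range (2 ^ N), g N k ^ 4 :=
        Finset.single_le_sum (f := fun k => g N k ^ 4) (fun j _ => by positivity)
          (Finset.mem_range.2 hk)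
      refine Real.le_sqrt_of_sq_le (Real.le_sqrt_of_sq_le ?_)
      rwa [← pow_mul, Even.pow_abs (by decide)]
    · rw [show Δ N = _ from (dyTime_sub hac hk).symm]
      exact (abs_intervalIntegral_le hβb (hstep N k) (hleT N _)).trans
        (mul_le_mul_of_nonneg_right hbA (sub_nonneg.2 (by exact_mod_cast hstep N k)))
    · have h1 := abs_intervalIntegral_le (ae_sq_le hCs) (hstep N k) (hleT N _)
      rw [Nat.succ_eq_add_one, dyTime_sub hac hk] at h1
      have h2 := (le_abs_self _).trans h1
      have hΔ0 : 0 ≤ Δ N := by positivity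
      have hv0 : 0 ≤ v N k := integral_sq_nonneg (hstep N k)
      calc w ω ^ 2 * v N k / 2 ≤ w ω ^ 2 * v N k := by
            have : 0 ≤ w ω ^ 2 * v N k := by positivity
            linarith
        _ ≤ w ω ^ 2 * (Cs ^ 2 * Δ N) := mul_le_mul_of_nonneg_left h2 (sq_nonneg _)
        _ = w ω ^ 2 * Cs ^ 2 * Δ N := by ring
        _ ≤ A * Δ N := mul_le_mul_of_nonneg_right hvA hΔ0
    · have := abs_integral_sub_le (hstep N k) (hleT N _) (f := fun u => B u.toNNReal ω) (β := β)
        (x := fun t => X t ω) (y := X (dyTime a c N k) ω) hβm hCb0 hβb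
        (hBint _ _ (hstep N k) (hleT N _)) (ae_mono (Measure.restrict_mono (Set.Ioc_subset_Ioc
          (by exact_mod_cast le_dyTime a c N k) (by exact_mod_cast dyTime_le hac N _)) le_rfl) hB)
        (hoX N k hk)
      rwa [Nat.succ_eq_add_one, dyTime_sub hac hk] at this
    -- The increment of `X` is its drift integral plus the increment of `Y`; the latter is `w X` at
    -- the left end times the increment of `J`, plus the block error.
    · have hsplit := intervalIntegral.integral_add_adjacent_intervals
        (hBint 0 _ zero_le (hleT N k)) (hBint _ _ (hstep N k) (hleT N _))
      rw [NNReal.coe_zero, Nat.succ_eq_add_one] at hsplit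
      simp only [ε, e, blockError, hY, ← hsplit, g]
      ring
    · rw [← Real.exp_add, logGrowth_add hr hρ hσ (le_dyTime a c N k) (hstep N k) (hleT N _),
        hb_eq]
      congr 1
      simp only [logGrowth, g, v, Nat.succ_eq_add_one]
      ring
  have hvsum : ∀ N, ∑ k ∈ Finset.range (2 ^ N), v N k = ∫ y in (a : ℝ)..c, σ y ^ 2 := fun N => by
    have h := intervalIntegral.sum_integral_adjacent_intervals (μ := volume)
      (f := fun y => σ y ^ 2) (a := fun j => (dyTime a c N j : ℝ)) (n := 2 ^ N) (fun k _ =>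
        intervalIntegrable_of_memLp (memLp_sq hσ) (hstep N k) (hleT N _))
    rw [h, dyTime_zero, dyTime_last hac]
  have hQ : Tendsto Q atTop (𝓝 (∫ y in (a : ℝ)..c, σ y ^ 2)) := by
    have := hJ2.add_const (∫ y in (a : ℝ)..c, σ y ^ 2)
    rw [zero_add] at this
    refine this.congr fun N => ?_
    rw [Finset.sum_sub_distrib, ← hvsum N]
    simp only [Q, v, g, sub_add_cancel]
  have hφt := hφ.tendsto_atTop
  have hsmall : ∀ᶠ n in atTop, 2 * A * (Δ (φ n) + η (φ n)) ≤ 1 := by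
    have : Tendsto (fun n => 2 * A * (Δ (φ n) + η (φ n))) atTop (𝓝 0) := by
      simpa [Function.comp_def] using ((hΔlim.add hηlim).const_mul (2 * A)).comp hφt
    exact this.eventually_le_const one_pos
  have hlim : Tendsto (fun n => 16 * A ^ 5 * (η (φ n) + Δ (φ n)) * (ℓ + Q (φ n))
      + w ω ^ 2 / 2 * |∑ k ∈ Finset.range (2 ^ φ n),
          Real.exp (-logGrowth r ρ σ J w a (dyTime a c (φ n) k) ω) * X (dyTime a c (φ n) k) ω
            * (g (φ n) k ^ 2 - v (φ n) k)|
      + A * (Cb * o (φ n) * ℓ) + |∑ k ∈ Finset.range (2 ^ φ n),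
          Real.exp (-logGrowth r ρ σ J w a (dyTime a c (φ n) k) ω) * ε (φ n) k|
      + A * (√(24 * A ^ 2 * (ℓ + Q (φ n))) * √(∑ k ∈ Finset.range (2 ^ φ n), ε (φ n) k ^ 2)))
      atTop (𝓝 0) := by
    have t1 := ((hηlim.add hΔlim).const_mul (16 * A ^ 5)).mul (hQ.const_add ℓ)
    have t3 := ((ho.const_mul Cb).mul_const ℓ).const_mul A
    have t5 := ((hQ.const_add ℓ).const_mul (24 * A ^ 2)).sqrt
    have := ((((t1.comp hφt).add (h3.abs.const_mul (w ω ^ 2 / 2))).add (t3.comp hφt)).add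
      h1.abs).add (((t5.comp hφt).mul h2.sqrt).const_mul A)
    simpa using this
  -- The left side does not depend on the level, while the bound tends to zero.
  have hfin : |Real.exp (-logGrowth r ρ σ J w a c ω) * X c ω - X a ω| ≤ 0 :=
    ge_of_tendsto hlim (hsmall.mono fun n hn => hmain _ hn)
  have heq := sub_eq_zero.1 (abs_nonpos_iff.1 hfin)
  rw [← heq, mul_comm, ← mul_assoc, ← Real.exp_add, add_neg_cancel, Real.exp_zero, one_mul]

end Linear

end

/-! ### The explicit solution, almost surely. -/

section

variable {Ω : Type*} {mΩ : MeasurableSpace Ω} {P : Measure Ω}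
  {𝓕 : Filtration ℝ≥0 mΩ} {W : ℝ≥0 → Ω → ℝ}

/-- Brings the discrete Lenglart bound into the form used by `tendsto_lintegral_zero_of_lenglart`;
the factor `3` is only there to match. -/
lemma measure_lt_le_lintegral_min {D : Ω → ℝ} (hD : Measurable D) {δ : ℝ} (hδ : 0 < δ) :
    P {ω | δ < D ω} ≤ ∫⁻ ω, min (3 * ENNReal.ofReal (D ω) / ENNReal.ofReal δ) 1 ∂P := by
  have hm : MeasurableSet {ω | δ < D ω} := measurableSet_lt measurable_const hD
  rw [← lintegral_indicator_one hm]
  refine lintegral_mono fun ω => ?_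
  by_cases h : ω ∈ {ω | δ < D ω}
  · rw [Set.indicator_of_mem h, Pi.one_apply]
    refine le_min ?_ le_rfl
    rw [ENNReal.le_div_iff_mul_le (Or.inl (by simpa using hδ)) (Or.inl ENNReal.ofReal_ne_top),
      one_mul]
    exact (ENNReal.ofReal_le_ofReal (le_of_lt h)).trans
      (le_mul_of_one_le_left zero_le (by norm_num))
  · rw [Set.indicator_of_notMem h]
    exact zero_le

lemma exists_subseq_ae_tendsto_zero₃ {f g h : ℕ → Ω → ℝ≥0∞} (hf : ∀ n, AEMeasurable (f n) P)
    (hg : ∀ n, AEMeasurable (g n) P) (hh : ∀ n, AEMeasurable (h n) P)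
    (tf : Tendsto (fun n => ∫⁻ ω, f n ω ∂P) atTop (𝓝 0))
    (tg : Tendsto (fun n => ∫⁻ ω, g n ω ∂P) atTop (𝓝 0))
    (th : Tendsto (fun n => ∫⁻ ω, h n ω ∂P) atTop (𝓝 0)) :
    ∃ φ : ℕ → ℕ, StrictMono φ ∧
      ∀ᵐ ω ∂P, Tendsto (fun n => f (φ n) ω + g (φ n) ω + h (φ n) ω) atTop (𝓝 0) := by
  refine exists_subseq_ae_tendsto_zero (f := fun n ω => f n ω + g n ω + h n ω)
    (fun n => ((hf n).add (hg n)).add (hh n)) ?_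
  have := (tf.add tg).add th
  simp only [add_zero] at this
  refine this.congr fun n => ?_
  rw [lintegral_add_right' _ (hh n), lintegral_add_right' _ (hg n)]

section Linear

variable {T : ℝ≥0} {r ρ σ : ℝ → ℝ} {U : ℕ → SimpleProcess 𝓕} {J : ℝ≥0 → Ω → ℝ} {a c : ℝ≥0}
  {w : Ω → ℝ}

lemma dyTime_bound {f : ℝ≥0 → ℝ} (hac : a ≤ c) (hf : ContinuousOn f (Set.Icc a c)) :
    ∃ C : ℝ, ∀ N k, |f (dyTime a c N k)| ≤ C := by
  obtain ⟨C, hC⟩ := isCompact_Icc.exists_bound_of_continuousOn hf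
  exact ⟨C, fun N k => hC _ ⟨le_dyTime a c N k, dyTime_le hac N k⟩⟩

/-- Weighted compensated squares of the Wiener integral vanish along dyadic partitions. -/
lemma IsWienerIntegral.tendsto_weighted_sq [IsProbabilityMeasure P]
    (hJ : IsWienerIntegral 𝓕 W P T σ U J)
    (hσ : MemLp σ ∞ (volume.restrict (Set.Icc (0 : ℝ) T))) (hac : a ≤ c) (hcT : c ≤ T)
    {ξ : ℕ → ℕ → Ω → ℝ} (hξ : ∀ N k, Measurable[𝓕 (dyTime a c N k)] (ξ N k))
    (hξb : ∀ᵐ ω ∂P, ∃ C : ℝ, ∀ N k, |ξ N k ω| ≤ C) :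
    (∀ N, Measurable fun ω => ∑ k ∈ Finset.range (2 ^ N), ξ N k ω *
      ((J (dyTime a c N (k + 1)) ω - J (dyTime a c N k) ω) ^ 2
          - ∫ y in (dyTime a c N k : ℝ)..dyTime a c N (k + 1), σ y ^ 2)) ∧
    Tendsto (fun N => ∫⁻ ω, min (ENNReal.ofReal ((∑ k ∈ Finset.range (2 ^ N), ξ N k ω *
      ((J (dyTime a c N (k + 1)) ω - J (dyTime a c N k) ω) ^ 2
          - ∫ y in (dyTime a c N k : ℝ)..dyTime a c N (k + 1), σ y ^ 2)) ^ 2)) 1 ∂P)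
      atTop (𝓝 0) := by
  have hξm : ∀ N k, Measurable (ξ N k) := fun N k => (hξ N k).mono (𝓕.le _) le_rfl
  have hJm : ∀ t, Measurable (J t) := fun t => (hJ.adapted t).mono (𝓕.le t) le_rfl
  refine ⟨fun N => Finset.measurable_fun_sum _ fun k _ => (hξm N k).mul
    ((((hJm _).sub (hJm _)).pow_const 2).sub_const _), ?_⟩
  obtain ⟨C, hC0, hC⟩ := exists_ae_abs_le hσ
  set v : ℕ → ℕ → ℝ := fun N k => ∫ y in (dyTime a c N k : ℝ)..dyTime a c N (k + 1), σ y ^ 2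
  have hv0 : ∀ N k, 0 ≤ v N k := fun N k =>
    integral_sq_nonneg (dyTime_mono a c N (Nat.le_succ k))
  have hvc : ∀ N k, ((v N k).toNNReal : ℝ) = v N k := fun N k => Real.coe_toNNReal _ (hv0 N k)
  set ℓ : ℝ := (c : ℝ) - a
  have hℓ : 0 ≤ ℓ := sub_nonneg.2 (by exact_mod_cast hac)
  have hvle : ∀ N, ∀ k ∈ Finset.range (2 ^ N), v N k ≤ C ^ 2 * (ℓ / 2 ^ N) := fun N k hk => by
    have h1 := abs_intervalIntegral_le (ae_sq_le hC) (dyTime_mono a c N (Nat.le_succ k))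
      ((dyTime_le hac N _).trans hcT)
    rw [Nat.succ_eq_add_one, dyTime_sub hac (Finset.mem_range.1 hk)] at h1
    exact (le_abs_self _).trans h1
  -- The bracket of the weighted compensated squares. With weights bounded along the path it is of
  -- order `2 ^ (-N)`.
  let D : ℕ → Ω → ℝ := fun N ω =>
    ∑ k ∈ Finset.range (2 ^ N), sqVariance * v N k ^ 2 * ξ N k ω ^ 2
  have hDm : ∀ N, Measurable (D N) := fun N => Finset.measurable_fun_sum _ fun k _ =>
    ((hξm N k).pow_const 2).const_mul _
  refine tendsto_lintegral_zero_of_lenglart (D := fun N ω => ENNReal.ofReal (D N ω))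
    (fun N => (hDm N).ennreal_ofReal.aemeasurable) ?_ fun δ hδ N => ?_
  · filter_upwards [hξb] with ω ⟨K, hK⟩
    have hlim : Tendsto (fun N : ℕ => sqVariance * (C ^ 2 * ℓ) ^ 2 * K ^ 2 * (1 / 2 : ℝ) ^ N) atTop
        (𝓝 0) := by
      simpa using (tendsto_pow_atTop_nhds_zero_of_lt_one (by norm_num)
        (by norm_num : (1 / 2 : ℝ) < 1)).const_mul (sqVariance * (C ^ 2 * ℓ) ^ 2 * K ^ 2)
    have h0 : Tendsto (fun N => D N ω) atTop (𝓝 0) := by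
      refine squeeze_zero (fun N => Finset.sum_nonneg fun k _ => mul_nonneg
        (mul_nonneg sqVariance_nonneg (sq_nonneg _)) (sq_nonneg _)) (fun N => ?_) hlim
      calc D N ω ≤ ∑ k ∈ Finset.range (2 ^ N), sqVariance * (C ^ 2 * (ℓ / 2 ^ N)) ^ 2 * K ^ 2 := by
            refine Finset.sum_le_sum fun k hk => ?_
            have h1 := pow_le_pow_left₀ (hv0 N k) (hvle N k hk) 2
            have h2 : ξ N k ω ^ 2 ≤ K ^ 2 := by
              rw [← sq_abs]
              exact pow_le_pow_left₀ (abs_nonneg _) (hK N k) 2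
            exact mul_le_mul (mul_le_mul_of_nonneg_left h1 sqVariance_nonneg) h2 (sq_nonneg _)
              (mul_nonneg sqVariance_nonneg (sq_nonneg _))
        _ = _ := by
            rw [Finset.sum_const, Finset.card_range, nsmul_eq_mul]
            push_cast
            rw [one_div, inv_pow]
            field_simp
    simpa using ENNReal.tendsto_ofReal h0
  · have hn := hJ.noise (dyTime_mono a c N) fun k => (dyTime_le hac N k).trans hcT
    have hl : ∀ k, HasLaw (fun ω => J (dyTime a c N (k + 1)) ω - J (dyTime a c N k) ω)
      (gaussianReal 0 (v N k).toNNReal) P := fun k => hn.2.2 k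
    have hs := isNoise_sq_of_gaussian (v := fun k => (v N k).toNNReal) hn.1 hn.2.1 hl
    have h := hs.lintegral_min_sum_le (ξ := ξ N) (hξ N) hδ.le (2 ^ N)
    simp only [hvc] at h
    exact h.trans (add_le_add le_rfl (measure_lt_le_lintegral_min (hDm N) hδ))

/-- The explicit solution of a linear equation whose leverage is fixed at the initial time. -/
lemma HasItoDifferential.ae_eq_mul_exp [IsProbabilityMeasure P] (hW : IsFilteredBrownian 𝓕 W P)
    (hr : MemLp r ∞ (volume.restrict (Set.Icc (0 : ℝ) T)))
    (hρ : MemLp ρ ∞ (volume.restrict (Set.Icc (0 : ℝ) T)))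
    (hσ : MemLp σ ∞ (volume.restrict (Set.Icc (0 : ℝ) T)))
    (hJ : IsWienerIntegral 𝓕 W P T σ U J) (hac : a ≤ c) (hcT : c ≤ T)
    (hw : Measurable[𝓕 a] w) {B H X : ℝ≥0 → Ω → ℝ} (hX : HasItoDifferential 𝓕 W P T B H X)
    (hB : ∀ᵐ ω ∂P, ∀ᵐ s ∂(volume.restrict (Set.Ioc (a : ℝ) c)),
      B s.toNNReal ω = ((1 - w ω) * r s + w ω * ρ s) * X s.toNNReal ω)
    (hH : ∀ᵐ ω ∂P, ∀ᵐ s ∂(volume.restrict (Set.Ioc (a : ℝ) c)),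
      H s.toNNReal ω = w ω * σ s * X s.toNNReal ω) :
    ∀ᵐ ω ∂P, X c ω = X a ω * Real.exp (logGrowth r ρ σ J w a c ω) := by
  set Y : ℝ≥0 → Ω → ℝ := fun t ω => X t ω - X 0 ω - ∫ s in (0 : ℝ)..t, B s.toNNReal ω with hY
  have hleT := fun N k => (dyTime_le hac N k).trans hcT
  have hXc : ∀ᵐ ω ∂P, ContinuousOn (fun t => X t ω) (Set.Icc a c) := by
    filter_upwards [hX.continuousOn] with ω h
    exact h.mono (Set.Icc_subset_Icc zero_le hcT)
  have hXb : ∀ᵐ ω ∂P, ∃ C : ℝ, ∀ N k, |X (dyTime a c N k) ω| ≤ C :=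
    hXc.mono fun ω h => dyTime_bound hac h
  have hJb := hJ.ae_bounded_dyTime hσ hac hcT
  let z : ℕ → ℕ → Ω → ℝ := fun N k ω => Real.exp (-logGrowth r ρ σ J w a (dyTime a c N k) ω)
  let x : ℕ → ℕ → Ω → ℝ := fun N k ω => w ω * X (dyTime a c N k) ω
  have hzb : ∀ᵐ ω ∂P, ∃ C : ℝ, ∀ N k, |z N k ω| ≤ C :=
    hJb.mono fun ω h => exists_abs_exp_neg_logGrowth_le hr hρ hσ hac hcT h
  have hzm : ∀ N k, Measurable[𝓕 (dyTime a c N k)] (z N k) := fun N k =>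
    Real.measurable_exp.comp (measurable_logGrowth hJ hw (le_dyTime a c N k)).neg
  have hxm : ∀ N k, Measurable[𝓕 (dyTime a c N k)] (x N k) := fun N k =>
    (hw.mono (𝓕.mono (le_dyTime a c N k)) le_rfl).mul (hX.adapted _ (hleT N k))
  have h1m : ∀ N k : ℕ, Measurable[𝓕 (dyTime a c N k)] (fun _ : Ω => (1 : ℝ)) := fun N k =>
    measurable_const
  have hL1 := fun N (δ : ℝ) (hδ : 0 < δ) => hX.isItoIntegral.lintegral_min_blockError_le hW hJ hσ.1
    (dyTime_mono a c N) (hleT N) (hzm N) (hxm N) hδ (2 ^ N)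
  -- Unit weights: from this instance the sum of the squared block errors is taken, which enters the
  -- Cauchy–Schwarz term.
  have hL2 := fun N (δ : ℝ) (hδ : 0 < δ) => hX.isItoIntegral.lintegral_min_blockError_le hW hJ hσ.1
    (dyTime_mono a c N) (hleT N) (h1m N) (hxm N) hδ (2 ^ N)
  have hξb : ∀ᵐ ω ∂P, ∃ C : ℝ, ∀ N k, |z N k ω * X (dyTime a c N k) ω| ≤ C := by
    filter_upwards [hzb, hXb] with ω ⟨C1, h1⟩ ⟨C2, h2⟩
    refine ⟨C1 * C2, fun N k => ?_⟩
    rw [abs_mul]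
    exact mul_le_mul (h1 N k) (h2 N k) (abs_nonneg _) ((abs_nonneg _).trans (h1 N k))
  obtain ⟨m3, t3⟩ := hJ.tendsto_weighted_sq hσ hac hcT
    (ξ := fun N k ω => z N k ω * X (dyTime a c N k) ω)
    (fun N k => (hzm N k).mul (hX.adapted _ (hleT N k))) hξb
  have t1 := tendsto_lintegral_zero_of_lenglart (P := P)
    (f := fun N ω => min (ENNReal.ofReal ((∑ k ∈ Finset.range (2 ^ N),
      z N k ω * blockError Y J (dyTime a c N) (x N) k ω) ^ 2)) 1)
    (D := fun N => blockBracket H σ (dyTime a c N) (z N) (x N) (2 ^ N))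
    (fun N => (hL1 N 1 one_pos).1.2.2)
    (by
      filter_upwards [hzb, hXc, hH] with ω hz hXω hHω
      exact tendsto_blockBracket hσ hac hcT hz hXω hHω)
    (fun δ hδ N => (hL1 N δ hδ).2.1)
  have t2 := tendsto_lintegral_zero_of_lenglart (P := P)
    (f := fun N ω => min (ENNReal.ofReal (∑ k ∈ Finset.range (2 ^ N),
      (1 * blockError Y J (dyTime a c N) (x N) k ω) ^ 2)) 1)
    (D := fun N => blockBracket H σ (dyTime a c N) (fun _ _ => 1) (x N) (2 ^ N))
    (fun N => (hL2 N 1 one_pos).1.2.2)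
    (by
      filter_upwards [hXc, hH] with ω hXω hHω
      exact tendsto_blockBracket (z := fun _ _ _ => 1) hσ hac hcT ⟨1, fun _ _ => by simp⟩ hXω hHω)
    (fun δ hδ N => (hL2 N δ hδ).2.2)
  have a1 : ∀ N, AEMeasurable (fun ω => min (ENNReal.ofReal ((∑ k ∈ Finset.range (2 ^ N),
      z N k ω * blockError Y J (dyTime a c N) (x N) k ω) ^ 2)) 1) P := fun N =>
    ((hL1 N 1 one_pos).1.1.pow_const 2).ennreal_ofReal.min aemeasurable_const
  have a2 : ∀ N, AEMeasurable (fun ω => min (ENNReal.ofReal (∑ k ∈ Finset.range (2 ^ N),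
      (1 * blockError Y J (dyTime a c N) (x N) k ω) ^ 2)) 1) P := fun N =>
    (hL2 N 1 one_pos).1.2.1.ennreal_ofReal.min aemeasurable_const
  have a3 := fun N => (((m3 N).pow_const 2).ennreal_ofReal.min
    (measurable_const (a := (1 : ℝ≥0∞)))).aemeasurable (μ := P)
  -- The three martingale sums vanish only in probability. A common subsequence suffices, since the
  -- boundedness and variation statements for `J` hold along all levels.
  obtain ⟨φ, hφ, hae⟩ := exists_subseq_ae_tendsto_zero₃ a1 a2 a3 t1 t2 t3
  filter_upwards [hae, hXc, hB, hX.integrableOn, hJb, hJ.ae_tendsto_variation hσ hac hcT]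
    with ω hω hXω hBω hBi hJω hvar
  have key : ∀ {p : ℕ → ℝ≥0∞}, (∀ n, p n ≤ _) → Tendsto p atTop (𝓝 0) := fun {p} hp =>
    tendsto_of_tendsto_of_tendsto_of_le_of_le tendsto_const_nhds hω (fun _ => zero_le) hp
  have s1 := tendsto_zero_of_min_ofReal (fun n => sq_nonneg _)
    (key fun n => le_self_add.trans le_self_add)
  have s2 := tendsto_zero_of_min_ofReal (fun n => Finset.sum_nonneg fun k _ => sq_nonneg _)
    (key fun n => le_add_self.trans le_self_add)
  have s3 := tendsto_zero_of_min_ofReal (fun n => sq_nonneg _) (key fun n => le_add_self)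
  have hsq : ∀ {y : ℕ → ℝ}, Tendsto (fun n => y n ^ 2) atTop (𝓝 0) → Tendsto y atTop (𝓝 0) :=
    fun h => by
      have h4 := h.sqrt
      simp only [Real.sqrt_sq_eq_abs, Real.sqrt_zero] at h4
      exact tendsto_zero_iff_abs_tendsto_zero _ |>.2 h4
  simp only [one_mul] at s2
  exact eq_mul_exp_of_tendsto hr hρ hσ hac hcT (Y := Y) (fun t => rfl) hXω hBi hBω hJω
    hvar.1 hvar.2 hφ (hsq s1) s2 (hsq s3)

end Linear

end

/-! ### The market: observation times and explicit formulas for stock and indices. -/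

section

variable {Ω : Type*} {mΩ : MeasurableSpace Ω} {P : Measure Ω}
  {𝓕 : Filtration ℝ≥0 mΩ} {W : ℝ≥0 → Ω → ℝ}

section obsTime

variable {T : ℝ≥0} {N : ℕ}

lemma obsTime_mono (T : ℝ≥0) (N : ℕ) : Monotone (obsTime T N) := fun i j hij => by
  unfold obsTime
  gcongr

@[simp] lemma obsTime_zero (T : ℝ≥0) (N : ℕ) : obsTime T N 0 = 0 := by simp [obsTime]

lemma obsTime_last (hN : 1 ≤ N) : obsTime T N N = T := by
  unfold obsTime window
  have : (N : ℝ≥0) ≠ 0 := by exact_mod_cast (by omega : N ≠ 0)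
  field_simp

lemma obsTime_le (hN : 1 ≤ N) {n : ℕ} (hn : n ≤ N) : obsTime T N n ≤ T :=
  (obsTime_mono T N hn).trans_eq (obsTime_last hN)

lemma obsTime_succ_sub (T : ℝ≥0) (N n : ℕ) :
    (obsTime T N (n + 1) : ℝ) - obsTime T N n = T / N := by
  simp only [obsTime, window]
  push_cast
  ring

lemma window_pos (hT : 0 < T) (hN : 1 ≤ N) : 0 < window T N :=
  div_pos hT (by exact_mod_cast hN)

lemma floor_div_window (hT : 0 < T) (hN : 1 ≤ N) {n : ℕ} {t : ℝ≥0} (h1 : obsTime T N n ≤ t)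
    (h2 : t < obsTime T N (n + 1)) : ⌊t / window T N⌋₊ = n := by
  have hw := window_pos hT hN
  rw [Nat.floor_eq_iff zero_le]
  constructor
  · rwa [le_div_iff₀ hw]
  · rw [div_lt_iff₀ hw]
    simpa [obsTime] using h2

lemma floor_last_div_window (hT : 0 < T) (hN : 1 ≤ N) : ⌊T / window T N⌋₊ = N := by
  refine floor_div_window hT hN (obsTime_last hN).le ?_
  conv_lhs => rw [← obsTime_last (T := T) hN]
  unfold obsTime
  have hw := window_pos hT hN
  push_cast
  rw [add_one_mul]
  exact lt_add_of_pos_right _ hw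

end obsTime

/-- The market of the theorem, together with a version `J` of `∫ σ dW`. -/
structure IsMarket (𝓕 : Filtration ℝ≥0 mΩ) (W : ℝ≥0 → Ω → ℝ) (P : Measure Ω) (T : ℝ≥0)
    (r ρ σ : ℝ → ℝ) (σlow : ℝ) (U : ℕ → SimpleProcess 𝓕) (J S : ℝ≥0 → Ω → ℝ) : Prop where
  brownian : IsFilteredBrownian 𝓕 W P
  horizon_pos : 0 < T
  rate : MemLp r ∞ (volume.restrict (Set.Icc (0 : ℝ) T))
  drift : MemLp ρ ∞ (volume.restrict (Set.Icc (0 : ℝ) T))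
  vol : MemLp σ ∞ (volume.restrict (Set.Icc (0 : ℝ) T))
  low_pos : 0 < σlow
  low_lt : ∀ᵐ t ∂(volume.restrict (Set.Icc (0 : ℝ) T)), σlow < σ t
  wiener : IsWienerIntegral 𝓕 W P T σ U J
  stock : IsStock 𝓕 W P T ρ σ S

section Market

variable {T : ℝ≥0} {r ρ σ : ℝ → ℝ} {σlow : ℝ} {U : ℕ → SimpleProcess 𝓕} {J S : ℝ≥0 → Ω → ℝ}
  {lam v₀ σbar I₀ : ℝ} {N n : ℕ}

/-- The linear equation with leverage `1`, for which the interest rate drops out. -/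
lemma IsMarket.stock_eq [IsProbabilityMeasure P]
    (h : IsMarket 𝓕 W P T r ρ σ σlow U J S) {s t : ℝ≥0} (hst : s ≤ t)
    (htT : t ≤ T) :
    ∀ᵐ ω ∂P, S t ω = S s ω * Real.exp (logGrowth r ρ σ J (fun _ => 1) s t ω) := by
  refine h.stock.sde.ae_eq_mul_exp h.brownian h.rate h.drift h.vol h.wiener hst htT
    measurable_const (ae_of_all _ fun ω => ?_) (ae_of_all _ fun ω => ?_)
  all_goals
    filter_upwards [ae_restrict_mem measurableSet_Ioc] with u hu
    rw [Real.coe_toNNReal u (s.coe_nonneg.trans hu.1.le)]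
    ring

lemma IsMarket.stock_pos [IsProbabilityMeasure P]
    (h : IsMarket 𝓕 W P T r ρ σ σlow U J S) {t : ℝ≥0} (htT : t ≤ T) :
    ∀ᵐ ω ∂P, 0 < S t ω := by
  filter_upwards [h.stock_eq zero_le htT, h.stock.pos_zero] with ω h1 h2
  rw [h1]
  exact mul_pos h2 (Real.exp_pos _)

/-- Needed to cancel `S` in the coefficients `I / S * (σ S)` of the index equation. Positivity is
known almost surely at each fixed time and must be turned, by Fubini, into a statement for almost
every time on almost every path. Joint measurability is available for `σ S` only, so the exchange is
carried out for a measurable version of that product, which is nonzero because `σ > σlow`. -/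
lemma IsMarket.ae_ae_stock_ne_zero [IsProbabilityMeasure P]
    (h : IsMarket 𝓕 W P T r ρ σ σlow U J S) :
    ∀ᵐ ω ∂P, ∀ᵐ t ∂(volume.restrict (Set.Icc (0 : ℝ) T)), S t.toNNReal ω ≠ 0 := by
  have hm := h.stock.sde.isItoIntegral.aestronglyMeasurable
  have h1 : ∀ᵐ t ∂(volume.restrict (Set.Icc (0 : ℝ) T)), ∀ᵐ ω ∂P, hm.mk _ (t, ω) ≠ 0 := by
    filter_upwards [Measure.ae_ae_of_ae_prod hm.ae_eq_mk, h.low_lt,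
      ae_restrict_mem measurableSet_Icc] with t h1 h2 h3
    have htT : t.toNNReal ≤ T := Real.toNNReal_le_iff_le_coe.2 h3.2
    filter_upwards [h1, h.stock_pos htT] with ω h4 h5
    rw [← h4]
    simp only [Real.coe_toNNReal t h3.1]
    exact mul_ne_zero (h.low_pos.trans h2).ne' h5.ne'
  have hms : MeasurableSet {p : ℝ × Ω | hm.mk _ p ≠ 0} :=
    (hm.stronglyMeasurable_mk.measurable (measurableSet_singleton 0)).compl
  have h2 : ∀ᵐ p ∂((volume.restrict (Set.Icc (0 : ℝ) T)).prod P), hm.mk _ p ≠ 0 :=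
    (Measure.ae_prod_iff_ae_ae hms).2 h1
  have h3 : ∀ᵐ p ∂((volume.restrict (Set.Icc (0 : ℝ) T)).prod P), S p.1.toNNReal p.2 ≠ 0 := by
    filter_upwards [h2, hm.ae_eq_mk] with p hp1 hp2 h0
    rw [← hp2, h0, mul_zero] at hp1
    exact hp1 rfl
  have h4 : ∀ᵐ q ∂(P.prod (volume.restrict (Set.Icc (0 : ℝ) T))), S q.2.toNNReal q.1 ≠ 0 := by
    rw [← Measure.prod_swap] at h3
    exact ae_of_ae_map measurable_swap.aemeasurable h3
  exact Measure.ae_ae_of_ae_prod h4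

lemma pow_mul_le_realisedVariance (hlam : lam ∈ Set.Ioo (0 : ℝ) 1) (N n : ℕ) (ω : Ω) :
    lam ^ n * v₀ ≤ realisedVariance T lam v₀ S N n ω := by
  induction n with
  | zero => simp [realisedVariance]
  | succ n ih =>
    have h1 := mul_le_mul_of_nonneg_left ih hlam.1.le
    have h2 : 0 ≤ (1 - lam) / (window T N : ℝ) * simpleReturn T S N n ω ^ 2 :=
      mul_nonneg (div_nonneg (by linarith [hlam.2]) (NNReal.coe_nonneg _)) (sq_nonneg _)
    simp only [realisedVariance]
    rw [pow_succ]
    linarith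

lemma realisedVariance_pos (hlam : lam ∈ Set.Ioo (0 : ℝ) 1) (hv₀ : 0 < v₀) (N n : ℕ) (ω : Ω) :
    0 < realisedVariance T lam v₀ S N n ω :=
  (mul_pos (pow_pos hlam.1 n) hv₀).trans_le (pow_mul_le_realisedVariance hlam N n ω)

lemma IsMarket.measurable_simpleReturn (h : IsMarket 𝓕 W P T r ρ σ σlow U J S) (hN : 1 ≤ N)
    (hn : n < N) : Measurable[𝓕 (obsTime T N (n + 1))] (simpleReturn T S N n) := by
  have h1 := h.stock.sde.adapted _ (obsTime_le (T := T) hN (Nat.succ_le_of_lt hn))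
  have h2 := (h.stock.sde.adapted _ (obsTime_le (T := T) hN hn.le)).mono
    (𝓕.mono (obsTime_mono T N (Nat.le_succ n))) le_rfl
  exact (h1.div h2).sub_const 1

lemma IsMarket.measurable_realisedVariance (h : IsMarket 𝓕 W P T r ρ σ σlow U J S) (hN : 1 ≤ N)
    (hn : n ≤ N) : Measurable[𝓕 (obsTime T N n)] (realisedVariance T lam v₀ S N n) := by
  induction n with
  | zero => exact measurable_const
  | succ n ih =>
    have h1 := (ih (by omega)).mono (𝓕.mono (obsTime_mono T N (Nat.le_succ n))) le_rfl
    exact (h1.const_mul lam).add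
      (((h.measurable_simpleReturn hN (by omega)).pow_const 2).const_mul _)

lemma IsMarket.measurable_leverage (h : IsMarket 𝓕 W P T r ρ σ σlow U J S) (hN : 1 ≤ N)
    (hn : n ≤ N) : Measurable[𝓕 (obsTime T N n)] (leverage T lam v₀ σbar S N n) :=
  (Real.continuous_sqrt.measurable.comp (h.measurable_realisedVariance hN hn)).const_div σbar

/-- Within a window the leverage in force is constant and known at the left end, so the explicit
solution applies once `S` has been cancelled. -/
lemma IsMarket.index_step [IsProbabilityMeasure P]
    (h : IsMarket 𝓕 W P T r ρ σ σlow U J S) {I : ℝ≥0 → Ω → ℝ}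
    (hI : IsContinuousIndex 𝓕 W P T lam v₀ σbar I₀ r ρ σ S N I) (hN : 1 ≤ N) (hn : n < N) :
    ∀ᵐ ω ∂P, I (obsTime T N (n + 1)) ω = I (obsTime T N n) ω *
      Real.exp (logGrowth r ρ σ J (leverage T lam v₀ σbar S N n) (obsTime T N n)
        (obsTime T N (n + 1)) ω) := by
  have hle : obsTime T N (n + 1) ≤ T := obsTime_le hN hn
  have hgood : ∀ᵐ ω ∂P, ∀ᵐ s ∂(volume.restrict
      (Set.Ioc (obsTime T N n : ℝ) (obsTime T N (n + 1)))), S s.toNNReal ω ≠ 0 ∧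
      leverageAt T lam v₀ σbar S N s.toNNReal ω = leverage T lam v₀ σbar S N n ω ∧
      (s.toNNReal : ℝ) = s := by
    filter_upwards [h.ae_ae_stock_ne_zero] with ω hω
    -- At the right end the floor already points to the next window; this is a single time and thus
    -- negligible.
    have hne : ∀ᵐ s ∂(volume.restrict (Set.Ioc (obsTime T N n : ℝ) (obsTime T N (n + 1)))),
        s ≠ (obsTime T N (n + 1) : ℝ) := ae_restrict_of_ae (Measure.ae_ne volume _)
    filter_upwards [ae_mono (Measure.restrict_mono (Ioc_subset_Icc_of_le hle) le_rfl) hω,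
      ae_restrict_mem measurableSet_Ioc, hne] with s h1 h2 h3
    have hs := Real.coe_toNNReal s ((NNReal.coe_nonneg _).trans h2.1.le)
    refine ⟨h1, ?_, hs⟩
    unfold leverageAt
    rw [floor_div_window h.horizon_pos hN (n := n)]
    · rw [← NNReal.coe_le_coe, hs]
      exact h2.1.le
    · rw [← NNReal.coe_lt_coe, hs]
      exact lt_of_le_of_ne h2.2 h3
  refine hI.sde.ae_eq_mul_exp h.brownian h.rate h.drift h.vol h.wiener
    (obsTime_mono T N (Nat.le_succ n)) hle (h.measurable_leverage hN hn.le) ?_ ?_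
  all_goals
    filter_upwards [hgood] with ω hω
    filter_upwards [hω] with s ⟨h1, h2, h3⟩
    rw [h2, h3]
    field_simp

lemma IsMarket.index_eq [IsProbabilityMeasure P]
    (h : IsMarket 𝓕 W P T r ρ σ σlow U J S) {I : ℝ≥0 → Ω → ℝ}
    (hI : IsContinuousIndex 𝓕 W P T lam v₀ σbar I₀ r ρ σ S N I) (hN : 1 ≤ N) :
    ∀ᵐ ω ∂P, I T ω = I₀ * Real.exp (∑ k ∈ Finset.range N,
      logGrowth r ρ σ J (leverage T lam v₀ σbar S N k) (obsTime T N k) (obsTime T N (k + 1)) ω) := by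
  have h1 : ∀ᵐ ω ∂P, ∀ n < N, I (obsTime T N (n + 1)) ω = I (obsTime T N n) ω *
      Real.exp (logGrowth r ρ σ J (leverage T lam v₀ σbar S N n) (obsTime T N n)
        (obsTime T N (n + 1)) ω) := by
    rw [ae_all_iff]
    intro n
    by_cases hn : n < N
    · filter_upwards [h.index_step hI hN hn] with ω h _ using h
    · exact ae_of_all _ fun ω h => absurd h hn
  filter_upwards [h1, hI.initial] with ω h1 h0
  have h2 : ∀ n ≤ N, I (obsTime T N n) ω = I₀ * Real.exp (∑ k ∈ Finset.range n,
      logGrowth r ρ σ J (leverage T lam v₀ σbar S N k) (obsTime T N k) (obsTime T N (k + 1)) ω) := by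
    intro n hn
    induction n with
    | zero => simp [h0]
    | succ n ih =>
      rw [h1 n (by omega), ih (by omega), Finset.sum_range_succ, Real.exp_add, mul_assoc]
  have := h2 N le_rfl
  rwa [obsTime_last hN] at this

lemma IsMarket.simpleReturn_eq [IsProbabilityMeasure P]
    (h : IsMarket 𝓕 W P T r ρ σ σlow U J S) (hN : 1 ≤ N) :
    ∀ᵐ ω ∂P, ∀ n < N, simpleReturn T S N n ω =
      Real.exp (logGrowth r ρ σ J (fun _ => 1) (obsTime T N n) (obsTime T N (n + 1)) ω) - 1 := by
  rw [ae_all_iff]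
  intro n
  by_cases hn : n < N
  · filter_upwards [h.stock_eq (obsTime_mono T N (Nat.le_succ n)) (obsTime_le hN hn),
      h.stock_pos (obsTime_le hN hn.le)] with ω h1 h2 _
    rw [simpleReturn, h1, mul_div_cancel_left₀ _ h2.ne']
  · exact ae_of_all _ fun ω h => absurd h hn

lemma discreteIndex_eq (hT : 0 < T) (hN : 1 ≤ N) (ω : Ω) :
    discreteIndex T lam v₀ σbar I₀ r S N T ω = I₀ * ∏ k ∈ Finset.range N,
      (1 + (1 - leverage T lam v₀ σbar S N k ω)
          * (∫ t in (obsTime T N k : ℝ)..(obsTime T N (k + 1)), r t)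
        + leverage T lam v₀ σbar S N k ω * simpleReturn T S N k ω) := by
  unfold discreteIndex
  rw [floor_last_div_window hT hN]
  have : ∀ n, discreteIndexAt T lam v₀ σbar I₀ r S N n ω = I₀ * ∏ k ∈ Finset.range n,
      (1 + (1 - leverage T lam v₀ σbar S N k ω)
          * (∫ t in (obsTime T N k : ℝ)..(obsTime T N (k + 1)), r t)
        + leverage T lam v₀ σbar S N k ω * simpleReturn T S N k ω) := by
    intro n
    induction n with
    | zero => simp [discreteIndexAt]
    | succ n ih => rw [Finset.prod_range_succ, ← mul_assoc, ← ih, discreteIndexAt]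
  exact this N

end Market

end

/-! ### Negative moments of the realised variance. -/

section

variable {Ω : Type*} {mΩ : MeasurableSpace Ω} {P : Measure Ω}
  {𝓕 : Filtration ℝ≥0 mΩ} {W : ℝ≥0 → Ω → ℝ}

/-- The Gaussian density is at most `1 / √(2πv) ≤ 1 / √v`. -/
lemma gaussianReal_Icc_le {v : ℝ≥0} (hv : v ≠ 0) (x y : ℝ) :
    gaussianReal 0 v (Set.Icc x y) ≤ ENNReal.ofReal ((y - x) / √v) := by
  have hv0 : (0 : ℝ) < v := by exact_mod_cast pos_iff_ne_zero.2 hv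
  rw [gaussianReal_apply 0 hv]
  calc _ ≤ ∫⁻ _ in Set.Icc x y, ENNReal.ofReal (√v)⁻¹ := by
        refine lintegral_mono fun z => ENNReal.ofReal_le_ofReal ?_
        unfold gaussianPDFReal
        have h1 : (√(2 * Real.pi * v))⁻¹ ≤ (√v)⁻¹ := by
          refine inv_anti₀ (Real.sqrt_pos.2 hv0) (Real.sqrt_le_sqrt ?_)
          have : 1 ≤ 2 * Real.pi := by linarith [Real.pi_gt_three]
          exact le_mul_of_one_le_left hv0.le this
        have h2 : Real.exp (-(z - 0) ^ 2 / (2 * v)) ≤ 1 :=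
          Real.exp_le_one_iff.2 (div_nonpos_of_nonpos_of_nonneg
            (neg_nonpos.2 (sq_nonneg _)) (by positivity))
        calc _ ≤ (√v)⁻¹ * 1 := mul_le_mul h1 h2 (Real.exp_pos _).le (by positivity)
          _ = _ := mul_one _
    _ = _ := by
        rw [lintegral_const, Measure.restrict_apply_univ, Real.volume_Icc,
          ← ENNReal.ofReal_mul (by positivity), mul_comm, div_eq_mul_inv]

lemma abs_le_of_abs_exp_sub_one_le {y c : ℝ} (hc : c ≤ 1 / 2) (h : |Real.exp y - 1| ≤ c) :
    |y| ≤ 2 * c := by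
  have hc0 : 0 ≤ c := (abs_nonneg _).trans h
  obtain ⟨h1, h2⟩ := abs_le.1 h
  have h3 := Real.add_one_le_exp y
  have h4 := Real.add_one_le_exp (-y)
  have h5 : Real.exp (-y) ≤ 1 + 2 * c := by
    rw [Real.exp_neg, inv_le_comm₀ (Real.exp_pos y) (by linarith)]
    refine le_trans ?_ (by linarith : 1 - c ≤ Real.exp y)
    rw [inv_le_comm₀ (by linarith) (by linarith), inv_eq_one_div, div_le_iff₀ (by linarith)]
    nlinarith
  exact abs_le.2 ⟨by linarith, by linarith⟩

section Market

variable {T : ℝ≥0} {r ρ σ : ℝ → ℝ} {σlow : ℝ} {U : ℕ → SimpleProcess 𝓕} {J S : ℝ≥0 → Ω → ℝ}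
  {lam v₀ σbar I₀ : ℝ} {N n : ℕ}

lemma IsMarket.sq_mul_le_integral (h : IsMarket 𝓕 W P T r ρ σ σlow U J S) {s t : ℝ≥0} (hst : s ≤ t)
    (htT : t ≤ T) : σlow ^ 2 * (t - s) ≤ ∫ y in (s : ℝ)..t, σ y ^ 2 := by
  have hst' : (s : ℝ) ≤ t := by exact_mod_cast hst
  have h1 : ∫ y in (s : ℝ)..t, σlow ^ 2 ≤ ∫ y in (s : ℝ)..t, σ y ^ 2 := by
    refine intervalIntegral.integral_mono_ae_restrict hst' (by simp)
      (intervalIntegrable_of_memLp (memLp_sq h.vol) hst htT) ?_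
    have h2 : ∀ᵐ y ∂(volume.restrict (Set.Ioc (s : ℝ) t)), σlow ^ 2 ≤ σ y ^ 2 := by
      filter_upwards [ae_mono (Measure.restrict_mono (Ioc_subset_Icc_of_le htT) le_rfl) h.low_lt]
        with y hy
      exact pow_le_pow_left₀ h.low_pos.le hy.le 2
    rwa [← restrict_Ioc_eq_restrict_Icc]
  rw [intervalIntegral.integral_const, smul_eq_mul] at h1
  linarith

/-- A conditional small ball estimate. The log return is a constant plus a Gaussian increment
independent of the past, with variance at least `σlow² T / N`; a return below `c ≤ 1/2` confines the
increment to an interval of length `4 c`. For `c > 1/2` the summand `2` in the constant makes the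
bound trivial. -/
lemma IsMarket.measure_inter_return_le [IsProbabilityMeasure P]
    (h : IsMarket 𝓕 W P T r ρ σ σlow U J S) (hN : 1 ≤ N)
    (hn : n < N) {c : ℝ} (hc : 0 ≤ c) {E : Set Ω} (hE : MeasurableSet[𝓕 (obsTime T N n)] E) :
    P (E ∩ {ω | |simpleReturn T S N n ω| ≤ c}) ≤
      P E * ENNReal.ofReal (c * (2 + 4 / (σlow * √(T / N)))) := by
  have hΔ : 0 < (T : ℝ) / N := by
    have : (0 : ℝ) < T := by exact_mod_cast h.horizon_pos
    have : (0 : ℝ) < N := by exact_mod_cast hN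
    positivity
  have hlow := h.low_pos
  rcases le_or_gt c (1 / 2) with hc2 | hc2
  · set s := obsTime T N n
    set t := obsTime T N (n + 1)
    have hst : s ≤ t := obsTime_mono T N (Nat.le_succ n)
    have htT : t ≤ T := obsTime_le hN hn
    set μ : ℝ := (∫ y in (s : ℝ)..t, ρ y) - 1 / 2 * ∫ y in (s : ℝ)..t, σ y ^ 2
    set v : ℝ := ∫ y in (s : ℝ)..t, σ y ^ 2
    have hv : σlow ^ 2 * (T / N) ≤ v := by
      have := h.sq_mul_le_integral hst htT
      rwa [obsTime_succ_sub] at this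
    have hv0 : 0 < v := lt_of_lt_of_le (by positivity) hv
    have hg := h.wiener.hasLaw s t hst htT
    set A : Set Ω := (fun ω => J t ω - J s ω) ⁻¹' Set.Icc (-μ - 2 * c) (-μ + 2 * c)
    have hsub : (E ∩ {ω | |simpleReturn T S N n ω| ≤ c} : Set Ω) ≤ᵐ[P] (E ∩ A : Set Ω) := by
      filter_upwards [h.simpleReturn_eq hN] with ω hω hmem
      refine ⟨hmem.1, ?_⟩
      have h1 : |simpleReturn T S N n ω| ≤ c := hmem.2
      rw [hω n hn] at h1
      have h2 := abs_le.1 (abs_le_of_abs_exp_sub_one_le hc2 h1)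
      have h3 : logGrowth r ρ σ J (fun _ => 1) s t ω = μ + (J t ω - J s ω) := by
        simp only [logGrowth, μ]
        ring
      rw [h3] at h2
      exact ⟨by linarith [h2.1], by linarith [h2.2]⟩
    have hA : MeasurableSet[MeasurableSpace.comap (fun ω => J t ω - J s ω) inferInstance] A :=
      ⟨_, measurableSet_Icc, rfl⟩
    have hPA : P A ≤ ENNReal.ofReal (c * (2 + 4 / (σlow * √(T / N)))) := by
      rw [← Measure.map_apply_of_aemeasurable hg.aemeasurable measurableSet_Icc, hg.map_eq]
      refine (gaussianReal_Icc_le (Real.toNNReal_pos.2 hv0).ne' _ _).trans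
        (ENNReal.ofReal_le_ofReal ?_)
      rw [Real.coe_toNNReal _ hv0.le]
      have h4 : σlow * √(T / N) ≤ √v := by
        refine Real.le_sqrt_of_sq_le ?_
        rwa [mul_pow, Real.sq_sqrt hΔ.le]
      have h5 : 0 < σlow * √(T / N) := by positivity
      calc (-μ + 2 * c - (-μ - 2 * c)) / √v = 4 * c / √v := by ring
        _ ≤ 4 * c / (σlow * √(T / N)) := by gcongr
        _ = c * (4 / (σlow * √(T / N))) := by ring
        _ ≤ _ := by
          refine mul_le_mul_of_nonneg_left ?_ hc
          linarith
    calc _ ≤ P (E ∩ A) := measure_mono_ae hsub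
      _ = P E * P A := by
        rw [Set.inter_comm, (Indep_iff _ _ _).1 (h.wiener.indep s t hst htT) A E hA hE, mul_comm]
      _ ≤ _ := by gcongr
  · refine (measure_mono Set.inter_subset_left).trans (le_mul_of_one_le_right zero_le ?_)
    rw [ENNReal.one_le_ofReal]
    have : 0 ≤ c * (4 / (σlow * √(T / N))) := by positivity
    linarith

lemma IsMarket.measure_returns_le [IsProbabilityMeasure P]
    (h : IsMarket 𝓕 W P T r ρ σ σlow U J S) (hN : 1 ≤ N) {c : ℝ} (hc : 0 ≤ c) (m : ℕ)
    (hn : n + m ≤ N) :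
    MeasurableSet[𝓕 (obsTime T N (n + m))] {ω | ∀ i < m, |simpleReturn T S N (n + i) ω| ≤ c} ∧
    P {ω | ∀ i < m, |simpleReturn T S N (n + i) ω| ≤ c} ≤
      ENNReal.ofReal (c * (2 + 4 / (σlow * √(T / N)))) ^ m := by
  induction m with
  | zero => exact ⟨by simp, by simp⟩
  | succ m ih =>
    obtain ⟨h1, h2⟩ := ih (by omega)
    have heq : {ω | ∀ i < m + 1, |simpleReturn T S N (n + i) ω| ≤ c}
        = {ω | ∀ i < m, |simpleReturn T S N (n + i) ω| ≤ c}
          ∩ {ω | |simpleReturn T S N (n + m) ω| ≤ c} := by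
      ext ω
      simp only [Nat.forall_lt_succ_right, Set.mem_inter_iff, Set.mem_ofPred_eq]
    rw [heq]
    have hn' : n + m < N := by omega
    constructor
    · refine (𝓕.mono (obsTime_mono T N (by omega : n + m ≤ n + (m + 1))) _ h1).inter ?_
      exact (h.measurable_simpleReturn hN hn')
        (isClosed_le continuous_abs continuous_const).measurableSet
    · refine (h.measure_inter_return_le hN hn' hc h1).trans ?_
      rw [pow_succ]
      gcongr

/-- A squared return stays in the realised variance forever, discounted by `lam` at each step. -/
lemma mul_sq_simpleReturn_le (hlam : lam ∈ Set.Ioo (0 : ℝ) 1) (hv₀ : 0 < v₀) (N n j : ℕ) (ω : Ω) :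
    lam ^ j * ((1 - lam) / (window T N : ℝ) * simpleReturn T S N n ω ^ 2)
      ≤ realisedVariance T lam v₀ S N (n + 1 + j) ω := by
  induction j with
  | zero =>
    have := (realisedVariance_pos (T := T) (S := S) hlam hv₀ N n ω).le
    simp only [realisedVariance, pow_zero, one_mul]
    have := mul_nonneg hlam.1.le this
    linarith
  | succ j ih =>
    have h1 := mul_le_mul_of_nonneg_left ih hlam.1.le
    have h2 : 0 ≤ (1 - lam) / (window T N : ℝ) * simpleReturn T S N (n + 1 + j) ω ^ 2 :=
      mul_nonneg (div_nonneg (by linarith [hlam.2]) (NNReal.coe_nonneg _)) (sq_nonneg _)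
    rw [← add_assoc, realisedVariance, pow_succ]
    linarith

/-- A small realised variance forces its last five returns to be small. By successive conditioning
the probabilities multiply, which gives the fifth power. -/
lemma IsMarket.measure_realisedVariance_le [IsProbabilityMeasure P]
    (h : IsMarket 𝓕 W P T r ρ σ σlow U J S) (hN : 1 ≤ N) (hlam : lam ∈ Set.Ioo (0 : ℝ) 1)
    (hv₀ : 0 < v₀) (hn : n + 5 ≤ N) (j : ℕ) :
    P {ω | realisedVariance T lam v₀ S N (n + 5) ω ≤ (1 / 4 : ℝ) ^ j} ≤
      ENNReal.ofReal ((1 / 2 : ℝ) ^ j *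
        ((√((1 - lam) * lam ^ 4))⁻¹ * (2 * √T + 4 / σlow))) ^ 5 := by
  have hT : (0 : ℝ) < T := by exact_mod_cast h.horizon_pos
  have hN0 : (1 : ℝ) ≤ N := by exact_mod_cast hN
  have hΔ : 0 < (T : ℝ) / N := by positivity
  have hl0 := hlam.1
  have hl1 : 0 < 1 - lam := by linarith [hlam.2]
  have hlow := h.low_pos
  set q : ℝ := (1 - lam) * lam ^ 4 with hq
  have hq0 : 0 < q := by positivity
  -- The largest size of a return compatible with `q * return² / Δt ≤ 4 ^ (-j)`. Its factor `√Δt`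
  -- cancels the one in the small ball constant, so the bound is uniform in `N`.
  set c : ℝ := (1 / 2 : ℝ) ^ j * (√q)⁻¹ * √(T / N) with hcdef
  have hc0 : 0 ≤ c := by positivity
  have hc2 : c ^ 2 = (1 / 4 : ℝ) ^ j * q⁻¹ * (T / N) := by
    rw [hcdef, mul_pow, mul_pow, Real.sq_sqrt hΔ.le, inv_pow, Real.sq_sqrt hq0.le, ← pow_mul,
      mul_comm j 2, pow_mul]
    norm_num
  have hw : (window T N : ℝ) = T / N := by simp [window]
  have hsub : {ω | realisedVariance T lam v₀ S N (n + 5) ω ≤ (1 / 4 : ℝ) ^ j} ⊆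
      {ω | ∀ i < 5, |simpleReturn T S N (n + i) ω| ≤ c} := by
    intro ω hω i hi
    have h1 := mul_sq_simpleReturn_le (T := T) (S := S) hlam hv₀ N (n + i) (4 - i) ω
    rw [show n + i + 1 + (4 - i) = n + 5 by omega] at h1
    have h2 : lam ^ 4 ≤ lam ^ (4 - i) :=
      pow_le_pow_of_le_one hl0.le hlam.2.le (by omega)
    have h3 : lam ^ 4 * ((1 - lam) / (window T N : ℝ) * simpleReturn T S N (n + i) ω ^ 2)
        ≤ (1 / 4 : ℝ) ^ j := by
      refine (mul_le_mul_of_nonneg_right h2 ?_).trans (h1.trans hω)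
      rw [hw]
      positivity
    refine abs_le_of_sq_le_sq ?_ hc0
    rw [hc2]
    rw [hw] at h3
    have h4 : lam ^ 4 * ((1 - lam) / (T / N : ℝ) * simpleReturn T S N (n + i) ω ^ 2)
        = simpleReturn T S N (n + i) ω ^ 2 * (q / (T / N)) := by rw [hq]; ring
    rw [h4, ← le_div_iff₀ (by positivity)] at h3
    refine h3.trans_eq ?_
    field_simp
  refine (measure_mono hsub).trans ((h.measure_returns_le hN hc0 5 hn).2.trans ?_)
  refine pow_le_pow_left' (ENNReal.ofReal_le_ofReal ?_) 5
  have hsq : 0 < √((T : ℝ) / N) := Real.sqrt_pos.2 hΔ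
  have h6 : √((T : ℝ) / N) ≤ √T := Real.sqrt_le_sqrt (div_le_self hT.le hN0)
  calc c * (2 + 4 / (σlow * √(T / N)))
      = (1 / 2 : ℝ) ^ j * ((√q)⁻¹ * (2 * √(T / N) + 4 / σlow)) := by
        rw [hcdef]
        field_simp
    _ ≤ _ := by gcongr

/-- If `4 ^ (-(j+1)) < v ≤ 4 ^ (-j)`, the `j`-th term alone dominates `v⁻²`; for `v > 1` the summand
`1` does. -/
lemma inv_sq_le_tsum {v : ℝ} (hv : 0 < v) :
    ENNReal.ofReal ((v⁻¹) ^ 2) ≤ 1 + ∑' j : ℕ, ENNReal.ofReal (16 ^ (j + 1)) *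
      (Set.Iic ((1 / 4 : ℝ) ^ j)).indicator 1 v := by
  rcases le_or_gt v 1 with h1 | h1
  · obtain ⟨j, hj1, hj2⟩ := exists_nat_pow_near_of_lt_one hv h1 (by norm_num : (0 : ℝ) < 1 / 4)
      (by norm_num)
    refine le_trans ?_ (le_add_left (ENNReal.le_tsum j))
    rw [Set.indicator_of_mem (Set.mem_Iic.2 hj2), Pi.one_apply, mul_one]
    refine ENNReal.ofReal_le_ofReal ?_
    have h2 : v⁻¹ ≤ 4 ^ (j + 1) := by
      rw [inv_le_comm₀ hv (by positivity), ← inv_pow]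
      simpa using hj1.le
    calc (v⁻¹) ^ 2 ≤ (4 ^ (j + 1)) ^ 2 := pow_le_pow_left₀ (by positivity) h2 2
      _ = 16 ^ (j + 1) := by rw [← pow_mul, mul_comm, pow_mul]; norm_num
  · refine le_trans ?_ le_self_add
    rw [ENNReal.ofReal_le_one]
    exact pow_le_one₀ (by positivity) (inv_le_one_of_one_le₀ h1.le)

/-- The realised variances have uniformly bounded negative second moments. -/
lemma IsMarket.exists_lintegral_inv_sq_le [IsProbabilityMeasure P]
    (h : IsMarket 𝓕 W P T r ρ σ σlow U J S) (hlam : lam ∈ Set.Ioo (0 : ℝ) 1) (hv₀ : 0 < v₀) :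
    ∃ C : ℝ≥0∞, C ≠ ∞ ∧ ∀ N, 1 ≤ N → ∀ n ≤ N,
      ∫⁻ ω, ENNReal.ofReal ((realisedVariance T lam v₀ S N n ω)⁻¹ ^ 2) ∂P ≤ C := by
  set κ : ℝ := (√((1 - lam) * lam ^ 4))⁻¹ * (2 * √T + 4 / σlow)
  have hlow := h.low_pos
  have hκ0 : 0 ≤ κ := by positivity
  have hfin : ∑' j : ℕ, ENNReal.ofReal (16 * κ ^ 5 * (1 / 2) ^ j) ≠ ∞ :=
    ((summable_geometric_of_lt_one (by norm_num)
      (by norm_num : (1 / 2 : ℝ) < 1)).mul_left _).tsum_ofReal_ne_top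
  refine ⟨ENNReal.ofReal ((lam ^ 5 * v₀)⁻¹ ^ 2)
    + (1 + ∑' j : ℕ, ENNReal.ofReal (16 * κ ^ 5 * (1 / 2) ^ j)), ?_, fun N hN n hn => ?_⟩
  · exact ENNReal.add_ne_top.2 ⟨ENNReal.ofReal_ne_top, ENNReal.add_ne_top.2 ⟨by simp, hfin⟩⟩
  -- With fewer than five returns available, the initial value still contributes at least `lam ^ 5 *
  -- v₀`.
  rcases lt_or_ge n 5 with h5 | h5
  · refine le_trans ?_ le_self_add
    calc _ ≤ ∫⁻ _, ENNReal.ofReal ((lam ^ 5 * v₀)⁻¹ ^ 2) ∂P := by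
          refine lintegral_mono fun ω => ENNReal.ofReal_le_ofReal ?_
          have h0 : 0 < lam ^ 5 * v₀ := mul_pos (pow_pos hlam.1 5) hv₀
          have h1 : lam ^ 5 * v₀ ≤ realisedVariance T lam v₀ S N n ω :=
            le_trans (mul_le_mul_of_nonneg_right
              (pow_le_pow_of_le_one hlam.1.le hlam.2.le h5.le) hv₀.le)
              (pow_mul_le_realisedVariance hlam N n ω)
          exact pow_le_pow_left₀ (inv_nonneg.2 (h0.le.trans h1)) (inv_anti₀ h0 h1) 2
      _ = _ := by simp
  · obtain ⟨k, rfl⟩ := Nat.exists_eq_add_of_le' h5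
    refine le_trans ?_ le_add_self
    have hvm : Measurable (realisedVariance T lam v₀ S N (k + 5)) :=
      (h.measurable_realisedVariance hN hn).mono (𝓕.le _) le_rfl
    have him : ∀ j : ℕ, Measurable fun ω => (Set.Iic ((1 / 4 : ℝ) ^ j)).indicator
        (1 : ℝ → ℝ≥0∞) (realisedVariance T lam v₀ S N (k + 5) ω) := fun j =>
      (measurable_one.indicator measurableSet_Iic).comp hvm
    calc _ ≤ ∫⁻ ω, (1 + ∑' j : ℕ, ENNReal.ofReal (16 ^ (j + 1)) *
          (Set.Iic ((1 / 4 : ℝ) ^ j)).indicator 1 (realisedVariance T lam v₀ S N (k + 5) ω)) ∂P :=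
          lintegral_mono fun ω => inv_sq_le_tsum (realisedVariance_pos hlam hv₀ N _ ω)
      _ = 1 + ∑' j : ℕ, ENNReal.ofReal (16 ^ (j + 1)) *
          P {ω | realisedVariance T lam v₀ S N (k + 5) ω ≤ (1 / 4 : ℝ) ^ j} := by
          rw [lintegral_add_left measurable_const, lintegral_tsum
            fun j => ((him j).const_mul _).aemeasurable]
          congr 1
          · simp
          · refine tsum_congr fun j => ?_
            rw [lintegral_const_mul _ (him j)]
            congr 1
            rw [← lintegral_indicator_one (measurableSet_le hvm measurable_const)]
            rfl
      _ ≤ _ := by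
          refine add_le_add le_rfl (ENNReal.tsum_le_tsum fun j => ?_)
          refine (mul_le_mul_right (h.measure_realisedVariance_le hN hlam hv₀ hn j) _).trans ?_
          rw [← ENNReal.ofReal_pow (by positivity), ← ENNReal.ofReal_mul (by positivity)]
          refine ENNReal.ofReal_le_ofReal (le_of_eq ?_)
          -- Here the number five matters: four returns would give `16 ^ j * 16 ^ (-j)` and a
          -- divergent series.
          have h16 : (16 : ℝ) ^ j * (1 / 2) ^ (j * 5) = (1 / 2) ^ j := by
            rw [mul_comm j 5, pow_mul, ← mul_pow]
            norm_num
          rw [mul_pow, ← pow_mul, pow_succ]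
          linear_combination (16 * κ ^ 5) * h16

/-- The leverages have uniformly bounded fourth moments. -/
lemma IsMarket.exists_lintegral_leverage_le [IsProbabilityMeasure P]
    (h : IsMarket 𝓕 W P T r ρ σ σlow U J S) (hlam : lam ∈ Set.Ioo (0 : ℝ) 1) (hv₀ : 0 < v₀)
    (σbar : ℝ) :
    ∃ C : ℝ, 0 ≤ C ∧ ∀ N, 1 ≤ N → ∀ n ≤ N,
      ∫⁻ ω, ENNReal.ofReal ((1 + |leverage T lam v₀ σbar S N n ω|) ^ 4) ∂P
        ≤ ENNReal.ofReal C := by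
  obtain ⟨C, hC, hb⟩ := h.exists_lintegral_inv_sq_le hlam hv₀
  have hfin : 8 + ENNReal.ofReal (8 * σbar ^ 4) * C ≠ ∞ :=
    ENNReal.add_ne_top.2 ⟨by simp, ENNReal.mul_ne_top ENNReal.ofReal_ne_top hC⟩
  refine ⟨(8 + ENNReal.ofReal (8 * σbar ^ 4) * C).toReal, ENNReal.toReal_nonneg,
    fun N hN n hn => ?_⟩
  rw [ENNReal.ofReal_toReal hfin]
  have hvm : Measurable (realisedVariance T lam v₀ S N n) :=
    (h.measurable_realisedVariance hN hn).mono (𝓕.le _) le_rfl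
  calc _ ≤ ∫⁻ ω, (8 + ENNReal.ofReal (8 * σbar ^ 4) *
        ENNReal.ofReal ((realisedVariance T lam v₀ S N n ω)⁻¹ ^ 2)) ∂P := by
        refine lintegral_mono fun ω => ?_
        have hv := realisedVariance_pos (T := T) (S := S) hlam hv₀ N n ω
        have hw4 : |leverage T lam v₀ σbar S N n ω| ^ 4
            = σbar ^ 4 * (realisedVariance T lam v₀ S N n ω)⁻¹ ^ 2 := by
          rw [Even.pow_abs (by decide), leverage, div_pow, div_eq_mul_inv, inv_pow,
            show (√(realisedVariance T lam v₀ S N n ω)) ^ 4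
              = ((√(realisedVariance T lam v₀ S N n ω)) ^ 2) ^ 2 by ring, Real.sq_sqrt hv.le]
        rw [← ENNReal.ofReal_mul (by positivity), show (8 : ℝ≥0∞) = ENNReal.ofReal 8 by simp,
          ← ENNReal.ofReal_add (by norm_num) (by positivity)]
        refine ENNReal.ofReal_le_ofReal ?_
        have := add_pow_le (zero_le_one (α := ℝ)) (abs_nonneg (leverage T lam v₀ σbar S N n ω)) 4
        rw [hw4] at this
        refine this.trans_eq ?_
        norm_num
        ring
    _ = 8 + ENNReal.ofReal (8 * σbar ^ 4) *
        ∫⁻ ω, ENNReal.ofReal ((realisedVariance T lam v₀ S N n ω)⁻¹ ^ 2) ∂P := by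
        have him : Measurable fun ω =>
            ENNReal.ofReal ((realisedVariance T lam v₀ S N n ω)⁻¹ ^ 2) :=
          (hvm.inv.pow_const 2).ennreal_ofReal
        rw [lintegral_add_left measurable_const, lintegral_const_mul _ him]
        simp
    _ ≤ _ := by
        gcongr
        exact hb N hN n hn

end Market

end

/-! ### Expansion of the logarithm of one growth factor. -/

section

set_option maxHeartbeats 1000000 in
/-- Expansion of the logarithm of one discrete growth factor. -/
lemma log_growth_expansion {w g d R D s : ℝ} (hs0 : 0 ≤ s)
    (hR : |R| ≤ d) (hD : |D| ≤ d) (hs : s ≤ d) (hsmall : 16 * ((1 + |w|) * (|g| + d)) ≤ 1) :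
    0 < 1 + (1 - w) * R + w * (Real.exp (D + g - s / 2) - 1) ∧
    |Real.log (1 + (1 - w) * R + w * (Real.exp (D + g - s / 2) - 1))
      - ((1 - w) * R + w * D + w * g - w ^ 2 / 2 * s) - (w - w ^ 2) / 2 * (g ^ 2 - s)|
      ≤ 300 * ((1 + |w|) ^ 3 * ((|g| + d) ^ 3 + d * (|g| + d))) := by
  have hd0 : 0 ≤ d := hs0.trans hs
  set h : ℝ := |g| + d with hh
  set m : ℝ := 1 + |w| with hm
  have hg0 := abs_nonneg g
  have hw0 := abs_nonneg w
  have hh0 : 0 ≤ h := by positivity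
  have hm1 : 1 ≤ m := by linarith
  have hm0 : 0 ≤ m := by linarith
  have hgh : |g| ≤ h := by linarith
  have hdh : d ≤ h := by linarith
  have hwm : |w| ≤ m := by linarith
  have hmh : h ≤ m * h := le_mul_of_one_le_left hh0 hm1
  have hh1 : h ≤ 1 / 16 := by linarith
  have h1w : |1 - w| ≤ m := (abs_sub _ _).trans (by rw [abs_one])
  set q : ℝ := h ^ 3 + d * h with hq
  have hq0 : 0 ≤ q := by positivity
  have hdhq : d * h ≤ q := le_add_of_nonneg_left (by positivity)
  have hh3q : h ^ 3 ≤ q := le_add_of_nonneg_right (by positivity)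
  set y : ℝ := D + g - s / 2 with hy
  have hyg : |y - g| ≤ 3 / 2 * d := by
    rw [show y - g = D - s / 2 by rw [hy]; ring]
    refine (abs_sub _ _).trans ?_
    rw [abs_of_nonneg (by positivity : 0 ≤ s / 2)]
    linarith
  have hyh : |y| ≤ 3 / 2 * h := by
    have : |y| ≤ |y - g| + |g| := by
      calc |y| = |(y - g) + g| := by ring_nf
        _ ≤ _ := abs_add_le _ _
    linarith
  -- the return of the stock
  set e1 : ℝ := Real.exp y - (1 + y + y ^ 2 / 2) with he1
  have he1b : |e1| ≤ q := by
    refine (abs_exp_sub_two_le (by linarith : |y| ≤ 1)).trans ?_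
    have : |y| ^ 3 ≤ (3 / 2 * h) ^ 3 := pow_le_pow_left₀ (abs_nonneg _) hyh 3
    have h3 := pow_nonneg hh0 3
    have h4 : (3 / 2 * h) ^ 3 = 27 / 8 * h ^ 3 := by ring
    linarith
  set e2 : ℝ := y ^ 2 / 2 - g ^ 2 / 2 with he2
  have he2b : |e2| ≤ 2 * q := by
    have h1 : |y + g| ≤ 5 / 2 * h := (abs_add_le _ _).trans (by linarith)
    calc |e2| = |y - g| * |y + g| / 2 := by
          rw [← abs_mul, he2, ← abs_of_pos (two_pos (α := ℝ)), ← abs_div,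
            abs_of_pos (two_pos (α := ℝ))]
          congr 1
          ring
      _ ≤ (3 / 2 * d) * (5 / 2 * h) / 2 := by gcongr
      _ = 15 / 8 * (d * h) := by ring
      _ ≤ 2 * q := by linarith
  set u : ℝ := (1 - w) * R + w * (Real.exp y - 1) with hu
  -- In `exp y - 1 = y + y²/2 + e1` the square `y²` is replaced by `g²` at the cost of `e2`; the
  -- term `-s/2` of `y` compensates `g²/2`.
  have hu_eq : u = (1 - w) * R + w * D + w * g + w / 2 * (g ^ 2 - s) + w * (e1 + e2) := by
    rw [hu, he1, he2, hy]
    ring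
  have he12 : |w * (e1 + e2)| ≤ 3 * (m * q) := by
    rw [abs_mul]
    calc |w| * |e1 + e2| ≤ m * (q + 2 * q) := by
          gcongr
          exact (abs_add_le _ _).trans (add_le_add he1b he2b)
      _ = _ := by ring
  have hq' : q ≤ (h ^ 2 + d) / 16 := by
    have : q = h * (h ^ 2 + d) := by rw [hq]; ring
    rw [this, div_eq_mul_one_div, mul_comm]
    exact mul_le_mul_of_nonneg_left hh1 (by positivity)
  have hu0 : |u - w * g| ≤ m * (3 * d + h ^ 2) := by
    have h1 : |(1 - w) * R| ≤ m * d := by rw [abs_mul]; gcongr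
    have h2 : |w * D| ≤ m * d := by rw [abs_mul]; gcongr
    have h3 : |w / 2 * (g ^ 2 - s)| ≤ m * ((h ^ 2 + d) / 2) := by
      rw [abs_mul, abs_div, abs_of_pos (two_pos (α := ℝ))]
      have h4 : |g ^ 2 - s| ≤ h ^ 2 + d := by
        refine (abs_sub _ _).trans ?_
        rw [abs_pow, abs_of_nonneg hs0]
        gcongr
      calc |w| / 2 * |g ^ 2 - s| ≤ m / 2 * (h ^ 2 + d) := by gcongr
        _ = _ := by ring
    have h5 : m * q ≤ m * ((h ^ 2 + d) / 16) := mul_le_mul_of_nonneg_left hq' hm0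
    have h6 : u - w * g = (1 - w) * R + w * D + w / 2 * (g ^ 2 - s) + w * (e1 + e2) := by
      rw [hu_eq]; ring
    rw [h6]
    have h7 := abs_add_le ((1 - w) * R + w * D + w / 2 * (g ^ 2 - s)) (w * (e1 + e2))
    have h8 := abs_add_le ((1 - w) * R + w * D) (w / 2 * (g ^ 2 - s))
    have h9 := abs_add_le ((1 - w) * R) (w * D)
    have h10 : m * ((h ^ 2 + d) / 2) = (m * h ^ 2 + m * d) / 2 := by ring
    have h11 : m * ((h ^ 2 + d) / 16) = (m * h ^ 2 + m * d) / 16 := by ring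
    have h12 : m * (3 * d + h ^ 2) = 3 * (m * d) + m * h ^ 2 := by ring
    have h13 := mul_nonneg hm0 hd0
    have h14 := mul_nonneg hm0 (sq_nonneg h)
    linarith
  have hwg : |w * g| ≤ m * h := by rw [abs_mul]; gcongr
  have h3dh : 3 * d + h ^ 2 ≤ 4 * h := by
    have : h ^ 2 ≤ h := by
      rw [sq]
      exact mul_le_of_le_one_left hh0 (by linarith)
    linarith
  have hub : |u| ≤ 5 * (m * h) := by
    have h1 : |u| ≤ |u - w * g| + |w * g| := by
      calc |u| = |(u - w * g) + w * g| := by ring_nf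
        _ ≤ _ := abs_add_le _ _
    have h2 : m * (3 * d + h ^ 2) ≤ m * (4 * h) := mul_le_mul_of_nonneg_left h3dh hm0
    linarith
  have hu2 : |u| ≤ 1 / 2 := by linarith
  have hsq : |u ^ 2 - (w * g) ^ 2| ≤ 18 * (m ^ 2 * q) := by
    have h1 : |u + w * g| ≤ 6 * (m * h) := (abs_add_le _ _).trans (by linarith)
    calc |u ^ 2 - (w * g) ^ 2| = |u - w * g| * |u + w * g| := by
          rw [← abs_mul]
          congr 1
          ring
      _ ≤ (m * (3 * d + h ^ 2)) * (6 * (m * h)) := by gcongr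
      _ = m ^ 2 * (18 * (d * h) + 6 * h ^ 3) := by ring
      _ ≤ m ^ 2 * (18 * q) := by
          gcongr
          rw [hq]
          have := pow_nonneg hh0 3
          linarith
      _ = _ := by ring
  -- Third order Taylor remainder: `|u| ≤ 5 m h` gives `125`, and `1 - |u| ≥ 1/2` doubles it.
  have hlog : |Real.log (1 + u) - u + u ^ 2 / 2| ≤ 250 * (m ^ 3 * q) := by
    have h1 := Real.abs_log_sub_add_sum_range_le (x := -u) (by rw [abs_neg]; linarith) 2
    simp only [Finset.sum_range_succ, Finset.sum_range_zero, abs_neg, sub_neg_eq_add] at h1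
    norm_num at h1
    have h2 : |Real.log (1 + u) - u + u ^ 2 / 2| ≤ |u| ^ 3 / (1 - |u|) := by
      refine le_trans (le_of_eq ?_) h1
      congr 1
      ring
    refine h2.trans ?_
    rw [div_le_iff₀ (by linarith)]
    have h3 : |u| ^ 3 ≤ (5 * (m * h)) ^ 3 := pow_le_pow_left₀ (abs_nonneg _) hub 3
    have h4 : m ^ 3 * h ^ 3 ≤ m ^ 3 * q := by gcongr
    have h5 : 0 ≤ m ^ 3 * q := by positivity
    calc |u| ^ 3 ≤ (5 * (m * h)) ^ 3 := h3
      _ = 125 * (m ^ 3 * h ^ 3) := by ring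
      _ ≤ 250 * (m ^ 3 * q) * (1 / 2) := by linarith
      _ ≤ _ := by gcongr; linarith
  have h1u : 1 + (1 - w) * R + w * (Real.exp y - 1) = 1 + u := by rw [hu]; ring
  rw [h1u]
  refine ⟨by linarith [neg_abs_le u], ?_⟩
  -- The second order terms `w (g² - s) / 2 - w² g² / 2` equal `(w - w²)/2 * (g² - s) - w² s / 2`.
  -- The three errors left are at most `250`, `3` and `9` times `m³ q`, together below `300`.
  have hfin : Real.log (1 + u) - ((1 - w) * R + w * D + w * g - w ^ 2 / 2 * s)
      - (w - w ^ 2) / 2 * (g ^ 2 - s)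
      = (Real.log (1 + u) - u + u ^ 2 / 2) + w * (e1 + e2) - (u ^ 2 - (w * g) ^ 2) / 2 := by
    linear_combination hu_eq
  rw [hfin]
  have hmq1 : m * q ≤ m ^ 3 * q := by
    gcongr
    exact le_self_pow₀ hm1 (by norm_num)
  have hmq2 : m ^ 2 * q ≤ m ^ 3 * q := by
    gcongr
    norm_num
  have hmq0 : 0 ≤ m ^ 3 * q := by positivity
  have t1 := abs_sub ((Real.log (1 + u) - u + u ^ 2 / 2) + w * (e1 + e2))
    ((u ^ 2 - (w * g) ^ 2) / 2)
  have t2 := abs_add_le (Real.log (1 + u) - u + u ^ 2 / 2) (w * (e1 + e2))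
  have t3 : |(u ^ 2 - (w * g) ^ 2) / 2| ≤ 9 * (m ^ 2 * q) := by
    rw [abs_div, abs_of_pos (two_pos (α := ℝ))]
    linarith
  linarith

end

/-! ### Moments of the martingale part and of the remainder. -/

section

variable {Ω : Type*} {mΩ : MeasurableSpace Ω} {P : Measure Ω}
  {𝓕 : Filtration ℝ≥0 mΩ} {W : ℝ≥0 → Ω → ℝ}

/-- The increments of `J` over the observation windows. -/
def blockIncr (T : ℝ≥0) (J : ℝ≥0 → Ω → ℝ) (N k : ℕ) (ω : Ω) : ℝ :=
  J (obsTime T N (k + 1)) ω - J (obsTime T N k) ω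

/-- The integral of a deterministic function over an observation window. -/
def blockInt (T : ℝ≥0) (f : ℝ → ℝ) (N k : ℕ) : ℝ :=
  ∫ y in (obsTime T N k : ℝ)..obsTime T N (k + 1), f y

/-- The leading term of the difference of the logarithms of the two indices. -/
def martingalePart (T : ℝ≥0) (σ : ℝ → ℝ) (J : ℝ≥0 → Ω → ℝ) (lam v₀ σbar : ℝ)
    (S : ℝ≥0 → Ω → ℝ) (N : ℕ) (ω : Ω) : ℝ :=
  ∑ k ∈ Finset.range N, (leverage T lam v₀ σbar S N k ω - leverage T lam v₀ σbar S N k ω ^ 2) / 2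
    * (blockIncr T J N k ω ^ 2 - blockInt T (fun y => σ y ^ 2) N k)

/-- The bound for the remainder in the difference of the logarithms of the two indices. -/
def remainderBound (T : ℝ≥0) (C : ℝ) (J : ℝ≥0 → Ω → ℝ) (lam v₀ σbar : ℝ)
    (S : ℝ≥0 → Ω → ℝ) (N : ℕ) (ω : Ω) : ℝ :=
  ∑ k ∈ Finset.range N, (1 + |leverage T lam v₀ σbar S N k ω|) ^ 3 *
    ((|blockIncr T J N k ω| + C * (T / N)) ^ 3
      + C * (T / N) * (|blockIncr T J N k ω| + C * (T / N)))

lemma integral_le_of_lintegral_le {f g : Ω → ℝ} {C : ℝ} (hC : 0 ≤ C) (hf : Measurable f)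
    (hf0 : ∀ ω, 0 ≤ f ω) (hfg : ∀ ω, f ω ≤ g ω) (h : ∫⁻ ω, ENNReal.ofReal (g ω) ∂P ≤ ENNReal.ofReal C) :
    ∫ ω, f ω ∂P ≤ C := by
  rw [integral_eq_lintegral_of_nonneg_ae (ae_of_all _ hf0) hf.aestronglyMeasurable]
  exact ENNReal.toReal_le_of_le_ofReal hC
    ((lintegral_mono fun ω => ENNReal.ofReal_le_ofReal (hfg ω)).trans h)

/-- Odd powers are traded for even ones by Young type inequalities, so only second and fourth
Gaussian moments enter. The free parameter `e` will be `√(T / N)`, the typical size of an increment.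
-/
lemma remainder_le_poly {x d e : ℝ} (hd : 0 ≤ d) (he : 0 < e) :
    (|x| + d) ^ 3 + d * (|x| + d)
      ≤ (4 * e + d / e) * x ^ 2 + 4 / e * x ^ 4 + (4 * d ^ 3 + d * e + d ^ 2) := by
  set z := |x| with hz
  have hz0 : 0 ≤ z := abs_nonneg x
  have h2 : x ^ 2 = z ^ 2 := (sq_abs x).symm
  have h4 : x ^ 4 = z ^ 4 := (Even.pow_abs (by decide) x).symm
  rw [h2, h4]
  have h1 : z ^ 3 ≤ e * z ^ 2 + z ^ 4 / e := by
    have : e * z ^ 2 + z ^ 4 / e - z ^ 3 = z ^ 2 * ((e - z / 2) ^ 2 + 3 / 4 * z ^ 2) / e := by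
      field_simp
      ring
    have h : 0 ≤ z ^ 2 * ((e - z / 2) ^ 2 + 3 / 4 * z ^ 2) / e := by positivity
    linarith
  have h3 : z ≤ e + z ^ 2 / e := by
    have : e + z ^ 2 / e - z = ((e - z / 2) ^ 2 + 3 / 4 * z ^ 2) / e := by
      field_simp
      ring
    have h : 0 ≤ ((e - z / 2) ^ 2 + 3 / 4 * z ^ 2) / e := by positivity
    linarith
  have h5 : (z + d) ^ 3 ≤ 4 * (z ^ 3 + d ^ 3) := by
    have := add_pow_le hz0 hd 3
    norm_num at this
    exact this
  have h6 := mul_le_mul_of_nonneg_left h3 hd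
  have e1 : (4 * e + d / e) * z ^ 2 + 4 / e * z ^ 4 + (4 * d ^ 3 + d * e + d ^ 2)
    = 4 * (e * z ^ 2 + z ^ 4 / e) + 4 * d ^ 3 + d * (e + z ^ 2 / e) + d ^ 2 := by ring
  rw [e1]
  linarith

section Market

variable {T : ℝ≥0} {r ρ σ : ℝ → ℝ} {σlow : ℝ} {U : ℕ → SimpleProcess 𝓕} {J S : ℝ≥0 → Ω → ℝ}
  {lam v₀ σbar I₀ : ℝ} {N n : ℕ}

lemma IsMarket.exists_blockInt_le (h : IsMarket 𝓕 W P T r ρ σ σlow U J S) :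
    ∃ C : ℝ, 0 ≤ C ∧ ∀ N, 1 ≤ N → ∀ k < N, |blockInt T r N k| ≤ C * (T / N) ∧
      |blockInt T ρ N k| ≤ C * (T / N) ∧ blockInt T (fun y => σ y ^ 2) N k ≤ C * (T / N) ∧
      0 ≤ blockInt T (fun y => σ y ^ 2) N k := by
  obtain ⟨Cr, hr0, hCr⟩ := exists_ae_abs_le h.rate
  obtain ⟨Cp, hp0, hCp⟩ := exists_ae_abs_le h.drift
  obtain ⟨Cs, hs0, hCs⟩ := exists_ae_abs_le (memLp_sq h.vol)
  refine ⟨Cr + Cp + Cs, by positivity, fun N hN k hk => ?_⟩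
  have hst := obsTime_mono T N (Nat.le_succ k)
  have htT := obsTime_le (T := T) hN (Nat.succ_le_of_lt hk)
  have hΔ : 0 ≤ (T : ℝ) / N := by positivity
  have hb : ∀ {f : ℝ → ℝ} {C : ℝ}, C ≤ Cr + Cp + Cs →
      (∀ᵐ t ∂(volume.restrict (Set.Icc (0 : ℝ) T)), |f t| ≤ C) →
      |blockInt T f N k| ≤ (Cr + Cp + Cs) * (T / N) := fun hle hC => by
    have := abs_intervalIntegral_le hC hst htT
    rw [Nat.succ_eq_add_one, obsTime_succ_sub] at this
    exact this.trans (mul_le_mul_of_nonneg_right hle hΔ)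
  exact ⟨hb (by linarith) hCr, hb (by linarith) hCp,
    (le_abs_self _).trans (hb (by linarith) hCs), integral_sq_nonneg hst⟩

/-- The bound deteriorates as `n` grows; it serves integrability only, never the uniform estimates.
-/
lemma exists_abs_leverage_le (hlam : lam ∈ Set.Ioo (0 : ℝ) 1) (hv₀ : 0 < v₀) (N n : ℕ) :
    ∃ K : ℝ, ∀ ω, |leverage T lam v₀ σbar S N n ω| ≤ K := by
  refine ⟨|σbar| / √(lam ^ n * v₀), fun ω => ?_⟩
  have h0 : 0 < lam ^ n * v₀ := mul_pos (pow_pos hlam.1 n) hv₀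
  rw [leverage, abs_div, abs_of_nonneg (Real.sqrt_nonneg _)]
  exact div_le_div_of_nonneg_left (abs_nonneg _) (Real.sqrt_pos.2 h0)
    (Real.sqrt_le_sqrt (pow_mul_le_realisedVariance hlam N n ω))

lemma IsMarket.hasLaw_blockIncr (h : IsMarket 𝓕 W P T r ρ σ σlow U J S) (hN : 1 ≤ N)
    {k : ℕ} (hk : k < N) : HasLaw (blockIncr T J N k)
      (gaussianReal 0 (blockInt T (fun y => σ y ^ 2) N k).toNNReal) P :=
  h.wiener.hasLaw _ _ (obsTime_mono T N (Nat.le_succ k)) (obsTime_le hN hk)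

lemma IsMarket.measurable_blockIncr (h : IsMarket 𝓕 W P T r ρ σ σlow U J S) (N k : ℕ) :
    Measurable (blockIncr T J N k) :=
  ((h.wiener.adapted _).mono (𝓕.le _) le_rfl).sub ((h.wiener.adapted _).mono (𝓕.le _) le_rfl)

lemma IsMarket.measurable_leverage' (h : IsMarket 𝓕 W P T r ρ σ σlow U J S) (hN : 1 ≤ N)
    (hn : n ≤ N) : Measurable (leverage T lam v₀ σbar S N n) :=
  (h.measurable_leverage hN hn).mono (𝓕.le _) le_rfl

/-- Second moments of martingale transforms along the observation times. -/
lemma IsMarket.integral_sum_sq [IsProbabilityMeasure P]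
    (h : IsMarket 𝓕 W P T r ρ σ σlow U J S) (hN : 1 ≤ N)
    {ξ : ℕ → Ω → ℝ} (hξ : ∀ k ≤ N, Measurable[𝓕 (obsTime T N k)] (ξ k))
    (hξ2 : ∀ k ≤ N, MemLp (ξ k) 2 P) :
    (MemLp (fun ω => ∑ k ∈ Finset.range N, ξ k ω * blockIncr T J N k ω) 2 P ∧
      ∫ ω, (∑ k ∈ Finset.range N, ξ k ω * blockIncr T J N k ω) ^ 2 ∂P
        = ∑ k ∈ Finset.range N, blockInt T (fun y => σ y ^ 2) N k * ∫ ω, ξ k ω ^ 2 ∂P) ∧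
    (MemLp (fun ω => ∑ k ∈ Finset.range N, ξ k ω *
        (blockIncr T J N k ω ^ 2 - blockInt T (fun y => σ y ^ 2) N k)) 2 P ∧
      ∫ ω, (∑ k ∈ Finset.range N, ξ k ω *
        (blockIncr T J N k ω ^ 2 - blockInt T (fun y => σ y ^ 2) N k)) ^ 2 ∂P
        = ∑ k ∈ Finset.range N,
          sqVariance * blockInt T (fun y => σ y ^ 2) N k ^ 2 * ∫ ω, ξ k ω ^ 2 ∂P) := by
  -- The times are frozen at `T` after `N` steps: the noise lemmas want an infinite sequence, while
  -- `J` is controlled only up to `T`.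
  have hτ : Monotone fun k => obsTime T N (min k N) := fun i j hij =>
    obsTime_mono T N (min_le_min_right N hij)
  obtain ⟨h1, h2, h3⟩ := h.wiener.noise hτ fun k => obsTime_le hN (min_le_right k N)
  have n1 := isNoise_of_gaussian h1 h2 h3
  have n2 := isNoise_sq_of_gaussian h1 h2 h3
  have hm : ∀ k, Measurable[alongTimes 𝓕 hτ k] (ξ (min k N)) := fun k => hξ _ (min_le_right k N)
  have hm2 : ∀ k, MemLp (ξ (min k N)) 2 P := fun k => hξ2 _ (min_le_right k N)
  have hs0 : ∀ k, 0 ≤ ∫ y in (obsTime T N k : ℝ)..obsTime T N (k + 1), σ y ^ 2 := fun k =>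
    integral_sq_nonneg (obsTime_mono T N (Nat.le_succ k))
  have e1 : ∀ ω, ∑ k ∈ Finset.range N, ξ (min k N) ω *
      (J (obsTime T N (min (k + 1) N)) ω - J (obsTime T N (min k N)) ω)
      = ∑ k ∈ Finset.range N, ξ k ω * blockIncr T J N k ω := fun ω =>
    Finset.sum_congr rfl fun k hk => by
      have := Finset.mem_range.1 hk
      rw [min_eq_left this.le, min_eq_left (Nat.succ_le_of_lt this)]
      rfl
  have e2 : ∀ ω, ∑ k ∈ Finset.range N, ξ (min k N) ω *
      ((J (obsTime T N (min (k + 1) N)) ω - J (obsTime T N (min k N)) ω) ^ 2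
        - ((∫ y in (obsTime T N (min k N) : ℝ)..obsTime T N (min (k + 1) N),
          σ y ^ 2).toNNReal : ℝ))
      = ∑ k ∈ Finset.range N, ξ k ω *
        (blockIncr T J N k ω ^ 2 - blockInt T (fun y => σ y ^ 2) N k) := fun ω =>
    Finset.sum_congr rfl fun k hk => by
      have := Finset.mem_range.1 hk
      rw [min_eq_left this.le, min_eq_left (Nat.succ_le_of_lt this), Real.coe_toNNReal _ (hs0 k)]
      rfl
  have m1 := n1.memLp_sum hm hm2 N
  have m2 := n2.memLp_sum hm hm2 N
  have s1 := n1.integral_sum_sq hm hm2 N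
  have s2 := n2.integral_sum_sq hm hm2 N
  simp only [e1] at m1 s1
  simp only [e2] at m2 s2
  refine ⟨⟨m1, s1.trans (Finset.sum_congr rfl fun k hk => ?_)⟩,
    ⟨m2, s2.trans (Finset.sum_congr rfl fun k hk => ?_)⟩⟩
  all_goals
    have := Finset.mem_range.1 hk
    rw [min_eq_left this.le, min_eq_left (Nat.succ_le_of_lt this), Real.coe_toNNReal _ (hs0 k)]
    rfl

variable {C Cm : ℝ}

lemma IsMarket.memLp_leverage [IsProbabilityMeasure P]
    (h : IsMarket 𝓕 W P T r ρ σ σlow U J S) (hlam : lam ∈ Set.Ioo (0 : ℝ) 1) (hv₀ : 0 < v₀)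
    (hN : 1 ≤ N) (hn : n ≤ N) (p : ℝ≥0∞) : MemLp (leverage T lam v₀ σbar S N n) p P := by
  obtain ⟨K, hK⟩ := exists_abs_leverage_le (T := T) (S := S) (σbar := σbar) hlam hv₀ N n
  exact MemLp.of_bound (h.measurable_leverage' hN hn).aestronglyMeasurable K (ae_of_all _ hK)

/-- The `N` terms are orthogonal, and each has a second moment of order `N⁻²` because `((w - w²)/2)²
≤ (1 + |w|)⁴`. -/
lemma IsMarket.lintegral_martingalePart_le [IsProbabilityMeasure P]
    (h : IsMarket 𝓕 W P T r ρ σ σlow U J S) (hlam : lam ∈ Set.Ioo (0 : ℝ) 1) (hv₀ : 0 < v₀)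
    (hN : 1 ≤ N) (hC : ∀ k < N, blockInt T (fun y => σ y ^ 2) N k ≤ C * (T / N) ∧
      0 ≤ blockInt T (fun y => σ y ^ 2) N k) (hCm : 0 ≤ Cm)
    (hm : ∀ n ≤ N, ∫⁻ ω, ENNReal.ofReal ((1 + |leverage T lam v₀ σbar S N n ω|) ^ 4) ∂P
        ≤ ENNReal.ofReal Cm) :
    ∫⁻ ω, ENNReal.ofReal (martingalePart T σ J lam v₀ σbar S N ω ^ 2) ∂P
      ≤ ENNReal.ofReal (sqVariance * (C * T) ^ 2 * Cm / N) := by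
  have hN0 : (0 : ℝ) < N := by exact_mod_cast hN
  obtain ⟨-, m2, s2⟩ := h.integral_sum_sq hN
    (ξ := fun k ω => (leverage T lam v₀ σbar S N k ω - leverage T lam v₀ σbar S N k ω ^ 2) / 2)
    (fun k hk => ((h.measurable_leverage hN hk).sub
      ((h.measurable_leverage hN hk).pow_const 2)).div_const 2)
    (fun k hk => by
      obtain ⟨K, hK⟩ := exists_abs_leverage_le (T := T) (S := S) (σbar := σbar) hlam hv₀ N k
      have hmw := h.measurable_leverage' (lam := lam) (v₀ := v₀) (σbar := σbar) hN hk
      refine MemLp.of_bound ((hmw.sub (hmw.pow_const 2)).div_const 2).aestronglyMeasurable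
        ((K + K ^ 2) / 2) (ae_of_all _ fun ω => ?_)
      rw [Real.norm_eq_abs, abs_div, abs_of_pos (two_pos (α := ℝ))]
      have := abs_sub (leverage T lam v₀ σbar S N k ω) (leverage T lam v₀ σbar S N k ω ^ 2)
      rw [abs_pow] at this
      have h2 := pow_le_pow_left₀ (abs_nonneg _) (hK ω) 2
      have h3 := hK ω
      linarith)
  simp only [martingalePart]
  rw [← ofReal_integral_eq_lintegral_ofReal m2.integrable_sq (ae_of_all _ fun ω => sq_nonneg _)]
  refine ENNReal.ofReal_le_ofReal ?_
  refine s2.trans_le ?_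
  calc _ ≤ ∑ k ∈ Finset.range N, sqVariance * (C * (T / N)) ^ 2 * Cm := by
        refine Finset.sum_le_sum fun k hk => ?_
        have hk' := Finset.mem_range.1 hk
        have hmw := h.measurable_leverage' (lam := lam) (v₀ := v₀) (σbar := σbar) hN hk'.le
        have h1 : ∫ ω, ((leverage T lam v₀ σbar S N k ω
            - leverage T lam v₀ σbar S N k ω ^ 2) / 2) ^ 2 ∂P ≤ Cm := by
          refine integral_le_of_lintegral_le hCm (((hmw.sub (hmw.pow_const 2)).div_const 2).pow_const 2)
            (fun ω => sq_nonneg _) (fun ω => ?_) (hm k hk'.le)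
          set w := leverage T lam v₀ σbar S N k ω
          have h3 : |(w - w ^ 2) / 2| ≤ (1 + |w|) ^ 2 := by
            rw [abs_div, abs_of_pos (two_pos (α := ℝ))]
            have := abs_sub w (w ^ 2)
            rw [abs_pow] at this
            have := abs_nonneg w
            nlinarith [sq_nonneg |w|]
          calc ((w - w ^ 2) / 2) ^ 2 = |(w - w ^ 2) / 2| ^ 2 := (sq_abs _).symm
            _ ≤ ((1 + |w|) ^ 2) ^ 2 := pow_le_pow_left₀ (abs_nonneg _) h3 2
            _ = _ := by ring
        refine mul_le_mul (mul_le_mul_of_nonneg_left (pow_le_pow_left₀ (hC k hk').2 (hC k hk').1 2)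
          sqVariance_nonneg) h1 (integral_nonneg fun ω => sq_nonneg _)
          (mul_nonneg sqVariance_nonneg (sq_nonneg _))
    _ = _ := by
        rw [Finset.sum_const, Finset.card_range, nsmul_eq_mul]
        field_simp

/-- The leverage is independent of the increment over the following window, so each expectation
factorises into a leverage moment and a Gaussian moment of order `e³`, with `e = √(T / N)`. As `N e²
= T`, the sum is of order `e`. -/
lemma IsMarket.lintegral_remainder_le [IsProbabilityMeasure P]
    (h : IsMarket 𝓕 W P T r ρ σ σlow U J S)
    (hN : 1 ≤ N) (hC0 : 0 ≤ C) (hC : ∀ k < N, blockInt T (fun y => σ y ^ 2) N k ≤ C * (T / N) ∧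
      0 ≤ blockInt T (fun y => σ y ^ 2) N k)
    (hm : ∀ n ≤ N, ∫⁻ ω, ENNReal.ofReal ((1 + |leverage T lam v₀ σbar S N n ω|) ^ 4) ∂P
        ≤ ENNReal.ofReal Cm) :
    ∫⁻ ω, ENNReal.ofReal (remainderBound T C J lam v₀ σbar S N ω) ∂P
      ≤ ENNReal.ofReal (Cm * T * (√(T / N) * (5 * C + C ^ 2 + 4 * fourthMoment * C ^ 2
        + 4 * C ^ 3 * √(T / N) ^ 3 + C ^ 2 * √(T / N)))) := by
  have hN0 : (0 : ℝ) < N := by exact_mod_cast hN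
  have hT0 : (0 : ℝ) < T := by exact_mod_cast h.horizon_pos
  set e : ℝ := √(T / N) with hedef
  have he : 0 < e := Real.sqrt_pos.2 (by positivity)
  have he2 : (T : ℝ) / N = e ^ 2 := (Real.sq_sqrt (by positivity)).symm
  have hNe : (N : ℝ) * e ^ 2 = T := by rw [← he2]; field_simp
  set d : ℝ := C * (T / N) with hd
  have hd0 : 0 ≤ d := by positivity
  have hde : d = C * e ^ 2 := by rw [hd, he2]
  set K : ℝ := 5 * C + C ^ 2 + 4 * fourthMoment * C ^ 2 + 4 * C ^ 3 * e ^ 3 + C ^ 2 * e with hK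
  have hfm := fourthMoment_nonneg
  have hK0 : 0 ≤ K := by positivity
  let ψ : ℝ → ℝ := fun x => (|x| + d) ^ 3 + d * (|x| + d)
  have hψm : Measurable ψ := by
    have : Continuous ψ := by fun_prop
    exact this.measurable
  have hψ0 : ∀ x, 0 ≤ ψ x := fun x => by positivity
  have hψ : ∀ k < N, ∫⁻ ω, ENNReal.ofReal (ψ (blockIncr T J N k ω)) ∂P
      ≤ ENNReal.ofReal (e ^ 3 * K) := fun k hk => by
    have hl := h.hasLaw_blockIncr hN hk
    obtain ⟨hs1, hs0⟩ := hC k hk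
    set s := blockInt T (fun y => σ y ^ 2) N k
    have i2 : Integrable (fun ω => blockIncr T J N k ω ^ 2) P :=
      (memLp_of_hasLaw_gaussian hl (by norm_num)).integrable_sq
    have i4 := integrable_pow_four hl
    have v2 : ∫ ω, blockIncr T J N k ω ^ 2 ∂P = s := by
      have h2 := integral_sub i2 (integrable_const (μ := P) s)
      have h1 : ∫ ω, (blockIncr T J N k ω ^ 2 - s) ∂P = 0 := by
        have hi := hl.integral_comp (f := fun x => x ^ 2) (by fun_prop)
        simp only [Function.comp_def] at hi
        have hv := variance_fun_id_gaussianReal (μ := 0) (v := s.toNNReal)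
        rw [variance_of_integral_eq_zero (by fun_prop) (by simp)] at hv
        rw [h2, hi, hv, Real.coe_toNNReal _ hs0]
        simp
      rw [h2] at h1
      simpa [sub_eq_zero] using h1
    have v4 := integral_pow_four hl
    rw [Real.coe_toNNReal _ hs0] at v4
    calc _ ≤ ∫⁻ ω, ENNReal.ofReal ((4 * e + d / e) * blockIncr T J N k ω ^ 2
          + 4 / e * blockIncr T J N k ω ^ 4 + (4 * d ^ 3 + d * e + d ^ 2)) ∂P :=
          lintegral_mono fun ω => ENNReal.ofReal_le_ofReal (remainder_le_poly hd0 he)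
      _ = ENNReal.ofReal ((4 * e + d / e) * s + 4 / e * (fourthMoment * s ^ 2)
          + (4 * d ^ 3 + d * e + d ^ 2)) := by
          have j2 := i2.const_mul (4 * e + d / e)
          have j4 := i4.const_mul (4 / e)
          have j24 : Integrable (fun ω => (4 * e + d / e) * blockIncr T J N k ω ^ 2
            + 4 / e * blockIncr T J N k ω ^ 4) P := j2.add j4
          have j : Integrable (fun ω => (4 * e + d / e) * blockIncr T J N k ω ^ 2
            + 4 / e * blockIncr T J N k ω ^ 4 + (4 * d ^ 3 + d * e + d ^ 2)) P :=
            j24.add (integrable_const _)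
          rw [← ofReal_integral_eq_lintegral_ofReal j (ae_of_all _ fun ω => by positivity)]
          congr 1
          rw [integral_add j24 (integrable_const _), integral_add j2 j4,
            integral_const_mul, integral_const_mul, v2, v4]
          simp
      _ ≤ ENNReal.ofReal ((4 * e + d / e) * d + 4 / e * (fourthMoment * d ^ 2)
          + (4 * d ^ 3 + d * e + d ^ 2)) := by
          refine ENNReal.ofReal_le_ofReal ?_
          gcongr
      _ = _ := by
          congr 1
          rw [hde, hK]
          field_simp
          ring
  have hgm := fun k => h.measurable_blockIncr N k
  have hterm : ∀ k ∈ Finset.range N,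
      ∫⁻ ω, ENNReal.ofReal ((1 + |leverage T lam v₀ σbar S N k ω|) ^ 3) *
        ENNReal.ofReal (ψ (blockIncr T J N k ω)) ∂P
      ≤ ENNReal.ofReal Cm * ENNReal.ofReal (e ^ 3 * K) := fun k hk => by
    have hk' := Finset.mem_range.1 hk
    have hind := h.wiener.indep _ _ (obsTime_mono T N (Nat.le_succ k)) (obsTime_le hN hk')
    have hwm := h.measurable_leverage (lam := lam) (v₀ := v₀) (σbar := σbar) hN hk'.le
    have f1 : Measurable[𝓕 (obsTime T N k)] fun ω =>
        ENNReal.ofReal ((1 + |leverage T lam v₀ σbar S N k ω|) ^ 3) := by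
      have : Measurable fun x : ℝ => ENNReal.ofReal ((1 + |x|) ^ 3) :=
        (by fun_prop : Continuous fun x : ℝ => (1 + |x|) ^ 3).measurable.ennreal_ofReal
      exact this.comp hwm
    have f2 : Measurable[MeasurableSpace.comap
        (fun ω => J (obsTime T N (k + 1)) ω - J (obsTime T N k) ω) inferInstance] fun ω =>
        ENNReal.ofReal (ψ (blockIncr T J N k ω)) :=
      hψm.ennreal_ofReal.comp (comap_measurable _)
    rw [lintegral_mul_eq_lintegral_mul_lintegral_of_independent_measurableSpace (𝓕.le _)
      (hgm k).comap_le hind.symm f1 f2]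
    refine mul_le_mul' (le_trans (lintegral_mono fun ω => ENNReal.ofReal_le_ofReal ?_)
      (hm k hk'.le)) (hψ k hk')
    exact pow_le_pow_right₀ (by linarith [abs_nonneg (leverage T lam v₀ σbar S N k ω)])
      (by norm_num)
  calc _ = ∑ k ∈ Finset.range N, ∫⁻ ω, ENNReal.ofReal ((1 + |leverage T lam v₀ σbar S N k ω|) ^ 3) *
        ENNReal.ofReal (ψ (blockIncr T J N k ω)) ∂P := by
        rw [← lintegral_finsetSum' _ fun k hk => ?_]
        · refine lintegral_congr fun ω => ?_
          rw [remainderBound, ENNReal.ofReal_sum_of_nonneg fun k _ => by positivity]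
          refine Finset.sum_congr rfl fun k _ => ?_
          rw [ENNReal.ofReal_mul (by positivity)]
        · have hwm := h.measurable_leverage' (lam := lam) (v₀ := v₀) (σbar := σbar) hN
            (Finset.mem_range.1 hk).le
          have g1 : Measurable fun ω => (1 + |leverage T lam v₀ σbar S N k ω|) ^ 3 :=
            (by fun_prop : Continuous fun x : ℝ => (1 + |x|) ^ 3).measurable.comp hwm
          exact (g1.ennreal_ofReal.mul (hψm.comp (hgm k)).ennreal_ofReal).aemeasurable
    _ ≤ ∑ k ∈ Finset.range N, ENNReal.ofReal Cm * ENNReal.ofReal (e ^ 3 * K) :=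
        Finset.sum_le_sum hterm
    _ = ENNReal.ofReal (Cm * T * (e * K)) := by
        rw [Finset.sum_const, Finset.card_range, nsmul_eq_mul,
          ← ENNReal.ofReal_mul' (by positivity), ← ENNReal.ofReal_natCast,
          ← ENNReal.ofReal_mul (by positivity)]
        congr 1
        rw [← hNe]
        ring

end Market

end

/-! ### Closeness of the logarithms in probability. -/

section

variable {Ω : Type*} {mΩ : MeasurableSpace Ω} {P : Measure Ω}
  {𝓕 : Filtration ℝ≥0 mΩ} {W : ℝ≥0 → Ω → ℝ}

section Market

variable {T : ℝ≥0} {r ρ σ : ℝ → ℝ} {σlow : ℝ} {U : ℕ → SimpleProcess 𝓕} {J S : ℝ≥0 → Ω → ℝ}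
  {lam v₀ σbar I₀ : ℝ} {N n : ℕ} {C Cm : ℝ}

/-- The drift of the logarithm is at most quadratic in the leverage; the fourth power is a crude
bound that fits the moment estimate at hand. -/
lemma abs_logGrowth_sub_le {w : Ω → ℝ} {k : ℕ} {d : ℝ} {ω : Ω}
    (hR : |blockInt T r N k| ≤ d) (hD : |blockInt T ρ N k| ≤ d)
    (hs : blockInt T (fun y => σ y ^ 2) N k ≤ d) (hs0 : 0 ≤ blockInt T (fun y => σ y ^ 2) N k) :
    |logGrowth r ρ σ J w (obsTime T N k) (obsTime T N (k + 1)) ω - w ω * blockIncr T J N k ω|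
      ≤ 3 * d * (1 + |w ω|) ^ 4 := by
  set m := 1 + |w ω| with hm
  have hw0 := abs_nonneg (w ω)
  have hm1 : 1 ≤ m := by linarith
  have hd0 : 0 ≤ d := hs0.trans hs
  have e : logGrowth r ρ σ J w (obsTime T N k) (obsTime T N (k + 1)) ω - w ω * blockIncr T J N k ω
      = (1 - w ω) * blockInt T r N k + w ω * blockInt T ρ N k
        - w ω ^ 2 / 2 * blockInt T (fun y => σ y ^ 2) N k := by
    simp only [logGrowth, blockIncr, blockInt]
    ring
  rw [e]
  have hm4 : m ≤ m ^ 4 := le_self_pow₀ hm1 (by norm_num)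
  have hm24 : m ^ 2 ≤ m ^ 4 := pow_le_pow_right₀ hm1 (by norm_num)
  have h1 : |(1 - w ω) * blockInt T r N k| ≤ m ^ 4 * d := by
    rw [abs_mul]
    have : |1 - w ω| ≤ m := (abs_sub _ _).trans (by rw [abs_one])
    exact mul_le_mul (this.trans hm4) hR (abs_nonneg _) (by positivity)
  have h2 : |w ω * blockInt T ρ N k| ≤ m ^ 4 * d := by
    rw [abs_mul]
    exact mul_le_mul (le_trans (by linarith) hm4) hD (abs_nonneg _) (by positivity)
  have h3 : |w ω ^ 2 / 2 * blockInt T (fun y => σ y ^ 2) N k| ≤ m ^ 4 * d := by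
    rw [abs_mul, abs_of_nonneg hs0, abs_of_nonneg (by positivity)]
    refine mul_le_mul (le_trans ?_ hm24) hs hs0 (by positivity)
    rw [← sq_abs (w ω)]
    nlinarith
  have h4 := abs_sub ((1 - w ω) * blockInt T r N k + w ω * blockInt T ρ N k)
    (w ω ^ 2 / 2 * blockInt T (fun y => σ y ^ 2) N k)
  have h5 := abs_add_le ((1 - w ω) * blockInt T r N k) (w ω * blockInt T ρ N k)
  linarith

/-- The logarithm of the continuous time index is bounded in the mean. -/
lemma IsMarket.lintegral_abs_log_index_le [IsProbabilityMeasure P]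
    (h : IsMarket 𝓕 W P T r ρ σ σlow U J S) (hlam : lam ∈ Set.Ioo (0 : ℝ) 1) (hv₀ : 0 < v₀)
    (hI₀ : 0 < I₀) {I : ℝ≥0 → Ω → ℝ}
    (hI : IsContinuousIndex 𝓕 W P T lam v₀ σbar I₀ r ρ σ S N I) (hN : 1 ≤ N)
    (hC0 : 0 ≤ C) (hC : ∀ k < N, |blockInt T r N k| ≤ C * (T / N) ∧
      |blockInt T ρ N k| ≤ C * (T / N) ∧ blockInt T (fun y => σ y ^ 2) N k ≤ C * (T / N) ∧
      0 ≤ blockInt T (fun y => σ y ^ 2) N k) (hCm : 0 ≤ Cm)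
    (hm : ∀ n ≤ N, ∫⁻ ω, ENNReal.ofReal ((1 + |leverage T lam v₀ σbar S N n ω|) ^ 4) ∂P
        ≤ ENNReal.ofReal Cm) :
    ∫⁻ ω, ENNReal.ofReal |Real.log (I T ω)| ∂P
      ≤ ENNReal.ofReal (|Real.log I₀| + 1 + 4 * (C * T * Cm)) := by
  have hN0 : (0 : ℝ) < N := by exact_mod_cast hN
  have hT0 : (0 : ℝ) ≤ T := T.coe_nonneg
  set d : ℝ := C * (T / N) with hd
  have hd0 : 0 ≤ d := by positivity
  have hNd : N * d = C * T := by rw [hd]; field_simp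
  obtain ⟨⟨m1, s1⟩, -⟩ := h.integral_sum_sq hN (ξ := leverage T lam v₀ σbar S N)
    (fun k hk => h.measurable_leverage hN hk) (fun k hk => h.memLp_leverage hlam hv₀ hN hk 2)
  set B : Ω → ℝ := fun ω =>
    ∑ k ∈ Finset.range N, leverage T lam v₀ σbar S N k ω * blockIncr T J N k ω with hB
  have hBle : ∫ ω, B ω ^ 2 ∂P ≤ C * T * Cm := by
    refine s1.trans_le ?_
    calc _ ≤ ∑ k ∈ Finset.range N, d * Cm := by
          refine Finset.sum_le_sum fun k hk => ?_
          have hk' := Finset.mem_range.1 hk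
          have hmw := h.measurable_leverage' (lam := lam) (v₀ := v₀) (σbar := σbar) hN hk'.le
          refine mul_le_mul (hC k hk').2.2.1 ?_ (integral_nonneg fun ω => sq_nonneg _) hd0
          refine integral_le_of_lintegral_le hCm (hmw.pow_const 2)
            (fun ω => sq_nonneg _) (fun ω => ?_) (hm k hk'.le)
          have h0 := abs_nonneg (leverage T lam v₀ σbar S N k ω)
          rw [← sq_abs]
          calc |leverage T lam v₀ σbar S N k ω| ^ 2
              ≤ (1 + |leverage T lam v₀ σbar S N k ω|) ^ 2 :=
                pow_le_pow_left₀ h0 (by linarith) 2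
            _ ≤ _ := pow_le_pow_right₀ (by linarith) (by norm_num)
      _ = _ := by
          rw [Finset.sum_const, Finset.card_range, nsmul_eq_mul, ← hNd]
          ring
  have hwm4 : ∀ k ∈ Finset.range N, Measurable fun ω =>
      ENNReal.ofReal (3 * d * (1 + |leverage T lam v₀ σbar S N k ω|) ^ 4) := fun k hk => by
    have hmw := h.measurable_leverage' (lam := lam) (v₀ := v₀) (σbar := σbar) hN
      (Finset.mem_range.1 hk).le
    exact ((by fun_prop : Continuous fun x : ℝ => 3 * d * (1 + |x|) ^ 4).measurable.comp
      hmw).ennreal_ofReal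
  calc _ ≤ ∫⁻ ω, (ENNReal.ofReal (|Real.log I₀| + 1) + ENNReal.ofReal (B ω ^ 2)
        + ∑ k ∈ Finset.range N,
          ENNReal.ofReal (3 * d * (1 + |leverage T lam v₀ σbar S N k ω|) ^ 4)) ∂P := by
        refine lintegral_mono_ae ?_
        filter_upwards [h.index_eq hI hN] with ω hω
        rw [← ENNReal.ofReal_sum_of_nonneg fun k _ => by positivity,
          ← ENNReal.ofReal_add (by positivity) (sq_nonneg _),
          ← ENNReal.ofReal_add (by positivity) (Finset.sum_nonneg fun k _ => by positivity)]
        refine ENNReal.ofReal_le_ofReal ?_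
        rw [hω, Real.log_mul hI₀.ne' (Real.exp_pos _).ne', Real.log_exp]
        have h1 : ∑ k ∈ Finset.range N, logGrowth r ρ σ J (leverage T lam v₀ σbar S N k)
            (obsTime T N k) (obsTime T N (k + 1)) ω
            = B ω + ∑ k ∈ Finset.range N, (logGrowth r ρ σ J (leverage T lam v₀ σbar S N k)
              (obsTime T N k) (obsTime T N (k + 1)) ω
                - leverage T lam v₀ σbar S N k ω * blockIncr T J N k ω) := by
          rw [Finset.sum_sub_distrib]
          simp only [hB, add_sub_cancel]
        have h2 : |∑ k ∈ Finset.range N, (logGrowth r ρ σ J (leverage T lam v₀ σbar S N k)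
              (obsTime T N k) (obsTime T N (k + 1)) ω
                - leverage T lam v₀ σbar S N k ω * blockIncr T J N k ω)|
            ≤ ∑ k ∈ Finset.range N, 3 * d * (1 + |leverage T lam v₀ σbar S N k ω|) ^ 4 := by
          refine (Finset.abs_sum_le_sum_abs _ _).trans (Finset.sum_le_sum fun k hk => ?_)
          obtain ⟨a1, a2, a3, a4⟩ := hC k (Finset.mem_range.1 hk)
          exact abs_logGrowth_sub_le a1 a2 a3 a4
        -- The martingale term then enters through its second moment alone.
        have h3 : |B ω| ≤ 1 + B ω ^ 2 := by
          rw [← sq_abs]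
          nlinarith [sq_nonneg (|B ω| - 1), abs_nonneg (B ω)]
        rw [h1]
        refine (abs_add_le _ _).trans ?_
        have h4 := abs_add_le (B ω) (∑ k ∈ Finset.range N,
          (logGrowth r ρ σ J (leverage T lam v₀ σbar S N k)
              (obsTime T N k) (obsTime T N (k + 1)) ω
                - leverage T lam v₀ σbar S N k ω * blockIncr T J N k ω))
        linarith
    _ = ENNReal.ofReal (|Real.log I₀| + 1) + ENNReal.ofReal (∫ ω, B ω ^ 2 ∂P)
        + ∑ k ∈ Finset.range N,
          ∫⁻ ω, ENNReal.ofReal (3 * d * (1 + |leverage T lam v₀ σbar S N k ω|) ^ 4) ∂P := by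
        rw [lintegral_add_right _ (Finset.measurable_fun_sum _ hwm4),
          lintegral_add_left measurable_const, lintegral_finsetSum _ hwm4,
          ← ofReal_integral_eq_lintegral_ofReal m1.integrable_sq (ae_of_all _ fun ω => sq_nonneg _)]
        simp
    _ ≤ ENNReal.ofReal (|Real.log I₀| + 1) + ENNReal.ofReal (C * T * Cm)
        + ∑ k ∈ Finset.range N, ENNReal.ofReal (3 * d * Cm) := by
        refine add_le_add (add_le_add le_rfl (ENNReal.ofReal_le_ofReal hBle))
          (Finset.sum_le_sum fun k hk => ?_)
        simp_rw [ENNReal.ofReal_mul (by positivity : 0 ≤ 3 * d)]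
        rw [lintegral_const_mul' _ _ ENNReal.ofReal_ne_top]
        exact mul_le_mul' le_rfl (hm k (Finset.mem_range.1 hk).le)
    _ = _ := by
        rw [Finset.sum_const, Finset.card_range, nsmul_eq_mul, ← ENNReal.ofReal_natCast,
          ← ENNReal.ofReal_mul (by positivity), ← ENNReal.ofReal_add (by positivity) (by positivity),
          ← ENNReal.ofReal_add (by positivity) (by positivity)]
        congr 1
        linear_combination (3 * Cm) * hNd

/-- The difference of the logarithms is the martingale part up to the remainder bound. -/
lemma IsMarket.ae_log_sub_log [IsProbabilityMeasure P]
    (h : IsMarket 𝓕 W P T r ρ σ σlow U J S)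
    (hI₀ : 0 < I₀) {I : ℝ≥0 → Ω → ℝ}
    (hI : IsContinuousIndex 𝓕 W P T lam v₀ σbar I₀ r ρ σ S N I) (hN : 1 ≤ N)
    (hC0 : 0 ≤ C) (hC : ∀ k < N, |blockInt T r N k| ≤ C * (T / N) ∧
      |blockInt T ρ N k| ≤ C * (T / N) ∧ blockInt T (fun y => σ y ^ 2) N k ≤ C * (T / N) ∧
      0 ≤ blockInt T (fun y => σ y ^ 2) N k) :
    ∀ᵐ ω ∂P, remainderBound T C J lam v₀ σbar S N ω ≤ (1 / 16) ^ 3 →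
      0 < discreteIndex T lam v₀ σbar I₀ r S N T ω ∧
      |Real.log (discreteIndex T lam v₀ σbar I₀ r S N T ω) - Real.log (I T ω)
        - martingalePart T σ J lam v₀ σbar S N ω| ≤ 300 * remainderBound T C J lam v₀ σbar S N ω := by
  filter_upwards [h.index_eq hI hN, h.simpleReturn_eq hN] with ω hIω hSω hsmall
  set d : ℝ := C * (T / N) with hd
  have hd0 : 0 ≤ d := by positivity
  set w : ℕ → ℝ := fun k => leverage T lam v₀ σbar S N k ω with hw
  set g : ℕ → ℝ := fun k => blockIncr T J N k ω with hg
  let f : ℕ → ℝ := fun k => 1 + (1 - w k) * blockInt T r N k + w k *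
    (Real.exp (blockInt T ρ N k + g k - blockInt T (fun y => σ y ^ 2) N k / 2) - 1)
  let ℓ : ℕ → ℝ := fun k => (1 - w k) * blockInt T r N k + w k * blockInt T ρ N k + w k * g k
    - w k ^ 2 / 2 * blockInt T (fun y => σ y ^ 2) N k
  let b : ℕ → ℝ := fun k => (1 + |w k|) ^ 3 * ((|g k| + d) ^ 3 + d * (|g k| + d))
  have hstep : ∀ k ∈ Finset.range N, 0 < f k ∧ |Real.log (f k) - ℓ k - (w k - w k ^ 2) / 2 *
      (g k ^ 2 - blockInt T (fun y => σ y ^ 2) N k)| ≤ 300 * b k := by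
    intro k hk
    obtain ⟨a1, a2, a3, a4⟩ := hC k (Finset.mem_range.1 hk)
    refine log_growth_expansion a4 a1 a2 a3 ?_
    have h1 : b k ≤ (1 / 16) ^ 3 := by
      refine le_trans (Finset.single_le_sum (f := b) (fun j _ => ?_) hk) hsmall
      positivity
    -- Smallness of the total remainder bound forces the smallness condition of the expansion in
    -- every window at once, so no separate maximal estimate is needed.
    have h2 : ((1 + |w k|) * (|g k| + d)) ^ 3 ≤ (1 / 16) ^ 3 := by
      refine le_trans ?_ h1
      rw [mul_pow]
      refine mul_le_mul_of_nonneg_left (le_add_of_nonneg_right (by positivity)) (by positivity)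
    have h3 := le_of_pow_le_pow_left₀ three_ne_zero (by norm_num) h2
    linarith
  have hprod : discreteIndex T lam v₀ σbar I₀ r S N T ω = I₀ * ∏ k ∈ Finset.range N, f k := by
    rw [discreteIndex_eq h.horizon_pos hN]
    congr 1
    refine Finset.prod_congr rfl fun k hk => ?_
    rw [hSω k (Finset.mem_range.1 hk)]
    simp only [f, logGrowth, blockInt, w, hg, blockIncr]
    congr 3
    ring_nf
  have hlog : Real.log (I T ω) = Real.log I₀ + ∑ k ∈ Finset.range N, ℓ k := by
    rw [hIω, Real.log_mul hI₀.ne' (Real.exp_pos _).ne', Real.log_exp]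
    congr 1
  have hpos : 0 < ∏ k ∈ Finset.range N, f k := Finset.prod_pos fun k hk => (hstep k hk).1
  rw [hprod, hlog, Real.log_mul hI₀.ne' hpos.ne',
    Real.log_prod fun k hk => (hstep k hk).1.ne']
  refine ⟨mul_pos hI₀ hpos, ?_⟩
  have e : Real.log I₀ + ∑ k ∈ Finset.range N, Real.log (f k)
      - (Real.log I₀ + ∑ k ∈ Finset.range N, ℓ k) - martingalePart T σ J lam v₀ σbar S N ω
      = ∑ k ∈ Finset.range N, (Real.log (f k) - ℓ k - (w k - w k ^ 2) / 2 *
      (g k ^ 2 - blockInt T (fun y => σ y ^ 2) N k)) := by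
    have e0 : martingalePart T σ J lam v₀ σbar S N ω = ∑ k ∈ Finset.range N,
      (w k - w k ^ 2) / 2 * (g k ^ 2 - blockInt T (fun y => σ y ^ 2) N k) := rfl
    rw [e0, Finset.sum_sub_distrib (fun k => Real.log (f k) - ℓ k),
      Finset.sum_sub_distrib (fun k => Real.log (f k)) ℓ]
    abel
  rw [e]
  refine (Finset.abs_sum_le_sum_abs _ _).trans ?_
  refine (Finset.sum_le_sum fun k hk => (hstep k hk).2).trans ?_
  rw [← Finset.mul_sum]
  exact le_rfl

lemma IsMarket.measurable_martingalePart (h : IsMarket 𝓕 W P T r ρ σ σlow U J S) (hN : 1 ≤ N) :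
    Measurable (martingalePart T σ J lam v₀ σbar S N) :=
  Finset.measurable_fun_sum _ fun k hk => by
    have hmw := h.measurable_leverage' (lam := lam) (v₀ := v₀) (σbar := σbar) hN
      (Finset.mem_range.1 hk).le
    exact ((hmw.sub (hmw.pow_const 2)).div_const 2).mul
      (((h.measurable_blockIncr N k).pow_const 2).sub_const _)

lemma IsMarket.measurable_remainderBound (h : IsMarket 𝓕 W P T r ρ σ σlow U J S) (hN : 1 ≤ N) :
    Measurable (remainderBound T C J lam v₀ σbar S N) :=
  Finset.measurable_fun_sum _ fun k hk => by
    have hmw := h.measurable_leverage' (lam := lam) (v₀ := v₀) (σbar := σbar) hN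
      (Finset.mem_range.1 hk).le
    exact ((by fun_prop : Continuous fun x : ℝ => (1 + |x|) ^ 3).measurable.comp hmw).mul
      ((by fun_prop : Continuous fun x : ℝ => (|x| + C * (T / N)) ^ 3
        + C * (T / N) * (|x| + C * (T / N))).measurable.comp (h.measurable_blockIncr N k))

lemma IsMarket.measurable_discreteIndex (h : IsMarket 𝓕 W P T r ρ σ σlow U J S) (hN : 1 ≤ N) :
    Measurable (discreteIndex T lam v₀ σbar I₀ r S N T) := by
  have : discreteIndex T lam v₀ σbar I₀ r S N T = _ :=
    funext fun ω => discreteIndex_eq h.horizon_pos hN ω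
  rw [this]
  refine (Finset.measurable_fun_prod _ fun k hk => ?_).const_mul I₀
  have hk' := Finset.mem_range.1 hk
  have hmw := h.measurable_leverage' (lam := lam) (v₀ := v₀) (σbar := σbar) hN hk'.le
  have hms := (h.measurable_simpleReturn hN hk').mono (𝓕.le _) le_rfl
  exact (((measurable_const.sub hmw).mul_const _).const_add 1).add (hmw.mul hms)

/-- The logarithms of the two indices approach each other in probability, and those of the
continuous time indices are bounded in the mean. -/
lemma IsMarket.tendsto_measure_log_sub_log [IsProbabilityMeasure P]
    (h : IsMarket 𝓕 W P T r ρ σ σlow U J S) (hlam : lam ∈ Set.Ioo (0 : ℝ) 1) (hv₀ : 0 < v₀)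
    (hI₀ : 0 < I₀) {I : ℕ → ℝ≥0 → Ω → ℝ}
    (hI : ∀ N, 1 ≤ N → IsContinuousIndex 𝓕 W P T lam v₀ σbar I₀ r ρ σ S N (I N)) :
    (∀ ε : ℝ, 0 < ε → Tendsto (fun N => P {ω | ¬(0 < discreteIndex T lam v₀ σbar I₀ r S N T ω ∧
      |Real.log (discreteIndex T lam v₀ σbar I₀ r S N T ω) - Real.log (I N T ω)| < ε)})
      atTop (𝓝 0)) ∧
    ∃ K : ℝ, ∀ N, 1 ≤ N → ∫⁻ ω, ENNReal.ofReal |Real.log (I N T ω)| ∂P ≤ ENNReal.ofReal K := by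
  obtain ⟨C, hC0, hC⟩ := h.exists_blockInt_le
  obtain ⟨Cm, hCm, hm⟩ := h.exists_lintegral_leverage_le hlam hv₀ σbar
  refine ⟨fun ε hε => ?_, _, fun N hN => h.lintegral_abs_log_index_le hlam hv₀ hI₀ (hI N hN) hN hC0
    (hC N hN) hCm (hm N hN)⟩
  set F : ℕ → Ω → ℝ≥0∞ := fun N ω => ENNReal.ofReal (remainderBound T C J lam v₀ σbar S N ω)
    + ENNReal.ofReal (martingalePart T σ J lam v₀ σbar S N ω ^ 2) with hF
  -- The three thresholds: validity of the expansion, remainder `300 * (ε / 900) = ε / 3`, and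
  -- martingale part below `ε / 3`.
  set η : ℝ := min ((1 / 16) ^ 3) (min (ε / 900) ((ε / 3) ^ 2)) with hη
  have hη0 : 0 < η := by positivity
  have hinv : Tendsto (fun N : ℕ => (T : ℝ) / N) atTop (𝓝 0) :=
    Tendsto.div_atTop tendsto_const_nhds tendsto_natCast_atTop_atTop
  have he : Tendsto (fun N : ℕ => √((T : ℝ) / N)) atTop (𝓝 0) := by simpa using hinv.sqrt
  have hlim1 : Tendsto (fun N : ℕ => ENNReal.ofReal (Cm * T * (√(T / N) * (5 * C + C ^ 2
      + 4 * fourthMoment * C ^ 2 + 4 * C ^ 3 * √(T / N) ^ 3 + C ^ 2 * √(T / N))))) atTop (𝓝 0) := by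
    have := (he.mul ((((he.pow 3).const_mul (4 * C ^ 3)).const_add
      (5 * C + C ^ 2 + 4 * fourthMoment * C ^ 2)).add (he.const_mul (C ^ 2)))).const_mul (Cm * T)
    simpa using ENNReal.tendsto_ofReal this
  have hlim2 : Tendsto (fun N : ℕ => ENNReal.ofReal (sqVariance * (C * T) ^ 2 * Cm / N)) atTop
      (𝓝 0) := by
    have : Tendsto (fun N : ℕ => sqVariance * (C * T) ^ 2 * Cm / (N : ℝ)) atTop (𝓝 0) :=
      Tendsto.div_atTop tendsto_const_nhds tendsto_natCast_atTop_atTop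
    simpa using ENNReal.tendsto_ofReal this
  have hlim := ENNReal.Tendsto.div_const (hlim1.add hlim2) (b := ENNReal.ofReal η)
    (Or.inr (by simpa using hη0))
  rw [add_zero, ENNReal.zero_div] at hlim
  refine tendsto_of_tendsto_of_tendsto_of_le_of_le' tendsto_const_nhds hlim
    (Eventually.of_forall fun _ => zero_le) ?_
  filter_upwards [eventually_ge_atTop 1] with N hN
  have hFm : AEMeasurable (F N) P := ((h.measurable_remainderBound hN).ennreal_ofReal.add
    ((h.measurable_martingalePart hN).pow_const 2).ennreal_ofReal).aemeasurable
  have hsub : ({ω | ¬(0 < discreteIndex T lam v₀ σbar I₀ r S N T ω ∧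
      |Real.log (discreteIndex T lam v₀ σbar I₀ r S N T ω) - Real.log (I N T ω)| < ε)} : Set Ω)
      ≤ᵐ[P] ({ω | ENNReal.ofReal η ≤ F N ω} : Set Ω) := by
    filter_upwards [h.ae_log_sub_log hI₀ (hI N hN) hN hC0 (hC N hN)] with ω hω hbad
    by_contra hlt
    have hlt' : F N ω < ENNReal.ofReal η := not_le.1 hlt
    refine hbad ?_
    have hΞ : remainderBound T C J lam v₀ σbar S N ω < η :=
      (ENNReal.ofReal_lt_ofReal_iff hη0).1 (lt_of_le_of_lt le_self_add hlt')
    have hM : martingalePart T σ J lam v₀ σbar S N ω ^ 2 < η :=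
      (ENNReal.ofReal_lt_ofReal_iff hη0).1 (lt_of_le_of_lt le_add_self hlt')
    obtain ⟨hpos, hle⟩ := hω (hΞ.le.trans (min_le_left _ _))
    refine ⟨hpos, ?_⟩
    have h1 : remainderBound T C J lam v₀ σbar S N ω < ε / 900 :=
      hΞ.trans_le ((min_le_right _ _).trans (min_le_left _ _))
    have h2 : |martingalePart T σ J lam v₀ σbar S N ω| < ε / 3 := by
      refine abs_lt_of_sq_lt_sq ?_ (by positivity)
      exact hM.trans_le ((min_le_right _ _).trans (min_le_right _ _))
    have h3 := abs_add_le (Real.log (discreteIndex T lam v₀ σbar I₀ r S N T ω)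
      - Real.log (I N T ω) - martingalePart T σ J lam v₀ σbar S N ω)
      (martingalePart T σ J lam v₀ σbar S N ω)
    rw [sub_add_cancel] at h3
    linarith
  calc _ ≤ P {ω | ENNReal.ofReal η ≤ F N ω} := measure_mono_ae hsub
    _ ≤ (∫⁻ ω, F N ω ∂P) / ENNReal.ofReal η :=
        meas_ge_le_lintegral_div hFm (by simpa using hη0) ENNReal.ofReal_ne_top
    _ ≤ _ := by
        refine ENNReal.div_le_div_right ?_ _
        rw [hF, lintegral_add_left (h.measurable_remainderBound hN).ennreal_ofReal]
        exact add_le_add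
          (h.lintegral_remainder_le hN hC0 (fun k hk => (hC N hN k hk).2.2) (hm N hN))
          (h.lintegral_martingalePart_le hlam hv₀ hN (fun k hk => (hC N hN k hk).2.2) hCm
            (hm N hN))

end Market

end

/-! ### From logarithms to indices and laws. -/

section

variable {Ω : Type*} {mΩ : MeasurableSpace Ω} {P : Measure Ω}

/-- The exponential is Lipschitz on bounded sets, so closeness of logarithms transfers where `log y`
stays in a fixed range. -/
lemma abs_sub_le_of_abs_log_sub_lt {x y ε R : ℝ} (hx : 0 < x) (hy : 0 < y) (hε : ε ≤ 1)
    (h : |Real.log x - Real.log y| < ε) (hR : |Real.log y| ≤ R) :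
    |x - y| ≤ Real.exp R * (2 * ε) := by
  set δ := Real.log x - Real.log y with hδ
  have h1 : x = y * Real.exp δ := by
    rw [hδ, Real.exp_sub, Real.exp_log hx, Real.exp_log hy]
    field_simp
  have h2 : y ≤ Real.exp R := by
    rw [← Real.log_le_iff_le_exp hy]
    exact (le_abs_self _).trans hR
  have h3 : |Real.exp δ - 1| ≤ 2 * |δ| := Real.abs_exp_sub_one_le (h.le.trans hε)
  rw [h1, show y * Real.exp δ - y = y * (Real.exp δ - 1) by ring, abs_mul, abs_of_pos hy]
  exact mul_le_mul h2 (h3.trans (by linarith)) (abs_nonneg _) (Real.exp_pos _).le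

variable {X Y : ℕ → Ω → ℝ} {K : ℝ}

/-- A bound in the mean gives uniform tightness. -/
lemma exists_measure_abs_gt_le {Z : ℕ → Ω → ℝ} (hZ : ∀ N, 1 ≤ N → Measurable (Z N))
    (hK : ∀ N, 1 ≤ N → ∫⁻ ω, ENNReal.ofReal |Z N ω| ∂P ≤ ENNReal.ofReal K)
    {δ : ℝ≥0∞} (hδ : 0 < δ) :
    ∃ R : ℝ, 0 < R ∧ ∀ N, 1 ≤ N → P {ω | R ≤ |Z N ω|} ≤ δ := by
  have hlim : Tendsto (fun n : ℕ => ENNReal.ofReal (K / (n + 1))) atTop (𝓝 0) := by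
    have : Tendsto (fun n : ℕ => K / ((n : ℝ) + 1)) atTop (𝓝 0) :=
      Tendsto.div_atTop tendsto_const_nhds
        (tendsto_atTop_add_const_right _ _ tendsto_natCast_atTop_atTop)
    simpa using ENNReal.tendsto_ofReal this
  obtain ⟨n, hn⟩ := (hlim.eventually_le_const hδ).exists
  have hpos : (0 : ℝ) < n + 1 := by positivity
  refine ⟨n + 1, hpos, fun N hN => le_trans ?_ hn⟩
  have hset : {ω | (n : ℝ) + 1 ≤ |Z N ω|}
      = {ω | ENNReal.ofReal (n + 1) ≤ ENNReal.ofReal |Z N ω|} := by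
    ext ω
    exact (ENNReal.ofReal_le_ofReal_iff (abs_nonneg _)).symm
  have hm : Measurable fun ω => |Z N ω| := (hZ N hN).norm
  rw [hset]
  refine (meas_ge_le_lintegral_div hm.ennreal_ofReal.aemeasurable (by simpa using hpos)
    ENNReal.ofReal_ne_top).trans ?_
  rw [ENNReal.ofReal_div_of_pos hpos]
  exact ENNReal.div_le_div_right (hK N hN) _

lemma tendsto_zero_of_forall_le_add {f : ℕ → ℝ≥0∞}
    (h : ∀ δ : ℝ≥0∞, 0 < δ → ∃ g : ℕ → ℝ≥0∞, Tendsto g atTop (𝓝 0) ∧ ∀ᶠ N in atTop, f N ≤ g N + δ) :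
    Tendsto f atTop (𝓝 0) := by
  rw [ENNReal.tendsto_nhds_zero]
  intro ε hε
  obtain ⟨g, hg, hle⟩ := h (ε / 2) (ENNReal.half_pos hε.ne')
  filter_upwards [hle, hg.eventually_le_const (ENNReal.half_pos hε.ne')] with N h1 h2
  calc f N ≤ g N + ε / 2 := h1
    _ ≤ ε / 2 + ε / 2 := add_le_add h2 le_rfl
    _ = ε := ENNReal.add_halves ε

/-- Positive variables which are tight on the logarithmic scale and whose logarithms approach each
other in probability approach each other in probability. -/
lemma tendstoInMeasure_sub_of_log (hY : ∀ N, 1 ≤ N → Measurable (Y N))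
    (hpos : ∀ N, 1 ≤ N → ∀ᵐ ω ∂P, 0 < Y N ω)
    (hD : ∀ ε : ℝ, 0 < ε → Tendsto (fun N =>
      P {ω | ¬(0 < X N ω ∧ |Real.log (X N ω) - Real.log (Y N ω)| < ε)}) atTop (𝓝 0))
    (hK : ∀ N, 1 ≤ N → ∫⁻ ω, ENNReal.ofReal |Real.log (Y N ω)| ∂P ≤ ENNReal.ofReal K)
    {a : ℝ} (ha : 0 < a) :
    Tendsto (fun N => P {ω | a ≤ |X N ω - Y N ω|}) atTop (𝓝 0) := by
  refine tendsto_zero_of_forall_le_add fun δ hδ => ?_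
  obtain ⟨R, hR0, hR⟩ := exists_measure_abs_gt_le (P := P) (Z := fun N ω => Real.log (Y N ω))
    (fun N hN => Real.measurable_log.comp (hY N hN)) hK hδ
  -- Chosen so that `exp R * (2 ε) ≤ a / 2 < a`.
  set ε : ℝ := min 1 (a / (4 * Real.exp R)) with hε
  have hε0 : 0 < ε := by positivity
  refine ⟨_, hD ε hε0, ?_⟩
  filter_upwards [eventually_ge_atTop 1] with N hN
  refine le_trans (measure_mono_ae ?_) ((measure_union_le _ _).trans
    (add_le_add le_rfl (hR N hN)))
  filter_upwards [hpos N hN] with ω hω hbad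
  by_contra hnot
  have hnot' : ¬(ω ∈ {ω | ¬(0 < X N ω ∧ |Real.log (X N ω) - Real.log (Y N ω)| < ε)} ∨
    ω ∈ {ω | R ≤ |Real.log (Y N ω)|}) := hnot
  simp only [Set.mem_ofPred_eq, not_or, not_not, not_le] at hnot'
  obtain ⟨⟨h1, h2⟩, h3⟩ := hnot'
  have h4 := abs_sub_le_of_abs_log_sub_lt h1 hω (min_le_left _ _) h2 h3.le
  have h5 : Real.exp R * (2 * ε) ≤ a / 2 := by
    have : ε ≤ a / (4 * Real.exp R) := min_le_right _ _
    rw [le_div_iff₀ (by positivity)] at this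
    linarith
  have h6 : a ≤ |X N ω - Y N ω| := hbad
  linarith

/-- Bounded continuous functionals of two sequences which approach each other in probability, one
of them tight, have asymptotically equal expectations. -/
lemma tendsto_integral_sub_of_tendsto_measure [IsProbabilityMeasure P] {U V : ℕ → Ω → ℝ}
    (hU : ∀ N, 1 ≤ N → Measurable (U N)) (hV : ∀ N, 1 ≤ N → Measurable (V N))
    (hD : ∀ ε : ℝ, 0 < ε → Tendsto (fun N => P {ω | ε ≤ |U N ω - V N ω|}) atTop (𝓝 0))
    (hK : ∀ N, 1 ≤ N → ∫⁻ ω, ENNReal.ofReal |V N ω| ∂P ≤ ENNReal.ofReal K) (f : ℝ →ᵇ ℝ) :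
    Tendsto (fun N => (∫ ω, f (U N ω) ∂P) - ∫ ω, f (V N ω) ∂P) atTop (𝓝 0) := by
  have hmain : Tendsto (fun N => ∫⁻ ω, ENNReal.ofReal |f (U N ω) - f (V N ω)| ∂P) atTop (𝓝 0) := by
    refine tendsto_zero_of_forall_le_add fun δ hδ => ?_
    obtain ⟨δ', hδ'0, hδ'⟩ : ∃ δ' : ℝ, 0 < δ' ∧ ENNReal.ofReal δ' ≤ δ / 2 := by
      rcases eq_or_ne δ ∞ with rfl | h'
      · exact ⟨1, one_pos, by simp [ENNReal.top_div]⟩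
      · have hne : δ / 2 ≠ ∞ := (ENNReal.div_lt_top h' (by norm_num)).ne
        refine ⟨(δ / 2).toReal, ENNReal.toReal_pos (by simpa using hδ.ne') hne, ?_⟩
        rw [ENNReal.ofReal_toReal hne]
    -- A bound for the oscillation of `f`; the `1` keeps it positive, so that it may be divided by.
    set M : ℝ := 2 * ‖f‖ + 1 with hM
    have hM0 : 0 < M := by positivity
    have hMbd : ∀ x y, |f x - f y| ≤ M := fun x y => by
      have h1 := f.norm_coe_le_norm x
      have h2 := f.norm_coe_le_norm y
      rw [Real.norm_eq_abs] at h1 h2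
      have := abs_sub (f x) (f y)
      linarith
    have hM0' : ENNReal.ofReal M ≠ 0 := by simpa using hM0
    obtain ⟨R, hR0, hR⟩ := exists_measure_abs_gt_le (P := P) hV hK
      (δ := δ / 2 / ENNReal.ofReal M)
      (ENNReal.div_pos (ENNReal.half_pos hδ.ne').ne' ENNReal.ofReal_ne_top)
    obtain ⟨ε, hε0, hε⟩ := Metric.uniformContinuousOn_iff.1
      ((isCompact_Icc (a := -(R + 1)) (b := R + 1)).uniformContinuousOn_of_continuous
        f.continuous.continuousOn) δ' hδ'0
    -- Closeness within `1` keeps `U N` in `[-(R + 1), R + 1]`, where `f` is uniformly continuous.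
    set ε' : ℝ := min ε 1 with hε'
    have hε'0 : 0 < ε' := by positivity
    refine ⟨fun N => ENNReal.ofReal M * P {ω | ε' ≤ |U N ω - V N ω|}, ?_, ?_⟩
    · simpa using ENNReal.Tendsto.const_mul (hD ε' hε'0) (Or.inr ENNReal.ofReal_ne_top)
    filter_upwards [eventually_ge_atTop 1] with N hN
    set A := {ω | ε' ≤ |U N ω - V N ω|} with hA
    set B := {ω | R ≤ |V N ω|} with hB
    have hAm : MeasurableSet A := measurableSet_le measurable_const ((hU N hN).sub (hV N hN)).norm
    have hBm : MeasurableSet B := measurableSet_le measurable_const (hV N hN).norm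
    calc ∫⁻ ω, ENNReal.ofReal |f (U N ω) - f (V N ω)| ∂P
        ≤ ∫⁻ ω, (A.indicator (fun _ => ENNReal.ofReal M) ω
          + B.indicator (fun _ => ENNReal.ofReal M) ω + ENNReal.ofReal δ') ∂P := by
          refine lintegral_mono fun ω => ?_
          by_cases h1 : ω ∈ A
          · rw [Set.indicator_of_mem h1, add_assoc]
            exact (ENNReal.ofReal_le_ofReal (hMbd _ _)).trans le_self_add
          by_cases h2 : ω ∈ B
          · rw [Set.indicator_of_mem h2]
            exact (ENNReal.ofReal_le_ofReal (hMbd _ _)).trans (le_add_self.trans le_self_add)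
          refine le_trans (ENNReal.ofReal_le_ofReal ?_) le_add_self
          have h3 : |U N ω - V N ω| < ε' := not_le.1 h1
          have h4 : |V N ω| < R := not_le.1 h2
          have h5 : |U N ω - V N ω| < ε := h3.trans_le (min_le_left _ _)
          have h6 : |U N ω - V N ω| < 1 := h3.trans_le (min_le_right _ _)
          rw [abs_lt] at h4 h6
          exact (hε _ ⟨by linarith [h4.1, h6.1], by linarith [h4.2, h6.2]⟩ _
            ⟨by linarith [h4.1], by linarith [h4.2]⟩ h5).le
      _ = ENNReal.ofReal M * P A + ENNReal.ofReal M * P B + ENNReal.ofReal δ' := by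
          rw [lintegral_add_right _ measurable_const,
            lintegral_add_left (measurable_const.indicator hAm), lintegral_indicator_const hAm,
            lintegral_indicator_const hBm]
          simp
      _ ≤ ENNReal.ofReal M * P A + ENNReal.ofReal M * (δ / 2 / ENNReal.ofReal M) + δ / 2 := by
          gcongr
          exact hR N hN
      _ = ENNReal.ofReal M * P A + δ := by
          rw [ENNReal.mul_div_cancel hM0' ENNReal.ofReal_ne_top, add_assoc, ENNReal.add_halves]
  have hreal := (ENNReal.tendsto_toReal ENNReal.zero_ne_top).comp hmain
  rw [ENNReal.toReal_zero] at hreal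
  refine squeeze_zero_norm' ?_ hreal
  filter_upwards [eventually_ge_atTop 1] with N hN
  have iU : Integrable (fun ω => f (U N ω)) P :=
    Integrable.of_bound (f.continuous.measurable.comp (hU N hN)).aestronglyMeasurable ‖f‖
      (ae_of_all _ fun ω => f.norm_coe_le_norm _)
  have iV : Integrable (fun ω => f (V N ω)) P :=
    Integrable.of_bound (f.continuous.measurable.comp (hV N hN)).aestronglyMeasurable ‖f‖
      (ae_of_all _ fun ω => f.norm_coe_le_norm _)
  rw [← integral_sub iU iV]
  refine (norm_integral_le_integral_norm _).trans_eq ?_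
  have hi : Integrable (fun ω => ‖f (U N ω) - f (V N ω)‖) P := (iU.sub iV).norm
  rw [integral_eq_lintegral_of_nonneg_ae (ae_of_all _ fun ω => norm_nonneg _)
    hi.aestronglyMeasurable]
  rfl

/-- The shift by one discards `N = 0`, for which there is no observation window and nothing is
assumed about the index. -/
lemma tendstoInMeasure_of_tendsto_abs {D : ℕ → Ω → ℝ}
    (h : ∀ a : ℝ, 0 < a → Tendsto (fun N => P {ω | a ≤ |D N ω|}) atTop (𝓝 0)) :
    TendstoInMeasure P (fun N => D (N + 1)) atTop (0 : Ω → ℝ) := by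
  rw [tendstoInMeasure_iff_norm]
  intro a ha
  simpa [Function.comp_def] using (h a ha).comp (tendsto_add_atTop_nat 1)

end

end VolTarget

end

/-! ### Assembly of the theorem. -/

theorem mainTheorem6 {Ω : Type*} {mΩ : MeasurableSpace Ω} (P : Measure Ω) [IsProbabilityMeasure P]
    (𝓕 : Filtration ℝ≥0 mΩ) (W : ℝ≥0 → Ω → ℝ) (hW : VolTarget.IsFilteredBrownian 𝓕 W P)
    (T : ℝ≥0) (hT : 0 < T)
    (r ρ σ : ℝ → ℝ)
    (hr : MemLp r ∞ (volume.restrict (Set.Icc (0 : ℝ) T)))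
    (hρ : MemLp ρ ∞ (volume.restrict (Set.Icc (0 : ℝ) T)))
    (hσ : MemLp σ ∞ (volume.restrict (Set.Icc (0 : ℝ) T)))
    (σlow σup : ℝ) (hσlow : 0 < σlow)
    (hσbd : ∀ᵐ t ∂(volume.restrict (Set.Icc (0 : ℝ) T)), σlow < σ t ∧ σ t < σup)
    (lam : ℝ) (hlam : lam ∈ Set.Ioo (0 : ℝ) 1)
    (v₀ I₀ σbar : ℝ) (hv₀ : 0 < v₀) (hI₀ : 0 < I₀)
    (S : ℝ≥0 → Ω → ℝ) (hS : VolTarget.IsStock 𝓕 W P T ρ σ S)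
    (I : ℕ → ℝ≥0 → Ω → ℝ)
    (hI : ∀ N : ℕ, 1 ≤ N →
      VolTarget.IsContinuousIndex 𝓕 W P T lam v₀ σbar I₀ r ρ σ S N (I N)) :
    -- both logarithms are meaningful
    (∀ N : ℕ, 1 ≤ N → ∀ᵐ ω ∂P, 0 < I N T ω) ∧
    Tendsto (fun N : ℕ => P {ω | 0 < VolTarget.discreteIndex T lam v₀ σbar I₀ r S N T ω})
      atTop (𝓝 1) ∧
    -- the difference of the logarithms tends to zero in distribution
    TendstoInDistribution
      (fun (N : ℕ) (ω : Ω) =>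
        Real.log (VolTarget.discreteIndex T lam v₀ σbar I₀ r S (N + 1) T ω)
          - Real.log (I (N + 1) T ω))
      atTop (fun _ : Ω => (0 : ℝ)) (fun _ => P) P ∧
    -- the laws of the two logarithms are asymptotically equal
    (∀ f : ℝ →ᵇ ℝ,
      Tendsto (fun N : ℕ =>
        (∫ ω, f (Real.log (VolTarget.discreteIndex T lam v₀ σbar I₀ r S N T ω)) ∂P)
          - ∫ ω, f (Real.log (I N T ω)) ∂P) atTop (𝓝 0)) ∧
    -- the two indices have the same limiting distribution
    (∀ (ν : Measure ℝ) [IsProbabilityMeasure ν],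
      TendstoInDistribution
          (fun (N : ℕ) (ω : Ω) => VolTarget.discreteIndex T lam v₀ σbar I₀ r S (N + 1) T ω)
          atTop (id : ℝ → ℝ) (fun _ => P) ν ↔
        TendstoInDistribution (fun (N : ℕ) (ω : Ω) => I (N + 1) T ω)
          atTop (id : ℝ → ℝ) (fun _ => P) ν) := by
  obtain ⟨U, J, hJ⟩ := VolTarget.exists_isWienerIntegral hW (hσ.mono_exponent le_top)
  have hM : VolTarget.IsMarket 𝓕 W P T r ρ σ σlow U J S :=
    ⟨hW, hT, hr, hρ, hσ, hσlow, hσbd.mono fun t ht => ht.1, hJ, hS⟩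
  obtain ⟨hD, K, hK⟩ := hM.tendsto_measure_log_sub_log hlam hv₀ hI₀ hI
  have hYm : ∀ N, 1 ≤ N → Measurable (I N T) := fun N hN =>
    ((hI N hN).sde.adapted T le_rfl).mono (𝓕.le T) le_rfl
  have hXm : ∀ N, 1 ≤ N → Measurable (VolTarget.discreteIndex T lam v₀ σbar I₀ r S N T) :=
    fun N hN => hM.measurable_discreteIndex hN
  have hpos : ∀ N, 1 ≤ N → ∀ᵐ ω ∂P, 0 < I N T ω := fun N hN => by
    filter_upwards [hM.index_eq (hI N hN) hN] with ω hω
    rw [hω]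
    exact mul_pos hI₀ (Real.exp_pos _)
  have hlogm : ∀ {Z : Ω → ℝ}, Measurable Z → Measurable fun ω => Real.log (Z ω) := fun hZ =>
    Real.measurable_log.comp hZ
  have hlogD : ∀ ε : ℝ, 0 < ε → Tendsto (fun N => P {ω | ε ≤
      |Real.log (VolTarget.discreteIndex T lam v₀ σbar I₀ r S N T ω) - Real.log (I N T ω)|})
      atTop (𝓝 0) := fun ε hε =>
    tendsto_of_tendsto_of_tendsto_of_le_of_le tendsto_const_nhds (hD ε hε) (fun _ => zero_le)
      fun N => measure_mono fun ω hω h => (not_le.2 h.2) hω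
  have hXY := VolTarget.tendstoInMeasure_of_tendsto_abs (P := P)
    (D := fun N ω => VolTarget.discreteIndex T lam v₀ σbar I₀ r S N T ω - I N T ω) fun a ha =>
    VolTarget.tendstoInMeasure_sub_of_log hYm hpos hD hK ha
  have hlogXY := VolTarget.tendstoInMeasure_of_tendsto_abs (P := P) (D := fun N ω =>
    Real.log (VolTarget.discreteIndex T lam v₀ σbar I₀ r S N T ω) - Real.log (I N T ω)) hlogD
  have hYX : TendstoInMeasure P (fun N ω => I (N + 1) T ω
      - VolTarget.discreteIndex T lam v₀ σbar I₀ r S (N + 1) T ω) atTop (0 : Ω → ℝ) := by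
    rw [tendstoInMeasure_iff_norm] at hXY ⊢
    intro a ha
    simpa [abs_sub_comm] using hXY a ha
  refine ⟨hpos, ?_, ?_, fun f => ?_, fun ν _ => ⟨fun h => ?_, fun h => ?_⟩⟩
  · have hneg : Tendsto (fun N =>
        P {ω | 0 < VolTarget.discreteIndex T lam v₀ σbar I₀ r S N T ω}ᶜ) atTop (𝓝 0) :=
      tendsto_of_tendsto_of_tendsto_of_le_of_le tendsto_const_nhds (hD 1 one_pos)
        (fun _ => zero_le) fun N => measure_mono fun ω hω h => hω h.1
    have h1 := ENNReal.Tendsto.sub (tendsto_const_nhds (x := (1 : ℝ≥0∞))) hneg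
      (Or.inl ENNReal.one_ne_top)
    rw [tsub_zero] at h1
    refine h1.congr' ?_
    filter_upwards [eventually_ge_atTop 1] with N hN
    have hm : MeasurableSet {ω | 0 < VolTarget.discreteIndex T lam v₀ σbar I₀ r S N T ω} :=
      measurableSet_lt measurable_const (hXm N hN)
    rw [← prob_compl_eq_one_sub hm.compl, compl_compl]
  · refine TendstoInMeasure.tendstoInDistribution_of_aemeasurable hlogXY (fun N => ?_)
      aemeasurable_const
    exact ((hlogm (hXm _ (Nat.le_add_left 1 N))).sub
      (hlogm (hYm _ (Nat.le_add_left 1 N)))).aemeasurable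
  · exact VolTarget.tendsto_integral_sub_of_tendsto_measure
      (U := fun N ω => Real.log (VolTarget.discreteIndex T lam v₀ σbar I₀ r S N T ω))
      (V := fun N ω => Real.log (I N T ω)) (fun N hN => hlogm (hXm N hN))
      (fun N hN => hlogm (hYm N hN)) hlogD hK f
  -- Slutsky's lemma, once in each direction: a perturbation vanishing in probability does not
  -- change the limit law.
  · exact tendstoInDistribution_of_tendstoInMeasure_sub _ _ h hYX
      fun N => (hYm _ (Nat.le_add_left 1 N)).aemeasurable
  · exact tendstoInDistribution_of_tendstoInMeasure_sub _ _ h hXY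
      fun N => (hXm _ (Nat.le_add_left 1 N)).aemeasurable
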